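/- Fix an integer $r\ge 1$. For $N\ge r$ let $\mathcal S_{N,r}=\{X\in\mathbb R^{N\times r}: X^\top X=N I_r\}$ be the normalized Stiefel manifold, let $\mu_{N\times r}$ be the uniform (left- and right-orthogonally invariant) probability measure on it, and let $V=V_N=[v_1,\dots,v_r]\in\mathcal S_{N,r}$ be the matrix of spikes. Put $m_{ij}(X)=\frac1N\langle v_i,x_j\rangle$. 1. (Condition 1.) There are constants $C_1,c_1,C_2,c_2,C_3>0$ depending only on $r$ such that, for every $N\ge r$, all spikes $V_N$ and all $\gamma_1>\gamma_2>0$, the set $$\mathcal C_1(\gamma_1,\gamma_2)=\Big\{X\in\mathcal S_{N,r}: \tfrac{\gamma_2}{\sqrt N}\le |m_{ij}(X)|<\tfrac{\gamma_1}{\sqrt N}\ \text{ for all } i,j\Big\}$$ satisfies $$\mu_{N\times r}\big(\mathcal C_1(\gamma_1,\gamma_2)^c\big)\le C_1e^{-c_1\gamma_1^2}+C_2e^{-c_2\gamma_2\sqrt N}+C_3\gamma_2 .$$ 2. (Condition 2.) There are constants $C_1,c_1,C_2,c_2,C_3>0$ depending only on $r$ such that, for every integer $p\ge3$, all $\lambda_1\ge\dots\ge\lambda_r>0$,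 every $N\ge r$, all spikes $V_N$ and all $\gamma_1>\gamma_3>0$, the set $$\mathcal C_2(\gamma_1,\gamma_3)=\Big\{X\in\mathcal S_{N,r}: \Big|\tfrac{\lambda_i\lambda_j m_{ij}(X)^{p-2}}{\lambda_k\lambda_\ell m_{k\ell}(X)^{p-2}}-1\Big|>\tfrac{\gamma_3}{\gamma_1}\ \text{ for all } (i,j)\ne(k,\ell)\Big\}$$ satisfies $$\mu_{N\times r}\big(\mathcal C_2(\gamma_1,\gamma_3)^c\big)\le C_1e^{-c_1\gamma_1^2}+C_2e^{-c_2\sqrt N\gamma_3}+C_3\sup_{i,j,k,\ell}\Big(1+\big(\tfrac{\lambda_i\lambda_j}{\lambda_k\lambda_\ell}\big)^{\frac2{p-2}}\Big)^{-\frac12}\gamma_3 .$$ 3. (Condition 0 at level $\infty$, in the weak sense.) Let $p\ge3$ be an integer and $\lambda_1\ge\dots\ge\lambda_r\ge0$. Let $W$ be an order-$p$ tensor on $\mathbb R^N$ with i.i.d. $\mathcal N(0,1)$ entries, with law $\mathbb P$, and put $H_0(X)=N^{-\frac{p-1}2}\sum_{j}\lambda_j\langle W,x_j^{\otimes p}\rangle$.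 For an integer $M\ge1$ let $L_0=-\frac1{\sqrt M}\langle\nabla H_0,\hat\nabla\,\cdot\,\rangle$, where $\hat\nabla$ is the Euclidean gradient, $\nabla f=\hat\nabla f-\frac1{2N}X(X^\top\hat\nabla f+\hat\nabla f^\top X)$ is the Riemannian gradient and the inner product is the trace inner product, and let $e^{tL_0}F(X)=F(\hat X_t)$, where $\hat X$ is the solution of $\frac{d}{dt}\hat X_t=-\frac1{\sqrt M}\nabla H_0(\hat X_t)$, $\hat X_0=X$. There are constants $C,c>0$ depending only on $p,r,\lambda_1,\dots,\lambda_r$ such that, for every $N\ge r$, all spikes $V_N$, all $M\ge1$, $\gamma_0>0$ and $T>0$, the ($W$-dependent) set $$\mathcal C_0^{\infty}(T,\gamma_0)=\Big\{X\in\mathcal S_{N,r}:\ \sup_{0\le t\le T}\big|e^{tL_0}L_0m_{ij}(X)\big|\le\tfrac{\gamma_0}{\sqrt N}\ \text{ for all } i,j\Big\}$$ satisfies $$(\mathbb P\otimes\mu_{N\times r})\big(X\notin\mathcal C_0^{\infty}(T,\gamma_0)\big)\le C\max(1,\sqrt N\,T)\,e^{-c\gamma_0^2},$$ and, with $\mathbb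 P$-probability at least $1-Ce^{-c\gamma_0^2}$, $$\mu_{N\times r}\big(\mathcal C_0^{\infty}(T,\gamma_0)^c\big)\le C\max(1,\sqrt N\,T)\,e^{-c\gamma_0^2}.$$ -/

import Mathlib

open MeasureTheory ProbabilityTheory

/-! ### The normalized Stiefel manifold and its uniform measure -/

/-- Matrices carry the product (equivalently Borel) sigma-algebra of their entries. -/
instance instMeasurableSpaceRealMatrix (N r : ℕ) :
    MeasurableSpace (Matrix (Fin N) (Fin r) ℝ) :=
  inferInstanceAs (MeasurableSpace (Fin N → Fin r → ℝ))

instance instBorelSpaceRealMatrix (N r : ℕ) : BorelSpace (Matrix (Fin N) (Fin r) ℝ) :=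
  inferInstanceAs (BorelSpace (Fin N → Fin r → ℝ))

/-- The normalized Stiefel manifold: `N × r` matrices `X` with `Xᵀ X = N I`. -/
def stiefel (N r : ℕ) : Set (Matrix (Fin N) (Fin r) ℝ) :=
  {X | X.transpose * X = (N : ℝ) • (1 : Matrix (Fin r) (Fin r) ℝ)}

instance instCompactSpaceOrthogonal (N : ℕ) :
    CompactSpace (Matrix.orthogonalGroup (Fin N) ℝ) := by
  refine isCompact_iff_compactSpace (s := ((Matrix.orthogonalGroup (Fin N) ℝ : Submonoid _) :
    Set (Matrix (Fin N) (Fin N) ℝ))).mp ?_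
  have hK : IsCompact (Set.pi Set.univ
      (fun _ : Fin N => Set.pi Set.univ (fun _ : Fin N => Set.Icc (-1 : ℝ) 1))) :=
    isCompact_univ_pi fun _ => isCompact_univ_pi fun _ => isCompact_Icc
  refine IsCompact.of_isClosed_subset hK ?_ ?_
  · have : ((Matrix.orthogonalGroup (Fin N) ℝ : Submonoid _) : Set (Matrix (Fin N) (Fin N) ℝ))
        = {A | A * A.transpose = 1} := by
      ext A
      exact Matrix.mem_orthogonalGroup_iff (Fin N) ℝ
    rw [this]
    exact isClosed_eq (by fun_prop) continuous_const
  · intro A hA i _ j _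
    have := entry_norm_bound_of_unitary hA i j
    rw [Real.norm_eq_abs, abs_le] at this
    exact this

/-- The Haar probability measure of the orthogonal group `O(N)`. -/
noncomputable def orthogonalHaar (N : ℕ) : Measure (Matrix.orthogonalGroup (Fin N) ℝ) :=
  Measure.haarMeasure ⊤

instance instIsProbabilityMeasureOrthogonalHaar (N : ℕ) :
    IsProbabilityMeasure (orthogonalHaar N) := by
  constructor
  have := Measure.haarMeasure_self (K₀ := (⊤ : TopologicalSpace.PositiveCompacts
    (Matrix.orthogonalGroup (Fin N) ℝ)))
  simpa [orthogonalHaar] using this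

instance instIsHaarMeasureOrthogonalHaar (N : ℕ) :
    (orthogonalHaar N).IsHaarMeasure := by
  unfold orthogonalHaar; infer_instance

/-- The reference frame `√N [e₁, …, e_r]`. -/
noncomputable def baseFrame (N r : ℕ) : Matrix (Fin N) (Fin r) ℝ :=
  Matrix.of fun a j => if (a : ℕ) = (j : ℕ) then Real.sqrt N else 0

/-- The uniform measure on the normalized Stiefel manifold: the law of `O [√N e₁, …, √N e_r]`
for `O` Haar distributed on `O(N)`. -/
noncomputable def uniformStiefel (N r : ℕ) : Measure (Matrix (Fin N) (Fin r) ℝ) :=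
  (orthogonalHaar N).map
    fun O : Matrix.orthogonalGroup (Fin N) ℝ =>
      (O : Matrix (Fin N) (Fin N) ℝ) * baseFrame N r

theorem measurable_orbit (N r : ℕ) : Measurable
    fun O : Matrix.orthogonalGroup (Fin N) ℝ =>
      (O : Matrix (Fin N) (Fin N) ℝ) * baseFrame N r := by
  apply Continuous.measurable
  fun_prop

instance instIsProbabilityMeasureUniformStiefel (N r : ℕ) :
    IsProbabilityMeasure (uniformStiefel N r) :=
  Measure.isProbabilityMeasure_map (measurable_orbit N r).aemeasurable

theorem baseFrame_mem_stiefel {N r : ℕ} (h : r ≤ N) : baseFrame N r ∈ stiefel N r := by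
  ext i j
  have hs : Real.sqrt N * Real.sqrt N = (N : ℝ) := Real.mul_self_sqrt (Nat.cast_nonneg N)
  simp only [baseFrame, Matrix.mul_apply, Matrix.transpose_apply, Matrix.of_apply,
    Matrix.smul_apply, Matrix.one_apply, smul_eq_mul]
  rw [Finset.sum_eq_single (Fin.castLE h i)]
  · by_cases hij : i = j
    · subst hij; simp [hs]
    · simp [hij, Fin.val_inj]
  · intro b _ hb
    have : (b : ℕ) ≠ (i : ℕ) := fun hbi => hb (Fin.ext hbi)
    simp [this]
  · simp

/-- The uniform measure is carried by the normalized Stiefel manifold. -/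
theorem uniformStiefel_compl_stiefel {N r : ℕ} (h : r ≤ N) :
    uniformStiefel N r (stiefel N r)ᶜ = 0 := by
  have hclosed : IsClosed (stiefel N r) := isClosed_eq (by fun_prop) continuous_const
  rw [uniformStiefel, Measure.map_apply (measurable_orbit N r) hclosed.measurableSet.compl]
  convert measure_empty (μ := orthogonalHaar N)
  ext O
  simp only [Set.mem_preimage, Set.mem_compl_iff, Set.mem_empty_iff_false, iff_false, not_not]
  have hO := (Matrix.mem_orthogonalGroup_iff' (Fin N) ℝ).mp O.2
  have hb := baseFrame_mem_stiefel h
  simp only [stiefel, Set.mem_ofPred_eq] at hb ⊢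
  rw [Matrix.transpose_mul, Matrix.mul_assoc, ← Matrix.mul_assoc _ _ (baseFrame N r), hO,
    Matrix.one_mul, hb]

/-- Invariance under left orthogonal transformations. -/
theorem uniformStiefel_map_left {N r : ℕ} (O : Matrix.orthogonalGroup (Fin N) ℝ) :
    (uniformStiefel N r).map (fun X => (O : Matrix (Fin N) (Fin N) ℝ) * X)
      = uniformStiefel N r := by
  have hm : Measurable fun X : Matrix (Fin N) (Fin r) ℝ =>
      (O : Matrix (Fin N) (Fin N) ℝ) * X := Continuous.measurable (by fun_prop)
  conv_rhs => rw [uniformStiefel, ← map_mul_left_eq_self (orthogonalHaar N) O]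
  rw [uniformStiefel, Measure.map_map hm (measurable_orbit N r),
    Measure.map_map (measurable_orbit N r) (measurable_const_mul O)]
  congr 1
  funext U
  simp [Function.comp, Matrix.mul_assoc]

/-- Invariance under right orthogonal transformations. -/
theorem uniformStiefel_map_right {N r : ℕ} (h : r ≤ N)
    (Q : Matrix.orthogonalGroup (Fin r) ℝ) :
    (uniformStiefel N r).map (fun X => X * (Q : Matrix (Fin r) (Fin r) ℝ))
      = uniformStiefel N r := by
  obtain ⟨k, rfl⟩ := Nat.exists_eq_add_of_le h
  have hQ := (Matrix.mem_orthogonalGroup_iff (Fin r) ℝ).mp Q.2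
  let A : Matrix (Fin (r + k)) (Fin (r + k)) ℝ :=
    (Matrix.fromBlocks (Q : Matrix (Fin r) (Fin r) ℝ) 0 0 (1 : Matrix (Fin k) (Fin k) ℝ)).submatrix
      finSumFinEquiv.symm finSumFinEquiv.symm
  have hA : A ∈ Matrix.orthogonalGroup (Fin (r + k)) ℝ := by
    rw [Matrix.mem_orthogonalGroup_iff]
    simp only [A, Matrix.transpose_submatrix, Matrix.submatrix_mul_equiv,
      Matrix.fromBlocks_transpose, Matrix.fromBlocks_multiply, hQ]
    simp [Matrix.fromBlocks_one]
  let U : Matrix.orthogonalGroup (Fin (r + k)) ℝ := ⟨A, hA⟩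
  have hb : baseFrame (r + k) r * (Q : Matrix (Fin r) (Fin r) ℝ) = A * baseFrame (r + k) r := by
    have hbase : baseFrame (r + k) r = (Matrix.fromRows
        (Real.sqrt ((r + k : ℕ) : ℝ) • (1 : Matrix (Fin r) (Fin r) ℝ)) 0).submatrix
        finSumFinEquiv.symm id := by
      ext a j
      obtain ⟨a, rfl⟩ := finSumFinEquiv.surjective a
      rcases a with a | a
      · simp [baseFrame, Matrix.one_apply, Fin.val_inj, Matrix.fromRows_apply_inl]
      · have : r + (a : ℕ) ≠ (j : ℕ) := by omega
        simp [baseFrame, Matrix.fromRows_apply_inr, this]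
    rw [hbase]
    ext a j
    obtain ⟨a, rfl⟩ := finSumFinEquiv.surjective a
    rw [Matrix.mul_apply, Matrix.mul_apply, ← finSumFinEquiv.sum_comp]
    rcases a with a | a
    · simp [A, Matrix.fromRows_apply_inl, Matrix.one_apply, mul_comm]
    · simp [A, Matrix.fromRows_apply_inr, Matrix.one_apply]
  have hm : Measurable fun X : Matrix (Fin (r + k)) (Fin r) ℝ =>
      X * (Q : Matrix (Fin r) (Fin r) ℝ) := Continuous.measurable (by fun_prop)
  have hH : (orthogonalHaar (r + k)).map (fun O => O * U) = orthogonalHaar (r + k) := by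
    have : IsProbabilityMeasure ((orthogonalHaar (r + k)).map (fun O => O * U)) :=
      Measure.isProbabilityMeasure_map (measurable_mul_const U).aemeasurable
    exact Measure.isHaarMeasure_eq_of_isProbabilityMeasure _ _
  conv_rhs => rw [uniformStiefel, ← hH]
  rw [uniformStiefel, Measure.map_map hm (measurable_orbit _ r),
    Measure.map_map (measurable_orbit _ r) (measurable_mul_const U)]
  congr 1
  funext O
  simp only [Function.comp, Matrix.mul_assoc, hb]
  simp [U, Matrix.mul_assoc]

/-! ### Correlations, noise Hamiltonian, gradients and the noise generator -/

/-- The correlations `m_{ij}(X) = N⁻¹ ⟨v_i, x_j⟩`, where `v_i` and `x_j` are the columns of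
`V` and `X`. -/
noncomputable def corr {N r : ℕ} (V : Matrix (Fin N) (Fin r) ℝ) (i j : Fin r)
    (X : Matrix (Fin N) (Fin r) ℝ) : ℝ :=
  (N : ℝ)⁻¹ * (V.transpose * X) i j

/-- The real order-`p` tensors on `ℝ^N`. -/
abbrev NoiseTensor (p N : ℕ) : Type := (Fin p → Fin N) → ℝ

/-- The law of an order-`p` tensor with i.i.d. standard Gaussian entries. -/
noncomputable def noiseLaw (p N : ℕ) : Measure (NoiseTensor p N) :=
  Measure.pi fun _ => gaussianReal 0 1

/-- The noise Hamiltonian `H₀(X) = N^{-(p-1)/2} ∑_j λ_j ⟨W, x_j^{⊗p}⟩`. -/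
noncomputable def noiseHamiltonian {p N r : ℕ} (lam : Fin r → ℝ) (W : NoiseTensor p N)
    (X : Matrix (Fin N) (Fin r) ℝ) : ℝ :=
  (N : ℝ) ^ (-(((p : ℝ) - 1) / 2)) *
    ∑ j : Fin r, lam j * ∑ a : Fin p → Fin N, W a * ∏ k : Fin p, X (a k) j

/-- The Euclidean gradient of a function of `N × r` matrices: the matrix of its partial
derivatives. -/
noncomputable def euclGrad {N r : ℕ} (F : Matrix (Fin N) (Fin r) ℝ → ℝ)
    (X : Matrix (Fin N) (Fin r) ℝ) : Matrix (Fin N) (Fin r) ℝ :=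
  Matrix.of fun a j => lineDeriv ℝ F X (Matrix.single a j 1)

/-- The Riemannian gradient on the normalized Stiefel manifold. -/
noncomputable def riemGrad {N r : ℕ} (F : Matrix (Fin N) (Fin r) ℝ → ℝ)
    (X : Matrix (Fin N) (Fin r) ℝ) : Matrix (Fin N) (Fin r) ℝ :=
  euclGrad F X - (1 / (2 * (N : ℝ))) •
    (X * (X.transpose * euclGrad F X + (euclGrad F X).transpose * X))

/-- The velocity `-M^{-1/2} ∇H₀(X)` of the pure-noise gradient flow. -/
noncomputable def noiseField {p N r : ℕ} (M : ℕ) (lam : Fin r → ℝ) (W : NoiseTensor p N)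
    (X : Matrix (Fin N) (Fin r) ℝ) : Matrix (Fin N) (Fin r) ℝ :=
  -((1 / Real.sqrt M) • riemGrad (noiseHamiltonian lam W) X)

/-- The noise generator `L₀ F = -M^{-1/2} ⟨∇H₀, ∇̂F⟩`, with the trace inner product. -/
noncomputable def noiseGen {p N r : ℕ} (M : ℕ) (lam : Fin r → ℝ) (W : NoiseTensor p N)
    (F : Matrix (Fin N) (Fin r) ℝ → ℝ) (X : Matrix (Fin N) (Fin r) ℝ) : ℝ :=
  -((1 / Real.sqrt M) *
    ((riemGrad (noiseHamiltonian lam W) X).transpose * euclGrad F X).trace)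

/-- `x` is the trajectory on the normalized Stiefel manifold, for times `t ≥ 0`, of the flow
`dx/dt = -M^{-1/2} ∇H₀(x)` started at `X`. -/
structure IsNoiseTrajectory {p N r : ℕ} (M : ℕ) (lam : Fin r → ℝ) (W : NoiseTensor p N)
    (X : Matrix (Fin N) (Fin r) ℝ) (x : ℝ → Matrix (Fin N) (Fin r) ℝ) : Prop where
  init : x 0 = X
  mem : ∀ t, 0 ≤ t → x t ∈ stiefel N r
  deriv : ∀ t, 0 ≤ t → ∀ a j,
    HasDerivWithinAt (fun s => x s a j) (noiseField M lam W (x t) a j) (Set.Ici 0) t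

open Classical in
/-- The flow of `-M^{-1/2} ∇H₀`. Since the field is smooth and tangent to the compact manifold,
each point `X` of the manifold has exactly one trajectory; the value off the manifold is
irrelevant. -/
noncomputable def noiseFlow {p N r : ℕ} (M : ℕ) (lam : Fin r → ℝ) (W : NoiseTensor p N)
    (t : ℝ) (X : Matrix (Fin N) (Fin r) ℝ) : Matrix (Fin N) (Fin r) ℝ :=
  if h : ∃ x, IsNoiseTrajectory M lam W X x then h.choose t else X

/-- The semigroup `e^{t L₀}` generated by the first-order operator `L₀`: composition with the
flow of its vector field. -/
noncomputable def noiseSemigroup {p N r : ℕ} (M : ℕ) (lam : Fin r → ℝ) (W : NoiseTensor p N)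
    (t : ℝ) (F : Matrix (Fin N) (Fin r) ℝ → ℝ) (X : Matrix (Fin N) (Fin r) ℝ) : ℝ :=
  F (noiseFlow M lam W t X)

/-! ### The conditions on the initialization

In the three predicates below `V N` is the matrix of spikes and `μ N` the initialization in
dimension `N`; the dimensions are those `N ≥ r` for which the manifold is nonempty. The constants
are explicit arguments, the same for all `N`. -/

/-- All initial correlations are of order `N^{-1/2}` in absolute value. -/
def condition1Set {N r : ℕ} (V : Matrix (Fin N) (Fin r) ℝ) (γ₁ γ₂ : ℝ) :
    Set (Matrix (Fin N) (Fin r) ℝ) :=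
  {X | X ∈ stiefel N r ∧ ∀ i j : Fin r,
    γ₂ / Real.sqrt N ≤ |corr V i j X| ∧ |corr V i j X| < γ₁ / Real.sqrt N}

def SatisfiesCondition1 {r : ℕ} (V : ∀ N, Matrix (Fin N) (Fin r) ℝ)
    (μ : ∀ N, Measure (Matrix (Fin N) (Fin r) ℝ)) (C₁ c₁ C₂ c₂ C₃ : ℝ) : Prop :=
  ∀ N, r ≤ N → ∀ γ₁ γ₂ : ℝ, 0 < γ₂ → γ₂ < γ₁ →
    μ N (condition1Set (V N) γ₁ γ₂)ᶜ ≤ ENNReal.ofReal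
      (C₁ * Real.exp (-c₁ * γ₁ ^ 2) + C₂ * Real.exp (-c₂ * γ₂ * Real.sqrt N) + C₃ * γ₂)

/-- The SNR-weighted initial correlations are separated. -/
def condition2Set {N r : ℕ} (p : ℕ) (lam : Fin r → ℝ) (V : Matrix (Fin N) (Fin r) ℝ)
    (γ₁ γ₃ : ℝ) : Set (Matrix (Fin N) (Fin r) ℝ) :=
  {X | X ∈ stiefel N r ∧ ∀ i j k l : Fin r, (i, j) ≠ (k, l) →
    γ₃ / γ₁ <
      |lam i * lam j * corr V i j X ^ (p - 2) / (lam k * lam l * corr V k l X ^ (p - 2)) - 1|}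

def SatisfiesCondition2 {r : ℕ} (p : ℕ) (lam : Fin r → ℝ) (V : ∀ N, Matrix (Fin N) (Fin r) ℝ)
    (μ : ∀ N, Measure (Matrix (Fin N) (Fin r) ℝ)) (C₁ c₁ C₂ c₂ C₃ : ℝ) : Prop :=
  ∀ N, r ≤ N → ∀ γ₁ γ₃ : ℝ, 0 < γ₃ → γ₃ < γ₁ →
    μ N (condition2Set p lam (V N) γ₁ γ₃)ᶜ ≤ ENNReal.ofReal
      (C₁ * Real.exp (-c₁ * γ₁ ^ 2) + C₂ * Real.exp (-c₂ * Real.sqrt N * γ₃)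
        + C₃ * (⨆ q : (Fin r × Fin r) × (Fin r × Fin r),
            (1 + ((lam q.1.1 * lam q.1.2) / (lam q.2.1 * lam q.2.2)) ^ (2 / ((p : ℝ) - 2)))
              ^ (-(1 / 2 : ℝ))) * γ₃)

/-- The event `sup_{t ≤ T} |e^{t L₀} L₀ m_{ij}(X)| ≤ γ₀ / √N` for all `i, j`, for the noise
realization `W`. -/
def condition0InftySet {p N r : ℕ} (M : ℕ) (lam : Fin r → ℝ) (V : Matrix (Fin N) (Fin r) ℝ)
    (W : NoiseTensor p N) (T γ₀ : ℝ) : Set (Matrix (Fin N) (Fin r) ℝ) :=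
  {X | X ∈ stiefel N r ∧ ∀ i j : Fin r, ∀ t ∈ Set.Icc 0 T,
    |noiseSemigroup M lam W t (noiseGen M lam W (corr V i j)) X| ≤ γ₀ / Real.sqrt N}

/-- Condition 0 at level `∞` in the weak sense. The event depends on the Gaussian tensor `W`
through `L₀`. The bound is stated for the joint law of `W` and an independent initialization, and
for the random number `μ N (…)` with high probability in `W`. The factor `max 1 (√N T)` is `√N T`
as soon as `T ≥ N^{-1/2}`. -/
def WeaklySatisfiesCondition0Infty {r : ℕ} (p M : ℕ) (lam : Fin r → ℝ)
    (V : ∀ N, Matrix (Fin N) (Fin r) ℝ) (μ : ∀ N, Measure (Matrix (Fin N) (Fin r) ℝ))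
    (C c : ℝ) : Prop :=
  ∀ N, r ≤ N → ∀ γ₀ T : ℝ, 0 < γ₀ → 0 < T →
    ((noiseLaw p N).prod (μ N)
        {q | q.2 ∉ condition0InftySet M lam (V N) q.1 T γ₀}
      ≤ ENNReal.ofReal (C * max 1 (Real.sqrt N * T) * Real.exp (-c * γ₀ ^ 2))) ∧
    (noiseLaw p N
        {W | ENNReal.ofReal (C * max 1 (Real.sqrt N * T) * Real.exp (-c * γ₀ ^ 2))
          < μ N (condition0InftySet M lam (V N) W T γ₀)ᶜ}
      ≤ ENNReal.ofReal (C * Real.exp (-c * γ₀ ^ 2)))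

/-!
# Initialization conditions for the uniform measure on the Stiefel manifold

A uniform point of the normalized Stiefel manifold is `O E` with `O` Haar distributed and `E` the
reference frame, so the correlation `m_{ij}` is an entry `⟨u_i, O e_j⟩` of a Haar orthogonal matrix.
Averaging over an auxiliary rotation shows that a column of `O` is a normalized Gaussian vector
(`orthogonalHaar_dotProduct_eq_gaussPi`). This gives sub-Gaussian tails and small-ball bounds at
scale `N^{-1/2}`, hence the bounds on the size of the correlations. Two correlations in the same
column combine to a single entry. For different columns the same averaging, over rotations fixing
the first of them, replaces the second by a Gaussian vector in a hyperplane
(`orthogonalHaar_two_columns_le`). A ratio of weighted powers of correlations close to one means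
that a combination `θ m_{ij} ± m_{kl}` is small, so small-ball bounds for such combinations give the
separation condition; the supremum of the signal-to-noise weights is at least `1/2` and plays no
further role.

For the noise flow the key fact is rotational equivariance. If `W` is a Gaussian tensor independent
of `O`, then `(O^{⊗p} W, O E)` has the same law as `(W, O E)`
(`noiseLaw_prod_uniformStiefel_apply`), and the flow of `O^{⊗p} W` started at `O E` is `O` applied
to the flow of `W` started at `E` (`noiseFlow_mul`). Given `W`, the velocity of `m_{ij}` at a fixed
time `t` is therefore, up to a factor at most `N^{-1/2}`, of the form `⟨u_i, O R⟩` with `R` a column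
of the gradient along the flow from `E`, which does not depend on `O`. As
`|R| = O(√N)` outside an event of exponentially small probability (a net bound for the norm of a
Gaussian multilinear form), the tail of a Haar column applies
(`noiseLaw_prod_uniformStiefel_noiseGen_ge_le`). Outside the same event the velocity changes by
`O(N^{-1/2})` over times `N^{-1/2}`, so a union bound over `O(max (1, √N T))` times controls the
supremum over `[0, T]`. For `γ₀` of order at least `√N` the norm bound on the tensor suffices, and
for bounded `γ₀` the claim is trivial. The statement conditional on `W` follows by the Markov
inequality, at the price of halving the exponent.

The flow is defined by choice of a trajectory; existence, uniqueness and joint continuity in the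
tensor and the starting point (which makes the fixed-time events measurable) are proved by cutting
the field off to a Lipschitz one and observing that the constraint `XᵀX = N` is preserved.
-/

/-! ### Standard Gaussian vectors -/

/-- The law of a vector of i.i.d. standard Gaussian coordinates. -/
noncomputable abbrev gaussPi (ι : Type*) [Fintype ι] : Measure (ι → ℝ) :=
  Measure.pi fun _ : ι => gaussianReal 0 1

theorem dotProduct_mulVec_mulVec_of_orthogonal {ι : Type*} [Fintype ι] [DecidableEq ι]
    {A : Matrix ι ι ℝ} (hA : A ∈ Matrix.orthogonalGroup ι ℝ) (x y : ι → ℝ) :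
    (A.mulVec x) ⬝ᵥ (A.mulVec y) = x ⬝ᵥ y := by
  rw [Matrix.dotProduct_mulVec, ← Matrix.mulVec_transpose, Matrix.mulVec_mulVec,
    (Matrix.mem_orthogonalGroup_iff' ι ℝ).mp hA, Matrix.one_mulVec]

theorem gaussPi_map_mulVec {ι : Type*} [Fintype ι] [DecidableEq ι]
    {A : Matrix ι ι ℝ} (hA : A ∈ Matrix.orthogonalGroup ι ℝ) :
    (gaussPi ι).map A.mulVec = gaussPi ι := by
  let f : EuclideanSpace ℝ ι →ₗᵢ[ℝ] EuclideanSpace ℝ ι :=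
    { toLinearMap := Matrix.toEuclideanLin A
      norm_map' := by
        intro x
        have h := dotProduct_mulVec_mulVec_of_orthogonal hA x.ofLp x.ofLp
        simp only [dotProduct, ← pow_two] at h
        rw [EuclideanSpace.norm_eq, EuclideanSpace.norm_eq]
        simp only [Real.norm_eq_abs, sq_abs]
        exact congrArg Real.sqrt h }
  have hf := stdGaussian_map (f.toLinearIsometryEquiv rfl)
  rw [← map_pi_eq_stdGaussian, Measure.map_map (by fun_prop) (by fun_prop)] at hf
  have hA' : Measurable A.mulVec := Continuous.measurable (by fun_prop)
  have h2 := congrArg (fun μ : Measure (EuclideanSpace ℝ ι) => μ.map WithLp.ofLp) hf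
  simp only at h2
  rw [Measure.map_map (by fun_prop) (by fun_prop),
    Measure.map_map (by fun_prop) (by fun_prop)] at h2
  have e1 : (WithLp.ofLp ∘ (f.toLinearIsometryEquiv rfl) ∘ WithLp.toLp 2 : (ι → ℝ) → ι → ℝ)
      = A.mulVec := by
    funext x
    rfl
  have e2 : (WithLp.ofLp ∘ WithLp.toLp 2 : (ι → ℝ) → ι → ℝ) = id := rfl
  rw [e1, e2, Measure.map_id] at h2
  exact h2

theorem measurePreserving_mulVec_gaussPi {ι : Type*} [Fintype ι] [DecidableEq ι]
    {A : Matrix ι ι ℝ} (hA : A ∈ Matrix.orthogonalGroup ι ℝ) :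
    MeasurePreserving A.mulVec (gaussPi ι) (gaussPi ι) :=
  ⟨Continuous.measurable (by fun_prop), gaussPi_map_mulVec hA⟩

theorem hasSubgaussianMGF_dotProduct_gaussPi {ι : Type*} [Fintype ι] {w : ι → ℝ}
    (hw : w ⬝ᵥ w ≤ 1) : HasSubgaussianMGF (fun g => w ⬝ᵥ g) 1 (gaussPi ι) := by
  have hid : ∀ i : ι, HasSubgaussianMGF (fun g : ι → ℝ => g i) 1 (gaussPi ι) := by
    intro i
    have hmap : (gaussPi ι).map (fun g : ι → ℝ => g i) = gaussianReal 0 1 :=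
      (measurePreserving_eval (fun _ : ι => gaussianReal 0 1) i).map_eq
    constructor
    · intro t
      have := integrable_exp_mul_gaussianReal (μ := 0) (v := 1) t
      rw [← hmap] at this
      exact this.comp_measurable (measurable_pi_apply i)
    · intro t
      rw [mgf_gaussianReal hmap]
      simp
  have hind : iIndepFun (fun (i : ι) (g : ι → ℝ) => w i * g i) (gaussPi ι) :=
    iIndepFun_pi (μ := fun _ : ι => gaussianReal 0 1) (X := fun i x => w i * x)
      (fun i => by fun_prop)
  have h := HasSubgaussianMGF.sum_of_iIndepFun hind (s := Finset.univ)
    (fun i _ => (hid i).const_mul (w i))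
  refine ⟨h.integrable_exp_mul, fun t => (h.mgf_le t).trans ?_⟩
  gcongr
  rw [← NNReal.coe_le_coe, NNReal.coe_sum]
  refine le_trans (le_of_eq (Finset.sum_congr rfl fun i _ => ?_)) hw
  change w i ^ 2 * 1 = w i * w i
  ring

theorem gaussPi_abs_dotProduct_ge_le {ι : Type*} [Fintype ι] {w : ι → ℝ} (hw : w ⬝ᵥ w ≤ 1)
    {s : ℝ} (hs : 0 ≤ s) :
    gaussPi ι {g | s ≤ |w ⬝ᵥ g|} ≤ ENNReal.ofReal (2 * Real.exp (-s ^ 2 / 2)) := by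
  have key : ∀ w : ι → ℝ, w ⬝ᵥ w ≤ 1 →
      gaussPi ι {g | s ≤ w ⬝ᵥ g} ≤ ENNReal.ofReal (Real.exp (-s ^ 2 / 2)) := by
    intro w hw
    have h2 := (hasSubgaussianMGF_dotProduct_gaussPi hw).measure_ge_le hs
    rw [← ENNReal.ofReal_toReal (measure_ne_top (gaussPi ι) _)]
    apply ENNReal.ofReal_le_ofReal
    change (gaussPi ι).real _ ≤ _
    simpa using h2
  have hsub : {g : ι → ℝ | s ≤ |w ⬝ᵥ g|} ⊆ {g | s ≤ w ⬝ᵥ g} ∪ {g | s ≤ (-w) ⬝ᵥ g} := by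
    intro g hg
    simp only [Set.mem_ofPred_eq, Set.mem_union, neg_dotProduct] at hg ⊢
    exact le_abs.mp hg
  calc _ ≤ _ := measure_mono hsub
    _ ≤ _ := measure_union_le _ _
    _ ≤ _ := add_le_add (key w hw) (key (-w) (by simpa using hw))
    _ = _ := by rw [← ENNReal.ofReal_add (by positivity) (by positivity)]; ring_nf

theorem gaussianReal_Icc_le (a b : ℝ) :
    gaussianReal 0 1 (Set.Icc a b) ≤ ENNReal.ofReal (b - a) := by
  rw [gaussianReal_apply _ one_ne_zero]
  calc ∫⁻ x in Set.Icc a b, gaussianPDF 0 1 x ≤ ∫⁻ _ in Set.Icc a b, 1 := by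
        apply lintegral_mono
        intro x
        rw [gaussianPDF_def, gaussianPDFReal_def]
        simp only
        rw [← ENNReal.ofReal_one]
        apply ENNReal.ofReal_le_ofReal
        have h1 : Real.exp (-(x - 0) ^ 2 / (2 * ((1 : NNReal) : ℝ))) ≤ 1 := by
          apply Real.exp_le_one_iff.mpr
          have : 0 ≤ (x - 0) ^ 2 := sq_nonneg _
          rw [NNReal.coe_one]
          linarith
        have h2 : (√(2 * Real.pi * ((1 : NNReal) : ℝ)))⁻¹ ≤ 1 := by
          apply inv_le_one_of_one_le₀
          rw [Real.one_le_sqrt, NNReal.coe_one]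
          linarith [Real.pi_gt_three]
        exact mul_le_one₀ h2 (Real.exp_pos _).le h1
    _ = _ := by simp

theorem integral_exp_neg_sq_gaussianReal :
    ∫ x, Real.exp (-x ^ 2) ∂(gaussianReal 0 1) = (√3)⁻¹ := by
  rw [integral_gaussianReal_eq_integral_smul one_ne_zero]
  have : ∀ x : ℝ, gaussianPDFReal 0 1 x • Real.exp (-x ^ 2)
      = (√(2 * Real.pi))⁻¹ * Real.exp (-(3 / 2) * x ^ 2) := by
    intro x
    rw [gaussianPDFReal_def]
    simp only [NNReal.coe_one, mul_one, sub_zero, smul_eq_mul]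
    rw [mul_assoc, ← Real.exp_add]
    ring_nf
  simp_rw [this]
  rw [integral_const_mul, integral_gaussian, ← Real.sqrt_inv, ← Real.sqrt_mul (by positivity),
    ← Real.sqrt_inv]
  congr 1
  field_simp

/-- Chernoff bound for `exp (-|g|²)`, whose expectation is `3^{-n/2}`. -/
theorem gaussPi_dotProduct_self_le (n : ℕ) :
    gaussPi (Fin n) {g | g ⬝ᵥ g ≤ (n : ℝ) / 4} ≤ ENNReal.ofReal (Real.exp (-n / 4)) := by
  have hprod : ∀ g : Fin n → ℝ, Real.exp (-(g ⬝ᵥ g)) = ∏ i, Real.exp (-g i ^ 2) := by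
    intro g
    rw [← Real.exp_sum, Finset.sum_neg_distrib]
    simp [dotProduct, pow_two]
  have hint : ∫ g, Real.exp (-(g ⬝ᵥ g)) ∂(gaussPi (Fin n)) = ((√3)⁻¹) ^ n := by
    simp_rw [hprod]
    rw [integral_fintype_prod_eq_pow (fun x : ℝ => Real.exp (-x ^ 2)),
      integral_exp_neg_sq_gaussianReal, Fintype.card_fin]
  have hcont : Continuous fun g : Fin n → ℝ => Real.exp (-(g ⬝ᵥ g)) := by
    unfold dotProduct; fun_prop
  have hI : Integrable (fun g : Fin n → ℝ => Real.exp (-(g ⬝ᵥ g))) (gaussPi (Fin n)) := by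
    refine Integrable.of_bound hcont.aestronglyMeasurable 1 (Filter.Eventually.of_forall ?_)
    intro g
    rw [Real.norm_eq_abs, abs_of_pos (Real.exp_pos _)]
    apply Real.exp_le_one_iff.mpr
    have : 0 ≤ g ⬝ᵥ g := Finset.sum_nonneg fun i _ => mul_self_nonneg _
    linarith
  have hm := mul_meas_ge_le_integral_of_nonneg
    (Filter.Eventually.of_forall fun g : Fin n → ℝ => (Real.exp_pos (-(g ⬝ᵥ g))).le) hI
    (Real.exp (-(n / 4)))
  rw [hint] at hm
  have hset : {g : Fin n → ℝ | Real.exp (-((n : ℝ) / 4)) ≤ Real.exp (-(g ⬝ᵥ g))}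
      = {g | g ⬝ᵥ g ≤ (n : ℝ) / 4} := by
    ext g; simp
  rw [hset] at hm
  rw [← ENNReal.ofReal_toReal (measure_ne_top (gaussPi (Fin n)) _)]
  apply ENNReal.ofReal_le_ofReal
  change (gaussPi (Fin n)).real _ ≤ _
  have h3 : (√3)⁻¹ ≤ Real.exp (-(1 / 2)) := by
    rw [Real.exp_neg]
    apply inv_anti₀ (Real.exp_pos _)
    apply Real.le_sqrt_of_sq_le
    rw [← Real.exp_nat_mul]
    have := Real.exp_one_lt_d9
    norm_num
    linarith
  have h4 : ((√3)⁻¹) ^ n ≤ Real.exp (-(n / 4)) * Real.exp (-n / 4) := by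
    calc ((√3)⁻¹) ^ n ≤ Real.exp (-(1 / 2)) ^ n := by gcongr
      _ = _ := by rw [← Real.exp_nat_mul, ← Real.exp_add]; ring_nf
  exact le_of_mul_le_mul_left (hm.trans h4) (Real.exp_pos _)

/-! ### Small balls for coordinates of a normalized Gaussian vector -/

theorem dotProduct_self_nonneg_real {ι : Type*} [Fintype ι] (x : ι → ℝ) : 0 ≤ x ⬝ᵥ x :=
  Finset.sum_nonneg fun _ _ => mul_self_nonneg _

/-- A partial orthonormal family `v i`, `i ∈ s`, extends to the columns of an orthogonal matrix. -/
theorem exists_orthogonal_mulVec_single_eq {ι : Type*} [Fintype ι] [DecidableEq ι]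
    (v : ι → ι → ℝ) (s : Set ι)
    (hv : ∀ i ∈ s, ∀ j ∈ s, v i ⬝ᵥ v j = if i = j then 1 else 0) :
    ∃ S ∈ Matrix.orthogonalGroup ι ℝ, ∀ i ∈ s, S.mulVec (Pi.single i 1) = v i := by
  have ho : Orthonormal ℝ (s.domRestrict fun i => (WithLp.toLp 2 (v i) : EuclideanSpace ℝ ι)) := by
    rw [orthonormal_iff_ite]
    intro i j
    have := hv i i.2 j j.2
    simp only [Set.domRestrict_apply]
    rw [EuclideanSpace.inner_toLp_toLp, star_trivial, dotProduct_comm, this]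
    simp [Subtype.ext_iff]
  obtain ⟨b, hb⟩ := ho.exists_orthonormalBasis_extension_of_card_eq (by simp)
  refine ⟨Matrix.of fun a i => b i a, ?_, ?_⟩
  · rw [Matrix.mem_orthogonalGroup_iff']
    ext i j
    have := orthonormal_iff_ite.mp b.orthonormal i j
    rw [EuclideanSpace.inner_eq_star_dotProduct] at this
    rw [Matrix.mul_apply, Matrix.one_apply, ← this]
    simp [dotProduct, mul_comm]
  · intro i hi
    ext a
    simp [hb i hi]

/-- The map `u ↦ u / √(1 - u²)`, inverse to `x ↦ x / √(1 + x²)`, is `4`-Lipschitz on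
`[-3/4, 3/4]`. -/
theorem abs_div_sqrt_sub_div_sqrt_le {u c : ℝ} (hu : |u| ≤ 3 / 4) (hc : |c| ≤ 3 / 4) :
    |u / √(1 - u ^ 2) - c / √(1 - c ^ 2)| ≤ 4 * |u - c| := by
  have aux : ∀ x : ℝ, |x| ≤ 3 / 4 → 5 / 8 ≤ √(1 - x ^ 2) ∧ √(1 - x ^ 2) ^ 2 = 1 - x ^ 2 := by
    intro x hx
    have hx2 : x ^ 2 ≤ (3 / 4) ^ 2 := sq_le_sq' (by linarith [(abs_le.mp hx).1]) (abs_le.mp hx).2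
    exact ⟨Real.le_sqrt_of_sq_le (by linarith), Real.sq_sqrt (by linarith)⟩
  obtain ⟨ha, ha2⟩ := aux u hu
  obtain ⟨hb, hb2⟩ := aux c hc
  set a := √(1 - u ^ 2)
  set b := √(1 - c ^ 2)
  have ha0 : 0 < a := by linarith
  have hb0 : 0 < b := by linarith
  have e : u / a - c / b = (u - c) * (1 / a + c * (u + c) / (a * b * (a + b))) := by
    have h1 : (b - a) * (a + b) = (u - c) * (u + c) := by linear_combination hb2 - ha2
    have hab : a + b ≠ 0 := by positivity
    field_simp
    linear_combination c * h1
  rw [e, abs_mul, mul_comm]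
  gcongr
  have h1 : |1 / a| ≤ 8 / 5 := by
    rw [abs_of_pos (by positivity), div_le_div_iff₀ ha0 (by norm_num)]
    linarith
  have h2 : |c * (u + c) / (a * b * (a + b))| ≤ 2.4 := by
    rw [abs_div, abs_of_pos (show 0 < a * b * (a + b) by positivity), div_le_iff₀ (by positivity),
      abs_mul]
    have h3 : 5 / 8 * (5 / 8) * (5 / 8 + 5 / 8) ≤ a * b * (a + b) := by gcongr
    have h4 : |c| * |u + c| ≤ 3 / 4 * (3 / 4 + 3 / 4) := by
      gcongr
      exact (abs_add_le _ _).trans (add_le_add hu hc)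
    linarith
  linarith [abs_add_le (1 / a) (c * (u + c) / (a * b * (a + b)))]

/-- The first coordinate of a normalized Gaussian vector, given the length `s` of the others: the
event is an interval of length `8 ε s` for `t`, because `t = s u / √(1 - u²)` is Lipschitz in
`u = t / √(t² + s²)`. -/
theorem gaussianReal_small_ball_of_normalized {c ε s : ℝ} (hc : |c| ≤ 1 / 2) (hε : ε ≤ 1 / 4)
    (hs : 0 ≤ s) :
    gaussianReal 0 1 {t | |t / √(t ^ 2 + s ^ 2) - c| ≤ ε} ≤ ENNReal.ofReal (8 * ε * s) := by
  have hsub : {t : ℝ | |t / √(t ^ 2 + s ^ 2) - c| ≤ ε} ⊆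
      Set.Icc (s * (c / √(1 - c ^ 2)) - 4 * ε * s) (s * (c / √(1 - c ^ 2)) + 4 * ε * s) := by
    intro t ht
    simp only [Set.mem_ofPred_eq] at ht
    set u := t / √(t ^ 2 + s ^ 2) with hu
    have hu34 : |u| ≤ 3 / 4 := by
      have := abs_sub_abs_le_abs_sub u c
      linarith
    have ht' : t = s * (u / √(1 - u ^ 2)) := by
      rcases eq_or_ne t 0 with h0 | h0
      · simp [hu, h0]
      have hpos : 0 < t ^ 2 + s ^ 2 := by positivity
      have h1 : 1 - u ^ 2 = s ^ 2 / (t ^ 2 + s ^ 2) := by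
        rw [hu, div_pow, Real.sq_sqrt hpos.le]
        field_simp
        ring
      have hs0 : s ≠ 0 := by
        rintro rfl
        have : u ^ 2 = 1 := by
          simp at h1
          linarith
        have h3 : |u| = 1 := by
          rw [← Real.sqrt_sq_eq_abs, this, Real.sqrt_one]
        linarith
      rw [h1, Real.sqrt_div (sq_nonneg s), Real.sqrt_sq hs, hu]
      have : √(t ^ 2 + s ^ 2) ≠ 0 := by positivity
      field_simp
    have hl := abs_div_sqrt_sub_div_sqrt_le hu34 (by linarith : |c| ≤ 3 / 4)
    have h5 : |t - s * (c / √(1 - c ^ 2))| ≤ 4 * ε * s := by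
      conv_lhs => rw [ht', ← mul_sub, abs_mul, abs_of_nonneg hs]
      nlinarith
    rw [abs_le] at h5
    constructor <;> linarith
  refine (measure_mono hsub).trans ((gaussianReal_Icc_le _ _).trans (le_of_eq ?_))
  congr 1
  ring

theorem lintegral_dotProduct_self_gaussPi (n : ℕ) :
    ∫⁻ g, ENNReal.ofReal (g ⬝ᵥ g) ∂(gaussPi (Fin n)) = n := by
  have h1 : ∫⁻ x, ENNReal.ofReal (x * x) ∂(gaussianReal 0 1) = 1 := by
    have hv := variance_id_gaussianReal (μ := 0) (v := 1)
    rw [variance_eq_integral (by fun_prop)] at hv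
    simp only [id_eq, integral_id_gaussianReal, sub_zero, NNReal.coe_one] at hv
    rw [← ofReal_integral_eq_lintegral_ofReal, ← ENNReal.ofReal_one]
    · congr 1
      simpa [pow_two] using hv
    · have := (memLp_id_gaussianReal (μ := 0) (v := 1) 2).integrable_sq
      simpa [pow_two] using this
    · exact Filter.Eventually.of_forall fun x => mul_self_nonneg x
  have h2 : ∀ g : Fin n → ℝ, ENNReal.ofReal (g ⬝ᵥ g) = ∑ i, ENNReal.ofReal (g i * g i) :=
    fun g => ENNReal.ofReal_sum_of_nonneg fun i _ => mul_self_nonneg _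
  simp_rw [h2]
  rw [lintegral_finsetSum _ (fun i _ => by fun_prop)]
  have h3 : ∀ i : Fin n, ∫⁻ g : Fin n → ℝ, ENNReal.ofReal (g i * g i) ∂(gaussPi (Fin n)) = 1 := by
    intro i
    rw [← h1]
    exact (measurePreserving_eval (fun _ : Fin n => gaussianReal 0 1) i).lintegral_comp
      (f := fun x => ENNReal.ofReal (x * x)) (by fun_prop)
  simp [h3]

/-- A coordinate of a normalized Gaussian vector has bounded density at scale `n^{-1/2}` on
`[-1/2, 1/2]`. -/
theorem gaussPi_small_ball {n : ℕ} {w : Fin n → ℝ} (hw : w ⬝ᵥ w = 1) {c ε : ℝ}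
    (hc : |c| ≤ 1 / 2) (hε : 0 ≤ ε) :
    gaussPi (Fin n) {g | |w ⬝ᵥ g / √(g ⬝ᵥ g) - c| ≤ ε} ≤ ENNReal.ofReal (8 * ε * √n) := by
  rcases n with _ | m
  · simp at hw
  have hn1 : 1 ≤ √((m + 1 : ℕ) : ℝ) := by
    rw [Real.one_le_sqrt]; push_cast; linarith [(Nat.cast_nonneg m : (0 : ℝ) ≤ m)]
  rcases le_or_gt ε (1 / 4) with hε4 | hε4
  swap
  · refine prob_le_one.trans ?_
    rw [ENNReal.one_le_ofReal]
    nlinarith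
  -- Rotate `w` to the first coordinate vector.
  obtain ⟨S, hS, hSw⟩ := exists_orthogonal_mulVec_single_eq (fun _ : Fin (m + 1) => w) {0}
    (by simp [hw])
  have hSw : S.mulVec (Pi.single 0 1) = w := hSw 0 rfl
  have hmeas : ∀ w : Fin (m + 1) → ℝ, MeasurableSet
      {g : Fin (m + 1) → ℝ | |w ⬝ᵥ g / √(g ⬝ᵥ g) - c| ≤ ε} := by
    intro w
    unfold dotProduct
    exact measurableSet_le (by fun_prop) measurable_const
  rw [← (measurePreserving_mulVec_gaussPi hS).measure_preimage (hmeas w).nullMeasurableSet]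
  have hpre : S.mulVec ⁻¹' {g | |w ⬝ᵥ g / √(g ⬝ᵥ g) - c| ≤ ε}
      = {g | |Pi.single (M := fun _ => ℝ) 0 1 ⬝ᵥ g / √(g ⬝ᵥ g) - c| ≤ ε} := by
    ext g
    simp only [Set.mem_preimage, Set.mem_ofPred_eq]
    rw [← hSw, dotProduct_mulVec_mulVec_of_orthogonal hS, dotProduct_mulVec_mulVec_of_orthogonal hS]
  rw [hpre]
  have hmp := measurePreserving_piFinSuccAbove (fun _ : Fin (m + 1) => gaussianReal 0 1) 0
  have hpre2 : {g : Fin (m + 1) → ℝ | |Pi.single (M := fun _ => ℝ) 0 1 ⬝ᵥ g / √(g ⬝ᵥ g) - c| ≤ ε}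
      = MeasurableEquiv.piFinSuccAbove (fun _ : Fin (m + 1) => ℝ) 0 ⁻¹'
        {q : ℝ × (Fin m → ℝ) | |q.1 / √(q.1 ^ 2 + √(q.2 ⬝ᵥ q.2) ^ 2) - c| ≤ ε} := by
    ext g
    simp only [Set.mem_preimage, Set.mem_ofPred_eq, single_dotProduct, one_mul]
    rw [Real.sq_sqrt (dotProduct_self_nonneg_real _)]
    have : g ⬝ᵥ g = g 0 ^ 2 + (MeasurableEquiv.piFinSuccAbove (fun _ : Fin (m + 1) => ℝ) 0 g).2 ⬝ᵥ
        (MeasurableEquiv.piFinSuccAbove (fun _ : Fin (m + 1) => ℝ) 0 g).2 := by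
      simp only [dotProduct]
      rw [Fin.sum_univ_succ, pow_two]
      rfl
    rw [this]
    rfl
  have hmeas2 : MeasurableSet
      {q : ℝ × (Fin m → ℝ) | |q.1 / √(q.1 ^ 2 + √(q.2 ⬝ᵥ q.2) ^ 2) - c| ≤ ε} := by
    unfold dotProduct
    exact measurableSet_le (by fun_prop) measurable_const
  rw [hpre2, hmp.measure_preimage hmeas2.nullMeasurableSet, Measure.prod_apply_symm hmeas2]
  calc _ ≤ ∫⁻ y : Fin m → ℝ, ENNReal.ofReal (8 * ε * √(y ⬝ᵥ y)) ∂(gaussPi (Fin m)) := by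
        apply lintegral_mono
        intro y
        change gaussianReal 0 1 {t | |t / √(t ^ 2 + √(y ⬝ᵥ y) ^ 2) - c| ≤ ε} ≤ _
        exact gaussianReal_small_ball_of_normalized hc hε4 (Real.sqrt_nonneg _)
    _ ≤ ∫⁻ y : Fin m → ℝ, (ENNReal.ofReal (4 * ε / √((m + 1 : ℕ) : ℝ)) * ENNReal.ofReal (y ⬝ᵥ y)
          + ENNReal.ofReal (4 * ε * √((m + 1 : ℕ) : ℝ))) ∂(gaussPi (Fin m)) := by
        -- `2 a b ≤ a² + b²` with `a² = |y|² / √n` and `b² = √n`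
        apply lintegral_mono
        intro y
        have hy := dotProduct_self_nonneg_real y
        simp only
        rw [← ENNReal.ofReal_mul (by positivity), ← ENNReal.ofReal_add (by positivity)
          (by positivity)]
        apply ENNReal.ofReal_le_ofReal
        set x := √(y ⬝ᵥ y)
        have hx : y ⬝ᵥ y = x ^ 2 := (Real.sq_sqrt hy).symm
        rw [hx]
        set R := √((m + 1 : ℕ) : ℝ)
        have hR : 0 < R := by linarith
        have : 4 * ε / R * x ^ 2 + 4 * ε * R - 8 * ε * x = 4 * ε / R * (x - R) ^ 2 := by
          field_simp
          ring
        have h0 : 0 ≤ 4 * ε / R * (x - R) ^ 2 := by positivity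
        linarith
    _ ≤ _ := by
        rw [lintegral_add_right _ measurable_const, lintegral_const_mul _ (by
          unfold dotProduct; fun_prop), lintegral_dotProduct_self_gaussPi, lintegral_const,
          measure_univ, mul_one, ← ENNReal.ofReal_natCast, ← ENNReal.ofReal_mul (by positivity),
          ← ENNReal.ofReal_add (by positivity) (by positivity)]
        apply ENNReal.ofReal_le_ofReal
        have hR : 0 < √((m + 1 : ℕ) : ℝ) := by linarith
        have h2 : √((m + 1 : ℕ) : ℝ) ^ 2 = m + 1 := by
          rw [Real.sq_sqrt (by positivity)]; push_cast; ring
        have : 4 * ε / √((m + 1 : ℕ) : ℝ) * m ≤ 4 * ε * √((m + 1 : ℕ) : ℝ) := by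
          rw [div_mul_eq_mul_div, div_le_iff₀ hR, mul_assoc, mul_assoc, ← pow_two, h2]
          nlinarith
        linarith

/-! ### Columns of a Haar orthogonal matrix -/

instance instSecondCountableTopologyRealMatrix (m n : ℕ) :
    SecondCountableTopology (Matrix (Fin m) (Fin n) ℝ) :=
  inferInstanceAs (SecondCountableTopology (Fin m → Fin n → ℝ))

instance instSecondCountableTopologyOrthogonal (N : ℕ) :
    SecondCountableTopology (Matrix.orthogonalGroup (Fin N) ℝ) :=
  TopologicalSpace.Subtype.secondCountableTopology _

instance instIsMulRightInvariantOrthogonalHaar (N : ℕ) :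
    (orthogonalHaar N).IsMulRightInvariant := by
  constructor
  intro U
  have : IsProbabilityMeasure ((orthogonalHaar N).map (fun O => O * U)) :=
    Measure.isProbabilityMeasure_map (measurable_mul_const U).aemeasurable
  exact Measure.isHaarMeasure_eq_of_isProbabilityMeasure _ _

theorem exists_orthogonal_mulVec_eq {ι : Type*} [Fintype ι] [DecidableEq ι] {x y : ι → ℝ}
    (hx : x ⬝ᵥ x = 1) (hy : y ⬝ᵥ y = 1) :
    ∃ S : Matrix.orthogonalGroup ι ℝ, (S : Matrix ι ι ℝ).mulVec x = y := by
  obtain ⟨i⟩ : Nonempty ι := by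
    by_contra h
    rw [not_nonempty_iff] at h
    simp at hx
  obtain ⟨S, hS, hSx⟩ := exists_orthogonal_mulVec_single_eq (fun _ : ι => x) {i} (by simp [hx])
  obtain ⟨T, hT, hTy⟩ := exists_orthogonal_mulVec_single_eq (fun _ : ι => y) {i} (by simp [hy])
  refine ⟨⟨T, hT⟩ * ⟨S, hS⟩⁻¹, ?_⟩
  have hinv : ((⟨S, hS⟩⁻¹ : Matrix.orthogonalGroup ι ℝ) : Matrix ι ι ℝ) = S.transpose := rfl
  rw [Submonoid.coe_mul, hinv, ← hSx i rfl, Matrix.mulVec_mulVec, Matrix.mul_assoc,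
    (Matrix.mem_orthogonalGroup_iff' ι ℝ).mp hS, Matrix.mul_one, hTy i rfl]

theorem dotProduct_normalize {ι : Type*} [Fintype ι] {g : ι → ℝ} (hg : g ≠ 0) :
    ((√(g ⬝ᵥ g))⁻¹ • g) ⬝ᵥ ((√(g ⬝ᵥ g))⁻¹ • g) = 1 := by
  have h0 : g ⬝ᵥ g ≠ 0 := fun h => hg (dotProduct_self_eq_zero.mp h)
  rw [smul_dotProduct, dotProduct_smul, smul_eq_mul, smul_eq_mul, ← mul_assoc, ← mul_inv,
    Real.mul_self_sqrt (dotProduct_self_nonneg_real g), inv_mul_cancel₀ h0]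

theorem ae_gaussPi_ne_zero {n : ℕ} (hn : n ≠ 0) : ∀ᵐ g ∂(gaussPi (Fin n)), g ≠ 0 := by
  have : Nonempty (Fin n) := ⟨⟨0, Nat.pos_of_ne_zero hn⟩⟩
  rw [ae_iff]
  simp only [not_not]
  have h : {g : Fin n → ℝ | g = 0} ⊆ {g | g ⟨0, Nat.pos_of_ne_zero hn⟩ ∈ ({0} : Set ℝ)} := by
    intro g hg
    have hg : g = 0 := hg
    simp [hg]
  refine measure_mono_null h ?_
  have := (measurePreserving_eval (fun _ : Fin n => gaussianReal 0 1)
    ⟨0, Nat.pos_of_ne_zero hn⟩).measure_preimage (s := {0})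
    (measurableSet_singleton 0).nullMeasurableSet
  have h0 := gaussianReal_Icc_le 0 0
  simp only [Set.Icc_self, sub_self, ENNReal.ofReal_zero, nonpos_iff_eq_zero] at h0
  rw [h0] at this
  exact this

theorem continuous_orthogonal_dotProduct_mulVec {N : ℕ} (v : Fin N → ℝ) :
    Continuous fun q : Matrix.orthogonalGroup (Fin N) ℝ × (Fin N → ℝ) =>
      v ⬝ᵥ (q.1 : Matrix (Fin N) (Fin N) ℝ).mulVec q.2 :=
  continuous_const.dotProduct
    ((continuous_subtype_val.comp continuous_fst).matrix_mulVec continuous_snd)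

theorem measurable_orthogonal_dotProduct_mulVec {N : ℕ} (v e : Fin N → ℝ) :
    Measurable fun O : Matrix.orthogonalGroup (Fin N) ℝ =>
      v ⬝ᵥ (O : Matrix (Fin N) (Fin N) ℝ).mulVec e :=
  ((continuous_orthogonal_dotProduct_mulVec v).comp
    (continuous_id.prodMk continuous_const)).measurable

/-- The average over an auxiliary random element `g` of events that all have the same Haar
probability, computed in the other order. -/
theorem orthogonalHaar_eq_lintegral_of_slices {N : ℕ} {α : Type*} [MeasurableSpace α]
    {ν : Measure α} [IsProbabilityMeasure ν]
    {D : Set (Matrix.orthogonalGroup (Fin N) ℝ × α)} (hD : MeasurableSet D)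
    {S : Set (Matrix.orthogonalGroup (Fin N) ℝ)}
    (h : ∀ᵐ g ∂ν, orthogonalHaar N {O | (O, g) ∈ D} = orthogonalHaar N S) :
    orthogonalHaar N S = ∫⁻ O, ν {g | (O, g) ∈ D} ∂(orthogonalHaar N) := by
  have h1 := Measure.prod_apply (μ := orthogonalHaar N) (ν := ν) hD
  have h2 := Measure.prod_apply_symm (μ := orthogonalHaar N) (ν := ν) hD
  have h3 : ∫⁻ y, orthogonalHaar N ((fun x => (x, y)) ⁻¹' D) ∂ν = orthogonalHaar N S := by
    calc _ = ∫⁻ _, orthogonalHaar N S ∂ν := lintegral_congr_ae h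
      _ = _ := by rw [lintegral_const, measure_univ, mul_one]
  rw [← h3, ← h2, h1]
  rfl

/-- The image of a unit vector under a Haar orthogonal matrix is distributed as a normalized
Gaussian vector. -/
theorem orthogonalHaar_dotProduct_eq_gaussPi {N : ℕ} {v e : Fin N → ℝ}
    (he : e ⬝ᵥ e = 1) {B : Set ℝ} (hB : MeasurableSet B) :
    orthogonalHaar N {O | v ⬝ᵥ (O : Matrix (Fin N) (Fin N) ℝ).mulVec e ∈ B}
      = gaussPi (Fin N) {g | v ⬝ᵥ g / √(g ⬝ᵥ g) ∈ B} := by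
  have hN : N ≠ 0 := by
    rintro rfl
    simp at he
  let D : Set (Matrix.orthogonalGroup (Fin N) ℝ × (Fin N → ℝ)) :=
    {q | v ⬝ᵥ (q.1 : Matrix (Fin N) (Fin N) ℝ).mulVec q.2 / √(q.2 ⬝ᵥ q.2) ∈ B}
  have hD : MeasurableSet D := by
    have : Measurable fun q : Matrix.orthogonalGroup (Fin N) ℝ × (Fin N → ℝ) =>
        v ⬝ᵥ (q.1 : Matrix (Fin N) (Fin N) ℝ).mulVec q.2 / √(q.2 ⬝ᵥ q.2) := by
      refine (continuous_orthogonal_dotProduct_mulVec v).measurable.div ?_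
      unfold dotProduct
      fun_prop
    exact this hB
  rw [orthogonalHaar_eq_lintegral_of_slices hD (ν := gaussPi (Fin N))]
  · have : ∀ O : Matrix.orthogonalGroup (Fin N) ℝ, gaussPi (Fin N) {g | (O, g) ∈ D}
        = gaussPi (Fin N) {g | v ⬝ᵥ g / √(g ⬝ᵥ g) ∈ B} := by
      intro O
      have hm : MeasurableSet {g : Fin N → ℝ | v ⬝ᵥ g / √(g ⬝ᵥ g) ∈ B} := by
        have : Measurable fun g : Fin N → ℝ => v ⬝ᵥ g / √(g ⬝ᵥ g) := by
          unfold dotProduct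
          fun_prop
        exact this hB
      rw [← (measurePreserving_mulVec_gaussPi O.2).measure_preimage hm.nullMeasurableSet]
      congr 1
      ext g
      simp only [D, Set.mem_preimage, Set.mem_ofPred_eq]
      rw [dotProduct_mulVec_mulVec_of_orthogonal O.2]
    simp_rw [this]
    rw [lintegral_const, measure_univ, mul_one]
  · filter_upwards [ae_gaussPi_ne_zero hN] with g hg
    obtain ⟨S, hS⟩ := exists_orthogonal_mulVec_eq he (dotProduct_normalize hg)
    rw [← measure_preimage_mul_right (orthogonalHaar N) S
      {O | v ⬝ᵥ (O : Matrix (Fin N) (Fin N) ℝ).mulVec e ∈ B}]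
    congr 1
    ext O
    simp only [D, Set.mem_preimage, Set.mem_ofPred_eq]
    rw [Submonoid.coe_mul, ← Matrix.mulVec_mulVec, hS, Matrix.mulVec_smul, dotProduct_smul,
      smul_eq_mul, div_eq_inv_mul]

theorem abs_dotProduct_le_one {ι : Type*} [Fintype ι] {x y : ι → ℝ}
    (hx : x ⬝ᵥ x = 1) (hy : y ⬝ᵥ y = 1) : |x ⬝ᵥ y| ≤ 1 := by
  have h1 := dotProduct_self_nonneg_real (x - y)
  have h2 := dotProduct_self_nonneg_real (x + y)
  rw [sub_dotProduct, dotProduct_sub, dotProduct_sub, dotProduct_comm y x] at h1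
  rw [add_dotProduct, dotProduct_add, dotProduct_add, dotProduct_comm y x] at h2
  rw [abs_le]
  constructor <;> linarith

/-- Sub-Gaussian tail at scale `N^{-1/2}` of an entry of a Haar orthogonal matrix. -/
theorem orthogonalHaar_abs_dotProduct_ge_le {N : ℕ} {v e : Fin N → ℝ}
    (hv : v ⬝ᵥ v = 1) (he : e ⬝ᵥ e = 1) {s : ℝ} (hs : 0 ≤ s) :
    orthogonalHaar N {O | s / √N ≤ |v ⬝ᵥ (O : Matrix (Fin N) (Fin N) ℝ).mulVec e|}
      ≤ ENNReal.ofReal (3 * Real.exp (-s ^ 2 / 8)) := by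
  have hN : N ≠ 0 := by
    rintro rfl
    simp at he
  have hN0 : 0 < √(N : ℝ) := by positivity
  rcases lt_or_ge (√(N : ℝ)) s with hsN | hsN
  · have hempty : {O : Matrix.orthogonalGroup (Fin N) ℝ |
        s / √N ≤ |v ⬝ᵥ (O : Matrix (Fin N) (Fin N) ℝ).mulVec e|} = ∅ := by
      ext O
      simp only [Set.mem_ofPred_eq, Set.mem_empty_iff_false, iff_false, not_le]
      have h1 := abs_dotProduct_le_one hv
        ((dotProduct_mulVec_mulVec_of_orthogonal O.2 e e).trans he)
      exact h1.trans_lt ((one_lt_div hN0).mpr hsN)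
    rw [hempty, measure_empty]
    exact bot_le
  -- Either `|v ⬝ g| ≥ s / 2` or the length of `g` is below half its typical value `√N`.
  have hB : MeasurableSet {x : ℝ | s / √N ≤ |x|} := measurableSet_le measurable_const (by fun_prop)
  refine (orthogonalHaar_dotProduct_eq_gaussPi (v := v) he hB).le.trans ?_
  have hsub : {g : Fin N → ℝ | v ⬝ᵥ g / √(g ⬝ᵥ g) ∈ {x : ℝ | s / √N ≤ |x|}}
      ⊆ {g | s / 2 ≤ |v ⬝ᵥ g|} ∪ {g | g ⬝ᵥ g ≤ (N : ℝ) / 4} := by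
    intro g hg
    simp only [Set.mem_ofPred_eq, Set.mem_union] at hg ⊢
    by_contra! hcon
    obtain ⟨h1, h2⟩ := hcon
    have h3 : √N / 2 < √(g ⬝ᵥ g) := by
      apply Real.lt_sqrt_of_sq_lt
      rw [div_pow, Real.sq_sqrt (Nat.cast_nonneg N)]
      linarith
    have h4 : 0 < √(g ⬝ᵥ g) := by linarith
    rw [abs_div, abs_of_pos h4, div_le_div_iff₀ hN0 h4] at hg
    nlinarith [abs_nonneg (v ⬝ᵥ g)]
  refine (measure_mono hsub).trans ((measure_union_le _ _).trans ((add_le_add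
    (gaussPi_abs_dotProduct_ge_le hv.le (by positivity)) (gaussPi_dotProduct_self_le N)).trans ?_))
  rw [← ENNReal.ofReal_add (by positivity) (by positivity)]
  apply ENNReal.ofReal_le_ofReal
  have h5 : s ^ 2 ≤ N := by
    rw [← Real.sq_sqrt (Nat.cast_nonneg N)]
    gcongr
  have h6 : Real.exp (-N / 4) ≤ Real.exp (-s ^ 2 / 8) := by
    apply Real.exp_le_exp.mpr
    nlinarith [sq_nonneg s]
  have h7 : -(s / 2) ^ 2 / 2 = -s ^ 2 / 8 := by ring
  rw [h7]
  linarith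

theorem orthogonalHaar_abs_dotProduct_le_le {N : ℕ} {v e : Fin N → ℝ}
    (hv : v ⬝ᵥ v = 1) (he : e ⬝ᵥ e = 1) {ε : ℝ} (hε : 0 ≤ ε) :
    orthogonalHaar N {O | |v ⬝ᵥ (O : Matrix (Fin N) (Fin N) ℝ).mulVec e| ≤ ε}
      ≤ ENNReal.ofReal (8 * ε * √N) := by
  have hB : MeasurableSet {x : ℝ | |x| ≤ ε} := measurableSet_le (by fun_prop) measurable_const
  refine (orthogonalHaar_dotProduct_eq_gaussPi (v := v) he hB).le.trans ?_
  simpa using gaussPi_small_ball hv (c := 0) (by norm_num) hε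

theorem measurable_insertNth_zero {n : ℕ} (a : Fin (n + 1)) :
    Measurable fun g : Fin n → ℝ => (a.insertNth (α := fun _ => ℝ) 0 g : Fin (n + 1) → ℝ) := by
  rw [measurable_pi_iff]
  intro i
  rcases Fin.eq_self_or_eq_succAbove a i with rfl | ⟨j, rfl⟩
  · simp
  · simp only [Fin.insertNth_apply_succAbove]
    fun_prop

theorem dotProduct_insertNth_zero {n : ℕ} (a : Fin (n + 1)) (x : Fin (n + 1) → ℝ)
    (g : Fin n → ℝ) :
    x ⬝ᵥ a.insertNth (α := fun _ => ℝ) 0 g = a.removeNth x ⬝ᵥ g := by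
  simp [dotProduct, Fin.sum_univ_succAbove _ a, Fin.removeNth]

/-- The small-ball estimate in the hyperplane orthogonal to `e_a`, for the projection of a unit
vector `u` that is far from `e_a`, so that the projection has length at least `1/2`. -/
theorem gaussPi_small_ball_removeNth {n : ℕ} {a : Fin (n + 1)} {u : Fin (n + 1) → ℝ}
    (huu : u ⬝ᵥ u = 1) (hua : |u a| ≤ 1 / 4) {x ε : ℝ} (hx : |x| ≤ 1 / 4) (hε : 0 ≤ ε) :
    gaussPi (Fin n) {g | |x + a.removeNth u ⬝ᵥ g / √(g ⬝ᵥ g)| ≤ ε}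
      ≤ ENNReal.ofReal (16 * ε * √((n + 1 : ℕ) : ℝ)) := by
  set w : Fin n → ℝ := a.removeNth u with hw
  have hsum : u ⬝ᵥ u = u a * u a + w ⬝ᵥ w := by
    simp [dotProduct, Fin.sum_univ_succAbove _ a, hw, Fin.removeNth]
  have hww : (1 / 2) ^ 2 ≤ w ⬝ᵥ w := by
    have := abs_le.mp hua
    nlinarith
  have hwn : 1 / 2 ≤ √(w ⬝ᵥ w) := Real.le_sqrt_of_sq_le hww
  have hw0 : w ≠ 0 := by
    intro h
    rw [h] at hww
    norm_num at hww
  have hwpos : 0 < √(w ⬝ᵥ w) := by linarith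
  have hc : |-x / √(w ⬝ᵥ w)| ≤ 1 / 2 := by
    rw [abs_div, abs_neg, abs_of_pos hwpos, div_le_iff₀ hwpos]
    linarith
  have hsb := gaussPi_small_ball (dotProduct_normalize hw0) hc
    (show 0 ≤ ε / √(w ⬝ᵥ w) by positivity)
  refine le_trans (measure_mono ?_) (hsb.trans (ENNReal.ofReal_le_ofReal ?_))
  · intro g hg
    simp only [Set.mem_ofPred_eq] at hg ⊢
    rw [smul_dotProduct, smul_eq_mul, le_div_iff₀ hwpos]
    have e : (√(w ⬝ᵥ w))⁻¹ * √(w ⬝ᵥ w) = 1 := inv_mul_cancel₀ hwpos.ne'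
    have e2 : x + w ⬝ᵥ g / √(g ⬝ᵥ g)
        = ((√(w ⬝ᵥ w))⁻¹ * (w ⬝ᵥ g) / √(g ⬝ᵥ g) - -x / √(w ⬝ᵥ w)) * √(w ⬝ᵥ w) := by
      linear_combination -(x + w ⬝ᵥ g / √(g ⬝ᵥ g)) * e
    rw [e2, abs_mul, abs_of_pos hwpos] at hg
    exact hg
  · have h5 : √(n : ℝ) ≤ √((n + 1 : ℕ) : ℝ) := Real.sqrt_le_sqrt (by push_cast; linarith)
    have h6 : ε / √(w ⬝ᵥ w) ≤ 2 * ε := by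
      rw [div_le_iff₀ hwpos]
      nlinarith
    calc 8 * (ε / √(w ⬝ᵥ w)) * √(n : ℝ) ≤ 8 * (2 * ε) * √((n + 1 : ℕ) : ℝ) := by gcongr
      _ = _ := by ring

/-- An orthogonal matrix fixing `e_a` and mapping `e_b` to a given unit vector orthogonal to
`e_a`. -/
theorem exists_orthogonal_fix_single {N : ℕ} {a b : Fin N} (hab : a ≠ b) {z : Fin N → ℝ}
    (hza : z a = 0) (hzz : z ⬝ᵥ z = 1) :
    ∃ S : Matrix.orthogonalGroup (Fin N) ℝ,
      (S : Matrix (Fin N) (Fin N) ℝ).mulVec (Pi.single a 1) = Pi.single a 1 ∧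
      (S : Matrix (Fin N) (Fin N) ℝ).mulVec (Pi.single b 1) = z := by
  obtain ⟨S, hS, hSe⟩ := exists_orthogonal_mulVec_single_eq
    (fun i => if i = a then Pi.single a 1 else z) {a, b} (by
      rintro i (rfl | rfl) j (rfl | rfl)
      · simp
      · simp [hab.symm, hab, hza]
      · simp [hab.symm, hza]
      · simp [hab.symm, hzz])
  exact ⟨⟨S, hS⟩, by simpa using hSe a (by simp), by simpa [hab.symm] using hSe b (by simp)⟩

/-- Small-ball estimate for a combination of entries of two different columns of a Haar
orthogonal matrix. Given one column, the other one is a normalized Gaussian vector of the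
orthogonal hyperplane; the exponential term accounts for the event that the first column is not
nearly orthogonal to `v` and `v'`. -/
theorem orthogonalHaar_two_columns_le {N : ℕ} {v v' : Fin N → ℝ}
    (hv : v ⬝ᵥ v = 1) (hv' : v' ⬝ᵥ v' = 1) {a b : Fin N} (hab : a ≠ b) {α ε : ℝ}
    (hα : |α| ≤ 1) (hε : 0 ≤ ε) :
    orthogonalHaar N {O | |α * (v ⬝ᵥ (O : Matrix (Fin N) (Fin N) ℝ).mulVec (Pi.single a 1))
        + v' ⬝ᵥ (O : Matrix (Fin N) (Fin N) ℝ).mulVec (Pi.single b 1)| ≤ ε}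
      ≤ ENNReal.ofReal (16 * ε * √N + 6 * Real.exp (-N / 128)) := by
  obtain ⟨n, rfl⟩ : ∃ n, N = n + 1 := ⟨N - 1, by have := a.2; omega⟩
  have hn : n ≠ 0 := by
    rintro rfl
    exact hab (Fin.ext (by omega))
  -- The column `b` replaced by the image of a normalized Gaussian vector orthogonal to `e_a`.
  let F : Matrix.orthogonalGroup (Fin (n + 1)) ℝ × (Fin n → ℝ) → ℝ := fun q =>
    α * (v ⬝ᵥ (q.1 : Matrix (Fin (n + 1)) (Fin (n + 1)) ℝ).mulVec (Pi.single a 1))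
      + v' ⬝ᵥ (q.1 : Matrix (Fin (n + 1)) (Fin (n + 1)) ℝ).mulVec
        (a.insertNth (α := fun _ => ℝ) 0 q.2) / √(q.2 ⬝ᵥ q.2)
  have hF1 : Measurable fun q : Matrix.orthogonalGroup (Fin (n + 1)) ℝ × (Fin n → ℝ) =>
      v ⬝ᵥ (q.1 : Matrix (Fin (n + 1)) (Fin (n + 1)) ℝ).mulVec (Pi.single a 1) :=
    (measurable_orthogonal_dotProduct_mulVec v (Pi.single a 1)).comp measurable_fst
  have hF2 := (continuous_orthogonal_dotProduct_mulVec v').measurable.comp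
    (measurable_fst.prodMk ((measurable_insertNth_zero a).comp measurable_snd))
  have hF3 : Measurable fun q : Matrix.orthogonalGroup (Fin (n + 1)) ℝ × (Fin n → ℝ) =>
      √(q.2 ⬝ᵥ q.2) := by
    unfold dotProduct
    fun_prop
  have hF : Measurable F := (hF1.const_mul α).add (hF2.div hF3)
  have hball : MeasurableSet {x : ℝ | |x| ≤ ε} := measurableSet_le (by fun_prop) measurable_const
  have hD : MeasurableSet {q | |F q| ≤ ε} := hF hball
  rw [orthogonalHaar_eq_lintegral_of_slices hD (ν := gaussPi (Fin n))]
  · let bad : Set (Matrix.orthogonalGroup (Fin (n + 1)) ℝ) :=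
      {O | 1 / 4 ≤ |v ⬝ᵥ (O : Matrix (Fin (n + 1)) (Fin (n + 1)) ℝ).mulVec (Pi.single a 1)|} ∪
      {O | 1 / 4 ≤ |v' ⬝ᵥ (O : Matrix (Fin (n + 1)) (Fin (n + 1)) ℝ).mulVec (Pi.single a 1)|}
    have hslice : ∀ O, gaussPi (Fin n) {g | (O, g) ∈ {q | |F q| ≤ ε}}
        ≤ ENNReal.ofReal (16 * ε * √((n + 1 : ℕ) : ℝ)) + bad.indicator 1 O := by
      intro O
      by_cases hO : O ∈ bad
      · rw [Set.indicator_of_mem hO]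
        exact prob_le_one.trans le_add_self
      rw [Set.indicator_of_notMem hO, add_zero]
      simp only [bad, Set.mem_union, Set.mem_ofPred_eq, not_or, not_le] at hO
      obtain ⟨h1, h2⟩ := hO
      have hOT : (O : Matrix (Fin (n + 1)) (Fin (n + 1)) ℝ).transpose
          ∈ Matrix.orthogonalGroup (Fin (n + 1)) ℝ := (O⁻¹).2
      have huv : ∀ x, v' ⬝ᵥ (O : Matrix (Fin (n + 1)) (Fin (n + 1)) ℝ).mulVec x
          = (O : Matrix (Fin (n + 1)) (Fin (n + 1)) ℝ).transpose.mulVec v' ⬝ᵥ x := by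
        intro x
        rw [Matrix.dotProduct_mulVec, ← Matrix.mulVec_transpose]
      rw [huv, dotProduct_single, mul_one] at h2
      have h3 : |α * (v ⬝ᵥ (O : Matrix (Fin (n + 1)) (Fin (n + 1)) ℝ).mulVec (Pi.single a 1))|
          ≤ 1 / 4 := by
        rw [abs_mul]
        exact (mul_le_of_le_one_left (abs_nonneg _) hα).trans h1.le
      have hsb := gaussPi_small_ball_removeNth
        ((dotProduct_mulVec_mulVec_of_orthogonal hOT v' v').trans hv') h2.le h3 hε
      simp only [Set.mem_ofPred_eq, F, huv, dotProduct_insertNth_zero]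
      exact hsb
    have hbad : orthogonalHaar (n + 1) bad
        ≤ ENNReal.ofReal (6 * Real.exp (-((n + 1 : ℕ) : ℝ) / 128)) := by
      have hN0 : 0 < √((n + 1 : ℕ) : ℝ) := by positivity
      have hone : ∀ x : Fin (n + 1) → ℝ, x ⬝ᵥ x = 1 → orthogonalHaar (n + 1)
          {O | 1 / 4 ≤ |x ⬝ᵥ (O : Matrix (Fin (n + 1)) (Fin (n + 1)) ℝ).mulVec (Pi.single a 1)|}
          ≤ ENNReal.ofReal (3 * Real.exp (-((n + 1 : ℕ) : ℝ) / 128)) := by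
        intro x hx
        have := orthogonalHaar_abs_dotProduct_ge_le hx
          (show (Pi.single a 1 : Fin (n + 1) → ℝ) ⬝ᵥ Pi.single a 1 = 1 by simp)
          (show 0 ≤ √((n + 1 : ℕ) : ℝ) / 4 by positivity)
        have e1 : √((n + 1 : ℕ) : ℝ) / 4 / √((n + 1 : ℕ) : ℝ) = 1 / 4 := by
          field_simp
        have e2 : -(√((n + 1 : ℕ) : ℝ) / 4) ^ 2 / 8 = -((n + 1 : ℕ) : ℝ) / 128 := by
          rw [div_pow, Real.sq_sqrt (by positivity)]
          ring
        rwa [e1, e2] at this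
      have hunion := (measure_union_le (μ := orthogonalHaar (n + 1)) _ _).trans
        (add_le_add (hone v hv) (hone v' hv'))
      rw [← ENNReal.ofReal_add (by positivity) (by positivity)] at hunion
      have e3 : 3 * Real.exp (-((n + 1 : ℕ) : ℝ) / 128) + 3 * Real.exp (-((n + 1 : ℕ) : ℝ) / 128)
          = 6 * Real.exp (-((n + 1 : ℕ) : ℝ) / 128) := by ring
      rwa [e3] at hunion
    calc _ ≤ ∫⁻ O, (ENNReal.ofReal (16 * ε * √((n + 1 : ℕ) : ℝ)) + bad.indicator 1 O)
          ∂(orthogonalHaar (n + 1)) := lintegral_mono hslice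
      _ ≤ _ := by
        rw [lintegral_add_left measurable_const, lintegral_const, measure_univ, mul_one,
          ENNReal.ofReal_add (by positivity) (by positivity)]
        gcongr
        exact (lintegral_indicator_one_le _).trans hbad
  · -- Right multiplication by a matrix fixing `e_a` and taking `e_b` to `g / |g|` preserves the
    -- Haar measure.
    apply (ae_gaussPi_ne_zero hn).mono
    intro g hg
    let z : Fin (n + 1) → ℝ := a.insertNth (α := fun _ => ℝ) 0 ((√(g ⬝ᵥ g))⁻¹ • g)
    have hza : z a = 0 := by simp [z]
    have hzz : z ⬝ᵥ z = 1 := by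
      rw [show z ⬝ᵥ z = a.removeNth z ⬝ᵥ ((√(g ⬝ᵥ g))⁻¹ • g) from
        dotProduct_insertNth_zero a _ _, Fin.removeNth_insertNth, dotProduct_normalize hg]
    obtain ⟨S, hSa, hSb⟩ := exists_orthogonal_fix_single hab hza hzz
    rw [← measure_preimage_mul_right (orthogonalHaar (n + 1)) S
      {O | |α * (v ⬝ᵥ (O : Matrix (Fin (n + 1)) (Fin (n + 1)) ℝ).mulVec (Pi.single a 1))
        + v' ⬝ᵥ (O : Matrix (Fin (n + 1)) (Fin (n + 1)) ℝ).mulVec (Pi.single b 1)| ≤ ε}]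
    congr 1
    ext O
    simp only [F, Set.mem_preimage, Set.mem_ofPred_eq]
    have hz : z = (√(g ⬝ᵥ g))⁻¹ • (a.insertNth (α := fun _ => ℝ) 0 g : Fin (n + 1) → ℝ) := by
      ext i
      rcases Fin.eq_self_or_eq_succAbove a i with h | ⟨j, rfl⟩
      · simp [z, h]
      · simp [z]
    rw [Submonoid.coe_mul, ← Matrix.mulVec_mulVec, ← Matrix.mulVec_mulVec, hSa, hSb, hz,
      Matrix.mulVec_smul, dotProduct_smul, smul_eq_mul, div_eq_inv_mul]

/-! ### Correlations at a uniform point of the Stiefel manifold -/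

theorem uniformStiefel_apply {N r : ℕ} {S : Set (Matrix (Fin N) (Fin r) ℝ)}
    (hS : MeasurableSet S) :
    uniformStiefel N r S
      = orthogonalHaar N {O | (O : Matrix (Fin N) (Fin N) ℝ) * baseFrame N r ∈ S} := by
  rw [uniformStiefel, Measure.map_apply (measurable_orbit N r) hS]
  rfl

/-- The columns of a spike matrix, normalized to have length one. -/
noncomputable def unitSpike {N r : ℕ} (V : Matrix (Fin N) (Fin r) ℝ) (i : Fin r) : Fin N → ℝ :=
  fun a => (√(N : ℝ))⁻¹ * V a i

theorem unitSpike_dotProduct {N r : ℕ} (hN : N ≠ 0) {V : Matrix (Fin N) (Fin r) ℝ}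
    (hV : V ∈ stiefel N r) (i k : Fin r) :
    unitSpike V i ⬝ᵥ unitSpike V k = if i = k then 1 else 0 := by
  have h := congrFun (congrFun hV i) k
  rw [Matrix.mul_apply, Matrix.smul_apply, Matrix.one_apply, smul_eq_mul] at h
  have hs : √(N : ℝ) * √(N : ℝ) = N := Real.mul_self_sqrt (Nat.cast_nonneg N)
  have hN0 : (N : ℝ) ≠ 0 := Nat.cast_ne_zero.mpr hN
  calc unitSpike V i ⬝ᵥ unitSpike V k
      = (√(N : ℝ) * √(N : ℝ))⁻¹ * ∑ a, V.transpose i a * V a k := by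
        rw [dotProduct, Finset.mul_sum]
        refine Finset.sum_congr rfl fun a _ => ?_
        rw [unitSpike, unitSpike, Matrix.transpose_apply, mul_inv]
        ring
    _ = _ := by
        rw [h, hs]
        split_ifs <;> simp [hN0]

theorem baseFrame_eq_smul_single {N r : ℕ} (h : r ≤ N) (j : Fin r) :
    (fun a => baseFrame N r a j) = √(N : ℝ) • (Pi.single (Fin.castLE h j) 1 : Fin N → ℝ) := by
  funext a
  simp [baseFrame, Pi.single_apply, Fin.ext_iff]

theorem inv_mul_sqrt_self (N : ℕ) : (N : ℝ)⁻¹ * √(N : ℝ) = 1 / √(N : ℝ) := by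
  rcases Nat.eq_zero_or_pos N with rfl | hN
  · simp
  · have : 0 < √(N : ℝ) := by positivity
    field_simp
    rw [Real.sq_sqrt (Nat.cast_nonneg N)]

theorem corr_orbit {N r : ℕ} (h : r ≤ N) (V : Matrix (Fin N) (Fin r) ℝ) (i j : Fin r)
    (O : Matrix (Fin N) (Fin N) ℝ) :
    corr V i j (O * baseFrame N r)
      = unitSpike V i ⬝ᵥ O.mulVec (Pi.single (Fin.castLE h j) 1) := by
  have hcol : ∀ a, (O * baseFrame N r) a j
      = √(N : ℝ) * O.mulVec (Pi.single (Fin.castLE h j) 1) a := by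
    intro a
    have : (O * baseFrame N r) a j = O.mulVec (fun b => baseFrame N r b j) a := rfl
    rw [this, baseFrame_eq_smul_single h, Matrix.mulVec_smul, Pi.smul_apply, smul_eq_mul]
  rw [corr, Matrix.mul_apply, dotProduct, Finset.mul_sum]
  refine Finset.sum_congr rfl fun a _ => ?_
  rw [hcol, Matrix.transpose_apply, unitSpike]
  have hinv : (N : ℝ)⁻¹ * √(N : ℝ) = (√(N : ℝ))⁻¹ := by rw [inv_mul_sqrt_self, one_div]
  rw [← hinv]
  ring

theorem continuous_corr {N r : ℕ} (V : Matrix (Fin N) (Fin r) ℝ) (i j : Fin r) :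
    Continuous (corr V i j) := by
  unfold corr
  exact continuous_const.mul
    (Continuous.matrix_elem (continuous_const.matrix_mul continuous_id) i j)

theorem uniformStiefel_corr_ge_le {N r : ℕ} (hN : N ≠ 0) (h : r ≤ N)
    {V : Matrix (Fin N) (Fin r) ℝ} (hV : V ∈ stiefel N r) (i j : Fin r) {s : ℝ} (hs : 0 ≤ s) :
    uniformStiefel N r {X | s / √N ≤ |corr V i j X|}
      ≤ ENNReal.ofReal (3 * Real.exp (-s ^ 2 / 8)) := by
  rw [uniformStiefel_apply
    (measurableSet_le measurable_const (continuous_corr V i j).abs.measurable)]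
  simp only [Set.mem_ofPred_eq, corr_orbit h]
  exact orthogonalHaar_abs_dotProduct_ge_le (by simp [unitSpike_dotProduct hN hV]) (by simp) hs

theorem uniformStiefel_corr_le_le {N r : ℕ} (hN : N ≠ 0) (h : r ≤ N)
    {V : Matrix (Fin N) (Fin r) ℝ} (hV : V ∈ stiefel N r) (i j : Fin r) {ε : ℝ} (hε : 0 ≤ ε) :
    uniformStiefel N r {X | |corr V i j X| ≤ ε} ≤ ENNReal.ofReal (8 * ε * √N) := by
  rw [uniformStiefel_apply
    (measurableSet_le (continuous_corr V i j).abs.measurable measurable_const)]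
  simp only [Set.mem_ofPred_eq, corr_orbit h]
  exact orthogonalHaar_abs_dotProduct_le_le (by simp [unitSpike_dotProduct hN hV]) (by simp) hε

theorem uniformStiefel_corr_pair_le_of_abs_le_one {N r : ℕ} (hN : N ≠ 0) (h : r ≤ N)
    {V : Matrix (Fin N) (Fin r) ℝ} (hV : V ∈ stiefel N r) {i j k l : Fin r}
    (hne : (i, j) ≠ (k, l)) {α ε : ℝ} (hα : |α| ≤ 1) (hε : 0 ≤ ε) :
    uniformStiefel N r {X | |α * corr V i j X + corr V k l X| ≤ ε}
      ≤ ENNReal.ofReal (16 * ε * √N + 6 * Real.exp (-N / 128)) := by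
  have h1 := continuous_corr V i j
  have h2 := continuous_corr V k l
  have hm : MeasurableSet {X | |α * corr V i j X + corr V k l X| ≤ ε} :=
    measurableSet_le (Continuous.measurable (by fun_prop)) measurable_const
  rw [uniformStiefel_apply hm]
  simp only [Set.mem_ofPred_eq, corr_orbit h]
  -- Two entries of the same column combine to one; different columns are almost independent.
  rcases eq_or_ne j l with rfl | hjl
  · have hik : i ≠ k := fun hik => hne (by rw [hik])
    set u := α • unitSpike V i + unitSpike V k with hu
    have huu : u ⬝ᵥ u = 1 + α ^ 2 := by
      simp [hu, unitSpike_dotProduct hN hV, hik, hik.symm]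
      ring
    have hu0 : u ≠ 0 := by
      intro h0
      rw [h0, zero_dotProduct] at huu
      nlinarith [sq_nonneg α]
    have hu1 : 1 ≤ √(u ⬝ᵥ u) := by
      rw [Real.one_le_sqrt, huu]
      nlinarith [sq_nonneg α]
    refine le_trans (measure_mono ?_) ((orthogonalHaar_abs_dotProduct_le_le
      (e := Pi.single (Fin.castLE h j) 1) (dotProduct_normalize hu0) (by simp) hε).trans
      (ENNReal.ofReal_le_ofReal ?_))
    · intro O hO
      simp only [Set.mem_ofPred_eq] at hO ⊢
      rw [← smul_eq_mul α, ← smul_dotProduct, ← add_dotProduct, ← hu] at hO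
      rw [smul_dotProduct, smul_eq_mul, abs_mul, abs_of_nonneg (by positivity)]
      exact (mul_le_of_le_one_left (abs_nonneg _) (inv_le_one_of_one_le₀ hu1)).trans hO
    · have h1 : 0 ≤ ε * √(N : ℝ) := by positivity
      have h2 := Real.exp_pos (-(N : ℝ) / 128)
      linarith
  · exact orthogonalHaar_two_columns_le (by simp [unitSpike_dotProduct hN hV])
      (by simp [unitSpike_dotProduct hN hV])
      (fun hab => hjl (Fin.castLE_injective h hab)) hα hε

/-- Small-ball estimate for a signed combination of two distinct correlations, for every weight `θ`:
dividing by the larger of the two coefficients reduces to weights in `[-1, 1]`. -/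
theorem uniformStiefel_corr_pair_le {N r : ℕ} (hN : N ≠ 0) (h : r ≤ N)
    {V : Matrix (Fin N) (Fin r) ℝ} (hV : V ∈ stiefel N r) {i j k l : Fin r}
    (hne : (i, j) ≠ (k, l)) {θ σ ε : ℝ} (hσ : |σ| = 1) (hε : 0 ≤ ε) :
    uniformStiefel N r {X | |θ * corr V i j X + σ * corr V k l X| ≤ ε}
      ≤ ENNReal.ofReal (16 * ε * √N + 6 * Real.exp (-N / 128)) := by
  have hσ0 : σ ≠ 0 := by
    rintro rfl
    simp at hσ
  rcases le_or_gt |θ| 1 with hθ | hθ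
  · refine le_trans (measure_mono ?_) (uniformStiefel_corr_pair_le_of_abs_le_one hN h hV hne
      (α := σ⁻¹ * θ) (by rw [abs_mul, abs_inv, hσ]; simpa using hθ) hε)
    intro X hX
    simp only [Set.mem_ofPred_eq] at hX ⊢
    have e : σ⁻¹ * θ * corr V i j X + corr V k l X
        = σ⁻¹ * (θ * corr V i j X + σ * corr V k l X) := by
      field_simp
    rw [e, abs_mul, abs_inv, hσ]
    simpa using hX
  · have hθ0 : θ ≠ 0 := by
      rintro rfl
      norm_num at hθ
    have hinv : |θ|⁻¹ ≤ 1 := inv_le_one_of_one_le₀ hθ.le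
    refine le_trans (measure_mono ?_) (uniformStiefel_corr_pair_le_of_abs_le_one hN h hV hne.symm
      (α := θ⁻¹ * σ) (by rw [abs_mul, abs_inv, hσ, mul_one]; exact hinv) hε)
    intro X hX
    simp only [Set.mem_ofPred_eq] at hX ⊢
    have e : θ⁻¹ * σ * corr V k l X + corr V i j X
        = θ⁻¹ * (θ * corr V i j X + σ * corr V k l X) := by
      field_simp
      ring
    rw [e, abs_mul, abs_inv]
    exact (mul_le_of_le_one_left (abs_nonneg _) hinv).trans hX

/-! ### Conditions on the size and the separation of the correlations -/

theorem satisfiesCondition1_uniformStiefel {r : ℕ} (hr : 1 ≤ r)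
    (V : ∀ N, Matrix (Fin N) (Fin r) ℝ) (hV : ∀ N, r ≤ N → V N ∈ stiefel N r) :
    SatisfiesCondition1 V (fun N => uniformStiefel N r)
      (3 * r ^ 2) (1 / 8) 1 1 (8 * r ^ 2) := by
  intro N hrN γ₁ γ₂ hγ₂ hγ
  have hN : N ≠ 0 := by omega
  have hN0 : 0 < √(N : ℝ) := by positivity
  have hsub : (condition1Set (V N) γ₁ γ₂)ᶜ ⊆ (stiefel N r)ᶜ ∪ ⋃ q : Fin r × Fin r,
      ({X | |corr (V N) q.1 q.2 X| ≤ γ₂ / √N} ∪ {X | γ₁ / √N ≤ |corr (V N) q.1 q.2 X|}) := by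
    intro X hX
    by_cases hXs : X ∈ stiefel N r
    · right
      simp only [condition1Set, Set.mem_compl_iff, Set.mem_ofPred_eq, hXs, true_and,
        not_forall, not_and_or, not_le, not_lt] at hX
      obtain ⟨i, j, hij⟩ := hX
      exact Set.mem_iUnion.mpr ⟨(i, j), hij.imp le_of_lt id⟩
    · exact Or.inl hXs
  refine (measure_mono hsub).trans ((measure_union_le _ _).trans ?_)
  rw [uniformStiefel_compl_stiefel hrN, zero_add]
  refine (measure_iUnion_fintype_le _ _).trans ((Finset.sum_le_sum fun q _ =>
    (measure_union_le _ _).trans (add_le_add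
      (uniformStiefel_corr_le_le hN hrN (hV N hrN) q.1 q.2 (by positivity))
      (uniformStiefel_corr_ge_le hN hrN (hV N hrN) q.1 q.2 (hγ₂.trans hγ).le))).trans ?_)
  rw [Finset.sum_const, nsmul_eq_mul, ← ENNReal.ofReal_add (by positivity) (by positivity),
    ← ENNReal.ofReal_natCast, ← ENNReal.ofReal_mul (by positivity)]
  apply ENNReal.ofReal_le_ofReal
  rw [Finset.card_univ, Fintype.card_prod, Fintype.card_fin]
  have e : 8 * (γ₂ / √N) * √N = 8 * γ₂ := by field_simp
  have e2 : -(1 / 8) * γ₁ ^ 2 = -γ₁ ^ 2 / 8 := by ring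
  rw [e, e2]
  have := Real.exp_pos (-1 * γ₂ * √N)
  push_cast
  nlinarith

/-- If `a x^q / (b y^q)` is close to `1`, then `θ |x|` is close to `|y|`, where `θ^q = a / b`. -/
theorem abs_abs_sub_abs_le_of_ratio_close {q : ℕ} (hq : q ≠ 0) {a b θ x y δ : ℝ}
    (hb : b ≠ 0) (hθ : θ ^ q = a / b) (hδ : δ < 1)
    (h : |a * x ^ q / (b * y ^ q) - 1| ≤ δ) : |(|θ * x| - |y|)| ≤ δ * |y| := by
  have hy : y ≠ 0 := by
    rintro rfl
    simp [hq] at h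
    linarith
  have hz : a * x ^ q / (b * y ^ q) = (θ * x / y) ^ q := by
    rw [div_pow, mul_pow, hθ]
    field_simp
  rw [hz] at h
  set w := |θ * x / y| with hw
  have h1 : |w ^ q - 1| ≤ δ := by
    refine le_trans ?_ h
    rw [hw, ← abs_pow]
    simpa using abs_abs_sub_abs_le ((θ * x / y) ^ q) 1
  have hw0 : 0 ≤ w := abs_nonneg _
  have h2 : |w - 1| ≤ |w ^ q - 1| := by
    rcases le_total 1 w with h1w | h1w
    · have := le_self_pow₀ h1w hq
      rw [abs_of_nonneg (by linarith), abs_of_nonneg (by linarith)]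
      linarith
    · have := pow_le_of_le_one hw0 h1w hq
      rw [abs_of_nonpos (by linarith), abs_of_nonpos (by linarith)]
      linarith
  have h3 : |θ * x| - |y| = (w - 1) * |y| := by
    rw [hw, abs_div]
    field_simp
  rw [h3, abs_mul, abs_abs]
  exact mul_le_mul_of_nonneg_right (h2.trans h1) (abs_nonneg y)

theorem exists_sign_abs_add_le {u y ε : ℝ} (h : |(|u| - |y|)| ≤ ε) :
    |u + 1 * y| ≤ ε ∨ |u + (-1) * y| ≤ ε := by
  rcases abs_cases u with ⟨hu, _⟩ | ⟨hu, _⟩ <;> rcases abs_cases y with ⟨hy, _⟩ | ⟨hy, _⟩ <;>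
    rw [hu, hy, abs_le] at h
  · exact Or.inr (abs_le.mpr ⟨by linarith, by linarith⟩)
  · exact Or.inl (abs_le.mpr ⟨by linarith, by linarith⟩)
  · exact Or.inl (abs_le.mpr ⟨by linarith, by linarith⟩)
  · exact Or.inr (abs_le.mpr ⟨by linarith, by linarith⟩)

theorem half_le_iSup_rpow {r : ℕ} (hr : 1 ≤ r) {lam : Fin r → ℝ} (hlam : ∀ i, 0 < lam i) (s : ℝ) :
    1 / 2 ≤ ⨆ q : (Fin r × Fin r) × (Fin r × Fin r),
      (1 + ((lam q.1.1 * lam q.1.2) / (lam q.2.1 * lam q.2.2)) ^ s) ^ (-(1 / 2 : ℝ)) := by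
  let i₀ : Fin r := ⟨0, hr⟩
  refine le_trans ?_ (le_ciSup (Set.finite_range _).bddAbove ((i₀, i₀), (i₀, i₀)))
  have h0 : lam i₀ * lam i₀ ≠ 0 := (mul_pos (hlam i₀) (hlam i₀)).ne'
  simp only
  rw [div_self h0, Real.one_rpow, Real.rpow_neg (by norm_num), ← Real.sqrt_eq_rpow, one_div]
  apply inv_anti₀ (by positivity)
  rw [Real.sqrt_le_left (by norm_num)]
  norm_num

/-- A ratio within `γ₃ / γ₁` of `1` forces `|θ m_{ij} ± m_{kl}| ≤ γ₃ / √N` as soon as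
`|m_{kl}| < γ₁ / √N`, which is a small-ball event. -/
theorem satisfiesCondition2_uniformStiefel {r : ℕ} (hr : 1 ≤ r) {p : ℕ} (hp : 3 ≤ p)
    {lam : Fin r → ℝ} (hlam : ∀ i, 0 < lam i)
    (V : ∀ N, Matrix (Fin N) (Fin r) ℝ) (hV : ∀ N, r ≤ N → V N ∈ stiefel N r) :
    SatisfiesCondition2 p lam V (fun N => uniformStiefel N r)
      (3 * r ^ 2) (1 / 8) (Real.exp 1) 1 (3136 * r ^ 4) := by
  intro N hrN γ₁ γ₃ hγ₃ hγ
  have hN : N ≠ 0 := by omega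
  have hN0 : 0 < √(N : ℝ) := by positivity
  have hγ₁ : 0 < γ₁ := hγ₃.trans hγ
  have hsup := half_le_iSup_rpow hr hlam (2 / ((p : ℝ) - 2))
  set M := ⨆ q : (Fin r × Fin r) × (Fin r × Fin r),
      (1 + ((lam q.1.1 * lam q.1.2) / (lam q.2.1 * lam q.2.2)) ^ (2 / ((p : ℝ) - 2)))
        ^ (-(1 / 2 : ℝ))
  rcases lt_or_ge (√(N : ℝ) * γ₃) 1 with hsmall | hlarge
  · -- For `γ₃ < N^{-1/2}` the second term of the bound is at least one.
    refine prob_le_one.trans ?_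
    rw [ENNReal.one_le_ofReal]
    have h1 : 1 ≤ Real.exp 1 * Real.exp (-1 * √N * γ₃) := by
      rw [← Real.exp_add]
      apply Real.one_le_exp
      linarith
    have h2 : 0 ≤ 3 * (r : ℝ) ^ 2 * Real.exp (-(1 / 8) * γ₁ ^ 2) := by positivity
    have h3 : 0 ≤ 3136 * (r : ℝ) ^ 4 * M * γ₃ := by positivity
    linarith
  let θ : (Fin r × Fin r) × (Fin r × Fin r) → ℝ := fun q =>
    ((lam q.1.1 * lam q.1.2) / (lam q.2.1 * lam q.2.2)) ^ (((p - 2 : ℕ) : ℝ)⁻¹)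
  have hp2 : p - 2 ≠ 0 := by omega
  have hsub : (condition2Set p lam (V N) γ₁ γ₃)ᶜ ⊆ (stiefel N r)ᶜ ∪
      ((⋃ q : Fin r × Fin r, {X | γ₁ / √N ≤ |corr (V N) q.1 q.2 X|}) ∪
      ⋃ q : {q : (Fin r × Fin r) × (Fin r × Fin r) // q.1 ≠ q.2},
        ({X | |θ q.1 * corr (V N) q.1.1.1 q.1.1.2 X + 1 * corr (V N) q.1.2.1 q.1.2.2 X|
            ≤ γ₃ / √N} ∪
         {X | |θ q.1 * corr (V N) q.1.1.1 q.1.1.2 X + (-1) * corr (V N) q.1.2.1 q.1.2.2 X|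
            ≤ γ₃ / √N})) := by
    intro X hX
    by_cases hXs : X ∈ stiefel N r
    swap
    · exact Or.inl hXs
    right
    simp only [condition2Set, Set.mem_compl_iff, Set.mem_ofPred_eq, hXs, true_and,
      not_forall, not_lt] at hX
    obtain ⟨i, j, k, l, hne, hX⟩ := hX
    rcases le_or_gt (γ₁ / √N) |corr (V N) k l X| with hbig | hbig
    · exact Or.inl (Set.mem_iUnion.mpr ⟨(k, l), hbig⟩)
    right
    refine Set.mem_iUnion.mpr ⟨⟨((i, j), (k, l)), hne⟩, ?_⟩
    have hb : 0 < lam k * lam l := mul_pos (hlam k) (hlam l)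
    have ha : 0 < lam i * lam j := mul_pos (hlam i) (hlam j)
    have hθ : θ ((i, j), (k, l)) ^ (p - 2) = lam i * lam j / (lam k * lam l) :=
      Real.rpow_inv_natCast_pow (by positivity) hp2
    have h1 := abs_abs_sub_abs_le_of_ratio_close hp2 hb.ne' hθ ((div_lt_one hγ₁).mpr hγ) hX
    have h2 : γ₃ / γ₁ * |corr (V N) k l X| ≤ γ₃ / √N := by
      calc γ₃ / γ₁ * |corr (V N) k l X| ≤ γ₃ / γ₁ * (γ₁ / √N) := by gcongr
        _ = _ := by field_simp
    exact exists_sign_abs_add_le (h1.trans h2)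
  have hpair : ∀ q : {q : (Fin r × Fin r) × (Fin r × Fin r) // q.1 ≠ q.2}, ∀ σ : ℝ, |σ| = 1 →
      uniformStiefel N r {X | |θ q.1 * corr (V N) q.1.1.1 q.1.1.2 X
        + σ * corr (V N) q.1.2.1 q.1.2.2 X| ≤ γ₃ / √N} ≤ ENNReal.ofReal (784 * γ₃) := by
    intro q σ hσ
    refine (uniformStiefel_corr_pair_le hN hrN (hV N hrN) q.2 hσ (by positivity)).trans
      (ENNReal.ofReal_le_ofReal ?_)
    have e : 16 * (γ₃ / √N) * √N = 16 * γ₃ := by field_simp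
    rw [e]
    -- `e^{-N/128} ≤ 128 / N ≤ 128 / √N ≤ 128 γ₃`
    have hsq : √(N : ℝ) ^ 2 = N := Real.sq_sqrt (Nat.cast_nonneg N)
    have h1N : 1 ≤ √(N : ℝ) := by
      rw [Real.one_le_sqrt]
      exact_mod_cast Nat.one_le_iff_ne_zero.mpr hN
    have hexp : Real.exp (-(N : ℝ) / 128) * N ≤ 128 := by
      have h1 := Real.add_one_le_exp ((N : ℝ) / 128)
      have h2 : Real.exp (-(N : ℝ) / 128) * Real.exp ((N : ℝ) / 128) = 1 := by
        rw [← Real.exp_add, neg_div, neg_add_cancel, Real.exp_zero]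
      nlinarith [Real.exp_pos (-(N : ℝ) / 128)]
    have h2 : Real.exp (-(N : ℝ) / 128) ≤ 128 * γ₃ := by
      have hE := Real.exp_pos (-(N : ℝ) / 128)
      have hN1 : (1 : ℝ) ≤ N := by exact_mod_cast Nat.one_le_iff_ne_zero.mpr hN
      have hEs : Real.exp (-(N : ℝ) / 128) * √(N : ℝ) ≤ 128 := by
        refine le_trans (mul_le_mul_of_nonneg_left ?_ hE.le) hexp
        nlinarith
      have : Real.exp (-(N : ℝ) / 128) * 1 ≤ Real.exp (-(N : ℝ) / 128) * (√(N : ℝ) * γ₃) :=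
        mul_le_mul_of_nonneg_left hlarge hE.le
      nlinarith
    linarith
  have hone : ∀ q : Fin r × Fin r, uniformStiefel N r {X | γ₁ / √N ≤ |corr (V N) q.1 q.2 X|}
      ≤ ENNReal.ofReal (3 * Real.exp (-γ₁ ^ 2 / 8)) := fun q =>
    uniformStiefel_corr_ge_le hN hrN (hV N hrN) q.1 q.2 hγ₁.le
  refine (measure_mono hsub).trans ((measure_union_le _ _).trans ?_)
  rw [uniformStiefel_compl_stiefel hrN, zero_add]
  refine (measure_union_le _ _).trans ((add_le_add
    ((measure_iUnion_fintype_le _ _).trans (Finset.sum_le_sum fun q _ => hone q))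
    ((measure_iUnion_fintype_le _ _).trans (Finset.sum_le_sum fun q _ =>
      (measure_union_le _ _).trans (add_le_add (hpair q 1 (by simp)) (hpair q (-1) (by simp)))))
    ).trans ?_)
  have hcard : Fintype.card {q : (Fin r × Fin r) × (Fin r × Fin r) // q.1 ≠ q.2} ≤ r ^ 4 := by
    refine (Fintype.card_subtype_le _).trans (le_of_eq ?_)
    simp only [Fintype.card_prod, Fintype.card_fin]
    ring
  have hcard' : (Fintype.card {q : (Fin r × Fin r) × (Fin r × Fin r) // q.1 ≠ q.2} : ℝ)
      ≤ (r : ℝ) ^ 4 := by exact_mod_cast hcard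
  rw [Finset.sum_const, Finset.sum_const, nsmul_eq_mul, nsmul_eq_mul,
    ← ENNReal.ofReal_add (by positivity) (by positivity),
    ← ENNReal.ofReal_natCast, ← ENNReal.ofReal_natCast, ← ENNReal.ofReal_mul (by positivity),
    ← ENNReal.ofReal_mul (by positivity), ← ENNReal.ofReal_add (by positivity) (by positivity)]
  apply ENNReal.ofReal_le_ofReal
  rw [Finset.card_univ, Finset.card_univ, Fintype.card_prod, Fintype.card_fin]
  have e2 : -(1 / 8) * γ₁ ^ 2 = -γ₁ ^ 2 / 8 := by ring
  rw [e2]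
  have h1 : 0 ≤ Real.exp 1 * Real.exp (-1 * √N * γ₃) := by positivity
  have h2 : (Fintype.card {q : (Fin r × Fin r) × (Fin r × Fin r) // q.1 ≠ q.2} : ℝ)
      * (784 * γ₃ + 784 * γ₃) ≤ 3136 * (r : ℝ) ^ 4 * M * γ₃ := by
    calc _ ≤ (r : ℝ) ^ 4 * (784 * γ₃ + 784 * γ₃) := by gcongr
      _ = 3136 * (r : ℝ) ^ 4 * (1 / 2) * γ₃ := by ring
      _ ≤ _ := by gcongr
  push_cast
  nlinarith

/-! ### The operator norm of a Gaussian tensor -/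

instance instIsProbabilityMeasureNoiseLaw (p N : ℕ) : IsProbabilityMeasure (noiseLaw p N) := by
  unfold noiseLaw
  infer_instance

/-- The multilinear form `(u₁, …, u_p) ↦ ⟨W, u₁ ⊗ ⋯ ⊗ u_p⟩` on Euclidean space. Its norm is the
injective norm of `W`. -/
noncomputable def tensorForm {p N : ℕ} (W : NoiseTensor p N) :
    ContinuousMultilinearMap ℝ (fun _ : Fin p => EuclideanSpace ℝ (Fin N)) ℝ :=
  ∑ a : Fin p → Fin N, W a •
    (ContinuousMultilinearMap.mkPiAlgebra ℝ (Fin p) ℝ).compContinuousLinearMap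
      (fun k => EuclideanSpace.proj (a k))

theorem tensorForm_apply {p N : ℕ} (W : NoiseTensor p N)
    (u : Fin p → EuclideanSpace ℝ (Fin N)) :
    tensorForm W u = ∑ a : Fin p → Fin N, W a * ∏ k, u k (a k) := by
  simp [tensorForm]

/-- A maximal `1/2`-separated subset of the unit ball. -/
theorem exists_half_net (N : ℕ) : ∃ s : Finset (EuclideanSpace ℝ (Fin N)),
    s.card ≤ 5 ^ N ∧ (∀ y ∈ s, ‖y‖ ≤ 1) ∧ ∀ x, ‖x‖ ≤ 1 → ∃ y ∈ s, ‖x - y‖ ≤ 1 / 2 := by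
  classical
  let P : Finset (EuclideanSpace ℝ (Fin N)) → Prop := fun s =>
    (∀ y ∈ s, ‖y‖ ≤ 1) ∧ ∀ y ∈ s, ∀ z ∈ s, y ≠ z → 1 / 2 ≤ ‖y - z‖
  have hcard : ∀ s, P s → s.card ≤ 5 ^ N := by
    intro s hs
    have h2 : Function.Injective fun y : EuclideanSpace ℝ (Fin N) => (2 : ℝ) • y :=
      smul_right_injective _ two_ne_zero
    have := Besicovitch.card_le_of_separated (s.image fun y => (2 : ℝ) • y) (by
        intro c hc
        obtain ⟨y, hy, rfl⟩ := Finset.mem_image.mp hc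
        rw [norm_smul, Real.norm_two]
        linarith [hs.1 y hy]) (by
        intro c hc d hd hcd
        obtain ⟨y, hy, rfl⟩ := Finset.mem_image.mp hc
        obtain ⟨z, hz, rfl⟩ := Finset.mem_image.mp hd
        have hyz : y ≠ z := fun h => hcd (by rw [h])
        rw [← smul_sub, norm_smul, Real.norm_two]
        linarith [hs.2 y hy z hz hyz])
    rwa [Finset.card_image_of_injective _ h2, finrank_euclideanSpace_fin] at this
  let C : Set ℕ := {n | ∃ s, P s ∧ s.card = n}
  have hC : sSup C ∈ C := Nat.sSup_mem ⟨0, ∅, by simp [P], rfl⟩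
    ⟨5 ^ N, by rintro n ⟨s, hs, rfl⟩; exact hcard s hs⟩
  obtain ⟨s, hs, hsC⟩ := hC
  refine ⟨s, hcard s hs, hs.1, fun x hx => ?_⟩
  by_contra! hcon
  have hxs : x ∉ s := fun h => by
    have := hcon x h
    norm_num at this
  have hP : P (insert x s) := by
    refine ⟨fun y hy => ?_, fun y hy z hz hyz => ?_⟩
    · rcases Finset.mem_insert.mp hy with rfl | hy
      · exact hx
      · exact hs.1 y hy
    · rcases Finset.mem_insert.mp hy with rfl | hy' <;>
        rcases Finset.mem_insert.mp hz with rfl | hz'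
      · exact absurd rfl hyz
      · exact (hcon z hz').le
      · rw [norm_sub_rev]
        exact (hcon y hy').le
      · exact hs.2 y hy' z hz' hyz
  have hle : (insert x s).card ≤ sSup C :=
    le_csSup ⟨5 ^ N, by rintro n ⟨s, hs, rfl⟩; exact hcard s hs⟩ ⟨_, hP, rfl⟩
  rw [Finset.card_insert_of_notMem hxs, hsC] at hle
  omega

theorem abs_apply_le_of_half_net {E : Type*} [NormedAddCommGroup E] [NormedSpace ℝ E]
    {s : Finset E} (hs : ∀ x, ‖x‖ ≤ 1 → ∃ y ∈ s, ‖x - y‖ ≤ 1 / 2) {f : E →L[ℝ] ℝ} {B : ℝ}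
    (hB : ∀ y ∈ s, |f y| ≤ B) (x : E) : |f x| ≤ 2 * B * ‖x‖ := by
  have hB0 : 0 ≤ B := by
    obtain ⟨y, hy, -⟩ := hs 0 (by simp)
    exact (abs_nonneg _).trans (hB y hy)
  have hf : ‖f‖ ≤ B + ‖f‖ / 2 := by
    refine ContinuousLinearMap.opNorm_le_of_unit_norm (by positivity) fun x hx => ?_
    obtain ⟨y, hy, hxy⟩ := hs x hx.le
    have e : f x = f y + f (x - y) := by rw [← map_add]; congr 1; abel
    rw [e]
    refine (norm_add_le _ _).trans (add_le_add (hB y hy) ((f.le_opNorm _).trans ?_))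
    nlinarith [norm_nonneg f]
  refine (f.le_opNorm x).trans ?_
  gcongr
  linarith

/-- A multilinear form bounded by `A` on a `1/2`-net of the unit ball has norm at most `2^p A`:
each slot costs a factor two. -/
theorem norm_le_of_half_net {p : ℕ} {E : Type*} [NormedAddCommGroup E] [NormedSpace ℝ E]
    {s : Finset E} (hs : ∀ x, ‖x‖ ≤ 1 → ∃ y ∈ s, ‖x - y‖ ≤ 1 / 2)
    (T : ContinuousMultilinearMap ℝ (fun _ : Fin p => E) ℝ) {A : ℝ} (hA0 : 0 ≤ A)
    (hA : ∀ u : Fin p → E, (∀ k, u k ∈ s) → |T u| ≤ A) : ‖T‖ ≤ 2 ^ p * A := by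
  classical
  have key : ∀ t : Finset (Fin p), ∀ u : Fin p → E, (∀ k ∉ t, u k ∈ s) →
      |T u| ≤ 2 ^ t.card * A * ∏ k ∈ t, ‖u k‖ := by
    intro t
    induction t using Finset.induction_on with
    | empty =>
      intro u hu
      simpa using hA u fun k => hu k (by simp)
    | insert k t hkt ih =>
      intro u hu
      have h1 : ∀ y ∈ s, |T.toContinuousLinearMap u k y| ≤ 2 ^ t.card * A * ∏ i ∈ t, ‖u i‖ := by
        intro y hy
        have h2 := ih (Function.update u k y) (by
          intro i hi
          rcases eq_or_ne i k with rfl | hik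
          · simpa using hy
          · rw [Function.update_of_ne hik]
            exact hu i (by simp [hik, hi]))
        have h3 : ∏ i ∈ t, ‖Function.update u k y i‖ = ∏ i ∈ t, ‖u i‖ := by
          refine Finset.prod_congr rfl fun i hi => ?_
          rw [Function.update_of_ne (by rintro rfl; exact hkt hi)]
        rw [h3] at h2
        exact h2
      have h4 := abs_apply_le_of_half_net hs h1 (u k)
      have h5 : T.toContinuousLinearMap u k (u k) = T u := by
        change T (Function.update u k (u k)) = T u
        rw [Function.update_eq_self]
      rw [h5] at h4
      rw [Finset.card_insert_of_notMem hkt, Finset.prod_insert hkt, pow_succ]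
      calc |T u| ≤ _ := h4
        _ = _ := by ring
  refine ContinuousMultilinearMap.opNorm_le_bound (by positivity) fun u => ?_
  simpa using key Finset.univ u (by simp)

/-- Union bound over the `p`-tuples of a `1/2`-net: at each of them the form is a centered
Gaussian of variance at most one. -/
theorem noiseLaw_norm_tensorForm_gt_le (p N : ℕ) {s : ℝ} (hs : 0 ≤ s) :
    noiseLaw p N {W | 2 ^ p * s < ‖tensorForm W‖}
      ≤ ENNReal.ofReal (2 * 5 ^ (p * N) * Real.exp (-s ^ 2 / 2)) := by
  classical
  obtain ⟨net, hcard, hnet1, hnet⟩ := exists_half_net N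
  have hsub : {W : NoiseTensor p N | 2 ^ p * s < ‖tensorForm W‖} ⊆
      ⋃ u ∈ Fintype.piFinset fun _ : Fin p => net,
        {W | s ≤ |(fun a : Fin p → Fin N => ∏ k, u k (a k)) ⬝ᵥ W|} := by
    intro W hW
    by_contra hcon
    simp only [Set.mem_iUnion, Fintype.mem_piFinset, Set.mem_ofPred_eq, not_exists, not_le] at hcon
    refine absurd (norm_le_of_half_net hnet (tensorForm W) hs fun u hu => ?_) (not_le.mpr hW)
    have := (hcon u hu).le
    rwa [dotProduct_comm, dotProduct, ← tensorForm_apply] at this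
  refine (measure_mono hsub).trans ((measure_biUnion_finset_le _ _).trans
    ((Finset.sum_le_sum fun u hu => gaussPi_abs_dotProduct_ge_le ?_ hs).trans ?_))
  · have hu := Fintype.mem_piFinset.mp hu
    have e : (fun a : Fin p → Fin N => ∏ k, u k (a k)) ⬝ᵥ (fun a => ∏ k, u k (a k))
        = ∏ k, ∑ b, u k b * u k b := by
      rw [Finset.prod_univ_sum, Fintype.piFinset_univ]
      simp only [dotProduct, ← Finset.prod_mul_distrib]
    rw [e]
    refine Finset.prod_le_one (fun k _ => Finset.sum_nonneg fun b _ => mul_self_nonneg _)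
      fun k _ => ?_
    have h1 := hnet1 _ (hu k)
    have h2 := EuclideanSpace.real_norm_sq_eq (u k)
    simp only [pow_two] at h2
    rw [← h2]
    exact mul_le_one₀ h1 (norm_nonneg _) h1
  · rw [Finset.sum_const, nsmul_eq_mul, ← ENNReal.ofReal_natCast,
      ← ENNReal.ofReal_mul (by positivity)]
    apply ENNReal.ofReal_le_ofReal
    rw [Fintype.card_piFinset_const]
    have h1 : ((net.card ^ p : ℕ) : ℝ) ≤ 5 ^ (p * N) := by
      calc ((net.card ^ p : ℕ) : ℝ) ≤ (((5 ^ N) ^ p : ℕ) : ℝ) := by gcongr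
        _ = _ := by push_cast; rw [← pow_mul, mul_comm]
    calc _ ≤ (5 : ℝ) ^ (p * N) * (2 * Real.exp (-s ^ 2 / 2)) := by gcongr
      _ = _ := by ring

/-! ### The gradient of the noise Hamiltonian -/

/-- The `j`-th column of a matrix, as a vector of Euclidean space. -/
noncomputable def euclCol {N r : ℕ} (X : Matrix (Fin N) (Fin r) ℝ) (j : Fin r) :
    EuclideanSpace ℝ (Fin N) :=
  WithLp.toLp 2 fun a => X a j

@[simp]
theorem euclCol_apply {N r : ℕ} (X : Matrix (Fin N) (Fin r) ℝ) (j : Fin r) (a : Fin N) :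
    euclCol X j a = X a j := rfl

theorem norm_euclCol_of_mem_stiefel {N r : ℕ} {X : Matrix (Fin N) (Fin r) ℝ}
    (hX : X ∈ stiefel N r) (j : Fin r) : ‖euclCol X j‖ = √(N : ℝ) := by
  have h := congrFun (congrFun hX j) j
  rw [Matrix.mul_apply, Matrix.smul_apply, Matrix.one_apply_eq, smul_eq_mul, mul_one] at h
  rw [EuclideanSpace.norm_eq, ← h]
  simp [pow_two]

/-- The derivative of `N^{-(p-1)/2} λ_j ⟨W, x^{⊗p}⟩` in the direction `h`. -/
noncomputable def gradForm {p N r : ℕ} (lam : Fin r → ℝ) (W : NoiseTensor p N) (j : Fin r)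
    (h x : EuclideanSpace ℝ (Fin N)) : ℝ :=
  (N : ℝ) ^ (-(((p : ℝ) - 1) / 2)) *
    (lam j * ∑ k : Fin p, tensorForm W (Function.update (fun _ => x) k h))

/-- The inner product of `h` with the `j`-th column of the Riemannian gradient of the noise
Hamiltonian. -/
noncomputable def riemForm {p N r : ℕ} (lam : Fin r → ℝ) (W : NoiseTensor p N) (j : Fin r)
    (h : EuclideanSpace ℝ (Fin N)) (X : Matrix (Fin N) (Fin r) ℝ) : ℝ :=
  gradForm lam W j h (euclCol X j) - (1 / (2 * (N : ℝ))) * ∑ l : Fin r, inner ℝ h (euclCol X l) *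
    (gradForm lam W j (euclCol X l) (euclCol X j) + gradForm lam W l (euclCol X j) (euclCol X l))

theorem hasDerivAt_multilinear_line {p : ℕ} {E : Type*} [NormedAddCommGroup E] [NormedSpace ℝ E]
    (T : ContinuousMultilinearMap ℝ (fun _ : Fin p => E) ℝ) (x h : E) :
    HasDerivAt (fun t : ℝ => T fun _ => x + t • h)
      (∑ k, T (Function.update (fun _ => x) k h)) 0 := by
  have h1 : HasDerivAt (fun t : ℝ => (fun _ : Fin p => x + t • h)) (fun _ => h) 0 := by
    rw [hasDerivAt_pi]
    intro k
    simpa using ((hasDerivAt_id (0 : ℝ)).smul_const h).const_add x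
  have h2 : HasFDerivAt T (T.linearDeriv fun _ => x)
      ((fun t : ℝ => (fun _ : Fin p => x + t • h)) 0) := by
    simpa using T.hasFDerivAt (fun _ => x)
  have h3 := h2.comp_hasDerivAt (0 : ℝ) h1
  rwa [ContinuousMultilinearMap.linearDeriv_apply] at h3

theorem noiseHamiltonian_eq {p N r : ℕ} (lam : Fin r → ℝ) (W : NoiseTensor p N)
    (X : Matrix (Fin N) (Fin r) ℝ) :
    noiseHamiltonian lam W X = (N : ℝ) ^ (-(((p : ℝ) - 1) / 2)) *
      ∑ j : Fin r, lam j * tensorForm W fun _ => euclCol X j := by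
  simp [noiseHamiltonian, tensorForm_apply]

theorem euclCol_add_smul_single {N r : ℕ} (X : Matrix (Fin N) (Fin r) ℝ) (a : Fin N) (j l : Fin r)
    (t : ℝ) : euclCol (X + t • Matrix.single a j 1) l
      = euclCol X l + t • (if l = j then EuclideanSpace.single a 1 else 0) := by
  ext b
  by_cases hl : l = j
  · subst hl
    by_cases hb : b = a
    · subst hb; simp
    · simp [hb, Matrix.single_apply_of_row_ne (Ne.symm hb)]
  · simp [hl, Matrix.single_apply_of_col_ne a b (Ne.symm hl)]

theorem euclGrad_noiseHamiltonian {p N r : ℕ} (lam : Fin r → ℝ) (W : NoiseTensor p N)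
    (X : Matrix (Fin N) (Fin r) ℝ) (a : Fin N) (j : Fin r) :
    euclGrad (noiseHamiltonian lam W) X a j
      = gradForm lam W j (EuclideanSpace.single a 1) (euclCol X j) := by
  rw [euclGrad, Matrix.of_apply]
  refine HasLineDerivAt.lineDeriv ?_
  unfold HasLineDerivAt
  simp only [noiseHamiltonian_eq, euclCol_add_smul_single]
  refine HasDerivAt.const_mul _ ?_
  have h1 : ∀ l ∈ Finset.univ, HasDerivAt (fun t : ℝ => lam l * tensorForm W fun _ =>
      euclCol X l + t • (if l = j then EuclideanSpace.single a 1 else 0))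
      (lam l * ∑ k, tensorForm W (Function.update (fun _ => euclCol X l) k
        (if l = j then EuclideanSpace.single a 1 else 0))) 0 := fun l _ =>
    (hasDerivAt_multilinear_line (tensorForm W) _ _).const_mul _
  have h2 := HasDerivAt.fun_sum h1
  rw [Finset.sum_eq_single j] at h2
  · simpa using h2
  · intro l _ hl
    rw [if_neg hl, Finset.sum_eq_zero fun k _ => (tensorForm W).map_coord_zero k (by simp),
      mul_zero]
  · simp

theorem sum_mul_gradForm_single {p N r : ℕ} (lam : Fin r → ℝ) (W : NoiseTensor p N) (j : Fin r)
    (h x : EuclideanSpace ℝ (Fin N)) :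
    ∑ a, h a * gradForm lam W j (EuclideanSpace.single a 1) x = gradForm lam W j h x := by
  have hh : ∀ k : Fin p, tensorForm W (Function.update (fun _ => x) k h)
      = ∑ a, h a * tensorForm W (Function.update (fun _ => x) k (EuclideanSpace.single a 1)) := by
    intro k
    have e : h = ∑ a, h a • (EuclideanSpace.single a 1 : EuclideanSpace ℝ (Fin N)) := by
      ext b
      simp [Pi.single_apply]
    have := map_sum ((tensorForm W).toContinuousLinearMap (fun _ => x) k)
      (fun a => h a • (EuclideanSpace.single a 1 : EuclideanSpace ℝ (Fin N))) Finset.univ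
    rw [← e] at this
    simp only [map_smul, smul_eq_mul] at this
    exact this
  simp only [gradForm, hh]
  rw [Finset.sum_comm, Finset.mul_sum, Finset.mul_sum]
  refine Finset.sum_congr rfl fun a _ => ?_
  rw [← Finset.mul_sum]
  ring

theorem sum_mul_riemGrad {p N r : ℕ} (lam : Fin r → ℝ) (W : NoiseTensor p N)
    (X : Matrix (Fin N) (Fin r) ℝ) (h : EuclideanSpace ℝ (Fin N)) (j : Fin r) :
    ∑ a, h a * riemGrad (noiseHamiltonian lam W) X a j = riemForm lam W j h X := by
  have h1 : ∀ l m, (X.transpose * euclGrad (noiseHamiltonian lam W) X) l m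
      = gradForm lam W m (euclCol X l) (euclCol X m) := by
    intro l m
    simp only [Matrix.mul_apply, Matrix.transpose_apply, euclGrad_noiseHamiltonian]
    exact sum_mul_gradForm_single lam W m (euclCol X l) (euclCol X m)
  have h2 : ∀ l m, ((euclGrad (noiseHamiltonian lam W) X).transpose * X) l m
      = gradForm lam W l (euclCol X m) (euclCol X l) := by
    intro l m
    rw [← h1, Matrix.mul_apply, Matrix.mul_apply]
    exact Finset.sum_congr rfl fun a _ => mul_comm _ _
  have h3 : ∀ a, (X * (X.transpose * euclGrad (noiseHamiltonian lam W) X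
      + (euclGrad (noiseHamiltonian lam W) X).transpose * X)) a j
      = ∑ l, X a l * (gradForm lam W j (euclCol X l) (euclCol X j)
        + gradForm lam W l (euclCol X j) (euclCol X l)) := by
    intro a
    rw [Matrix.mul_apply]
    refine Finset.sum_congr rfl fun l _ => ?_
    rw [Matrix.add_apply, h1, h2]
  simp only [riemGrad, Matrix.sub_apply, Matrix.smul_apply, smul_eq_mul, h3, mul_sub,
    Finset.sum_sub_distrib]
  rw [riemForm, ← sum_mul_gradForm_single lam W j h (euclCol X j)]
  simp only [euclGrad_noiseHamiltonian]
  congr 1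
  simp only [Finset.mul_sum]
  rw [Finset.sum_comm]
  refine Finset.sum_congr rfl fun l _ => ?_
  rw [PiLp.inner_apply, Finset.sum_mul, Finset.mul_sum]
  refine Finset.sum_congr rfl fun a _ => ?_
  simp
  ring

theorem riemGrad_noiseHamiltonian_apply {p N r : ℕ} (lam : Fin r → ℝ) (W : NoiseTensor p N)
    (X : Matrix (Fin N) (Fin r) ℝ) (a : Fin N) (j : Fin r) :
    riemGrad (noiseHamiltonian lam W) X a j
      = riemForm lam W j (EuclideanSpace.single a 1) X := by
  rw [← sum_mul_riemGrad, Finset.sum_eq_single a]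
  · simp
  · intro b _ hb
    simp [hb]
  · simp

theorem noiseGen_corr {p N r : ℕ} (M : ℕ) (lam : Fin r → ℝ) (W : NoiseTensor p N)
    (V : Matrix (Fin N) (Fin r) ℝ) (i j : Fin r) (X : Matrix (Fin N) (Fin r) ℝ) :
    noiseGen M lam W (corr V i j) X
      = -((1 / √M) * ((N : ℝ)⁻¹ * riemForm lam W j (euclCol V i) X)) := by
  have hgrad : ∀ a l, euclGrad (corr V i j) X a l = (N : ℝ)⁻¹ * if l = j then V a i else 0 := by
    intro a l
    rw [euclGrad, Matrix.of_apply]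
    refine HasLineDerivAt.lineDeriv ?_
    unfold HasLineDerivAt
    have e : ∀ t : ℝ, corr V i j (X + t • Matrix.single a l 1)
        = corr V i j X + t * ((N : ℝ)⁻¹ * if l = j then V a i else 0) := by
      intro t
      have e2 : (V.transpose * Matrix.single a l (1 : ℝ)) i j = if l = j then V a i else 0 := by
        by_cases hl : l = j
        · subst hl; simp
        · simp [hl, Matrix.mul_single_apply_of_ne _ _ _ _ _ (Ne.symm hl)]
      rw [corr, corr, Matrix.mul_add, Matrix.mul_smul, Matrix.add_apply, Matrix.smul_apply, e2,
        smul_eq_mul]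
      ring
    simp only [e]
    have h := ((hasDerivAt_id (0 : ℝ)).mul_const
      ((N : ℝ)⁻¹ * if l = j then V a i else 0)).const_add (corr V i j X)
    rw [one_mul] at h
    exact h
  rw [noiseGen, ← sum_mul_riemGrad, Matrix.trace]
  congr 2
  rw [Finset.sum_eq_single j]
  · rw [Matrix.diag_apply, Matrix.mul_apply, Finset.mul_sum]
    refine Finset.sum_congr rfl fun a _ => ?_
    rw [hgrad, if_pos rfl, Matrix.transpose_apply, euclCol_apply]
    ring
  · intro l _ hl
    rw [Matrix.diag_apply, Matrix.mul_apply]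
    simp [hgrad, hl]
  · simp

/-! ### Bounds on the gradient through the norm of the tensor -/

theorem rpow_mul_sqrt_pow {N p : ℕ} (hN : N ≠ 0) (hp : 1 ≤ p) :
    (N : ℝ) ^ (-(((p : ℝ) - 1) / 2)) * √(N : ℝ) ^ (p - 1) = 1 := by
  have hN0 : (0 : ℝ) < N := by positivity
  rw [← Real.rpow_natCast, Real.sqrt_eq_rpow, ← Real.rpow_mul hN0.le, ← Real.rpow_add hN0]
  have : -(((p : ℝ) - 1) / 2) + 1 / 2 * ((p - 1 : ℕ) : ℝ) = 0 := by
    rw [Nat.cast_sub hp]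
    push_cast
    ring
  rw [this, Real.rpow_zero]

theorem abs_gradForm_le {p N r : ℕ} (hN : N ≠ 0) (hp : 1 ≤ p) {lam : Fin r → ℝ} {Λ : ℝ}
    (h0 : ∀ j, 0 ≤ lam j) (hΛ : ∀ j, lam j ≤ Λ) (W : NoiseTensor p N) (j : Fin r)
    {h x : EuclideanSpace ℝ (Fin N)} (hx : ‖x‖ ≤ √(N : ℝ)) :
    |gradForm lam W j h x| ≤ Λ * p * ‖tensorForm W‖ * ‖h‖ := by
  have hterm : ∀ k : Fin p, |tensorForm W (Function.update (fun _ => x) k h)|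
      ≤ ‖tensorForm W‖ * (‖h‖ * √(N : ℝ) ^ (p - 1)) := by
    intro k
    refine ((tensorForm W).le_opNorm _).trans ?_
    gcongr
    rw [← Finset.mul_prod_erase _ _ (Finset.mem_univ k), Function.update_self]
    gcongr
    calc ∏ i ∈ Finset.univ.erase k, ‖Function.update (fun _ => x) k h i‖
        ≤ ∏ i ∈ Finset.univ.erase k, √(N : ℝ) := by
          refine Finset.prod_le_prod (fun _ _ => norm_nonneg _) fun i hi => ?_
          rw [Function.update_of_ne (Finset.ne_of_mem_erase hi)]
          exact hx
      _ = _ := by simp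
  have hsum : |∑ k : Fin p, tensorForm W (Function.update (fun _ => x) k h)|
      ≤ p * (‖tensorForm W‖ * (‖h‖ * √(N : ℝ) ^ (p - 1))) := by
    refine (Finset.abs_sum_le_sum_abs _ _).trans ((Finset.sum_le_sum fun k _ => hterm k).trans ?_)
    simp
  have hc : (0 : ℝ) ≤ (N : ℝ) ^ (-(((p : ℝ) - 1) / 2)) := by positivity
  rw [gradForm, abs_mul, abs_mul, abs_of_nonneg hc, abs_of_nonneg (h0 j)]
  calc _ ≤ (N : ℝ) ^ (-(((p : ℝ) - 1) / 2)) *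
        (Λ * (p * (‖tensorForm W‖ * (‖h‖ * √(N : ℝ) ^ (p - 1))))) := by
        gcongr
        · exact (h0 j).trans (hΛ j)
        · exact hΛ j
    _ = Λ * p * ‖tensorForm W‖ * ‖h‖ *
        ((N : ℝ) ^ (-(((p : ℝ) - 1) / 2)) * √(N : ℝ) ^ (p - 1)) := by ring
    _ = _ := by rw [rpow_mul_sqrt_pow hN hp, mul_one]

theorem abs_gradForm_sub_le {p N r : ℕ} (hN : N ≠ 0) (hp : 1 ≤ p) {lam : Fin r → ℝ} {Λ : ℝ}
    (h0 : ∀ j, 0 ≤ lam j) (hΛ : ∀ j, lam j ≤ Λ) (W : NoiseTensor p N) (j : Fin r)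
    {h h' x x' : EuclideanSpace ℝ (Fin N)} (hx : ‖x‖ ≤ √(N : ℝ)) (hx' : ‖x'‖ ≤ √(N : ℝ))
    (hh : ‖h‖ ≤ √(N : ℝ)) (hh' : ‖h'‖ ≤ √(N : ℝ)) {d : ℝ} (hd : ‖h - h'‖ ≤ d)
    (hd' : ‖x - x'‖ ≤ d) :
    |gradForm lam W j h x - gradForm lam W j h' x'| ≤ Λ * p ^ 2 * ‖tensorForm W‖ * d := by
  have hd0 : 0 ≤ d := (norm_nonneg _).trans hd
  have hupd : ∀ (k : Fin p) {h x : EuclideanSpace ℝ (Fin N)} {R : ℝ}, 0 ≤ R → ‖h‖ ≤ R →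
      ‖x‖ ≤ R → ‖Function.update (fun _ : Fin p => x) k h‖ ≤ R := by
    intro k h x R hR hh hx
    rw [pi_norm_le_iff_of_nonneg hR]
    intro i
    rcases eq_or_ne i k with rfl | hik
    · simpa using hh
    · simpa [hik] using hx
  have hterm : ∀ k : Fin p, |tensorForm W (Function.update (fun _ => x) k h)
      - tensorForm W (Function.update (fun _ => x') k h')|
      ≤ ‖tensorForm W‖ * p * √(N : ℝ) ^ (p - 1) * d := by
    intro k
    refine ((tensorForm W).norm_image_sub_le _ _).trans ?_
    rw [Fintype.card_fin]
    gcongr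
    · exact max_le (hupd k (by positivity) hh hx) (hupd k (by positivity) hh' hx')
    · have e : Function.update (fun _ : Fin p => x) k h - Function.update (fun _ => x') k h'
          = Function.update (fun _ => x - x') k (h - h') := by
        funext i
        rcases eq_or_ne i k with rfl | hik
        · simp
        · simp [hik]
      rw [e]
      exact hupd k hd0 hd hd'
  have hsum : |∑ k : Fin p, tensorForm W (Function.update (fun _ => x) k h)
      - ∑ k : Fin p, tensorForm W (Function.update (fun _ => x') k h')|
      ≤ p * (‖tensorForm W‖ * p * √(N : ℝ) ^ (p - 1) * d) := by
    rw [← Finset.sum_sub_distrib]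
    refine (Finset.abs_sum_le_sum_abs _ _).trans ((Finset.sum_le_sum fun k _ => hterm k).trans ?_)
    simp
  have hc : (0 : ℝ) ≤ (N : ℝ) ^ (-(((p : ℝ) - 1) / 2)) := by positivity
  rw [gradForm, gradForm, ← mul_sub, ← mul_sub, abs_mul, abs_mul, abs_of_nonneg hc,
    abs_of_nonneg (h0 j)]
  calc _ ≤ (N : ℝ) ^ (-(((p : ℝ) - 1) / 2)) *
        (Λ * (p * (‖tensorForm W‖ * p * √(N : ℝ) ^ (p - 1) * d))) := by
        gcongr
        · exact (h0 j).trans (hΛ j)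
        · exact hΛ j
    _ = Λ * p ^ 2 * ‖tensorForm W‖ * d *
        ((N : ℝ) ^ (-(((p : ℝ) - 1) / 2)) * √(N : ℝ) ^ (p - 1)) := by ring
    _ = _ := by rw [rpow_mul_sqrt_pow hN hp, mul_one]

theorem abs_riemForm_le {p N r : ℕ} (hN : N ≠ 0) (hp : 1 ≤ p) {lam : Fin r → ℝ} {Λ : ℝ}
    (h0 : ∀ j, 0 ≤ lam j) (hΛ : ∀ j, lam j ≤ Λ) (W : NoiseTensor p N) (j : Fin r)
    (h : EuclideanSpace ℝ (Fin N)) {X : Matrix (Fin N) (Fin r) ℝ} (hX : X ∈ stiefel N r) :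
    |riemForm lam W j h X| ≤ (1 + r) * Λ * p * ‖tensorForm W‖ * ‖h‖ := by
  have hn := fun l => norm_euclCol_of_mem_stiefel hX l
  have hN0 : 0 < √(N : ℝ) := by positivity
  have hsq : √(N : ℝ) * √(N : ℝ) = N := Real.mul_self_sqrt (Nat.cast_nonneg N)
  have hg : ∀ l m, |gradForm lam W l (euclCol X m) (euclCol X l)|
      ≤ Λ * p * ‖tensorForm W‖ * √(N : ℝ) := by
    intro l m
    rw [← hn m]
    exact abs_gradForm_le hN hp h0 hΛ W l (hn l).le
  have hsum : |∑ l : Fin r, inner ℝ h (euclCol X l) *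
      (gradForm lam W j (euclCol X l) (euclCol X j) + gradForm lam W l (euclCol X j) (euclCol X l))|
      ≤ r * (‖h‖ * √(N : ℝ) * (2 * (Λ * p * ‖tensorForm W‖ * √(N : ℝ)))) := by
    refine (Finset.abs_sum_le_sum_abs _ _).trans ((Finset.sum_le_sum
      (g := fun _ => ‖h‖ * √(N : ℝ) * (2 * (Λ * p * ‖tensorForm W‖ * √(N : ℝ))))
      fun l _ => ?_).trans ?_)
    · rw [abs_mul]
      refine mul_le_mul ?_ ?_ (abs_nonneg _) (by positivity)
      · rw [← hn l]
        exact abs_real_inner_le_norm _ _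
      · refine (abs_add_le _ _).trans ?_
        linarith [hg j l, hg l j]
    · simp
  rw [riemForm]
  refine (abs_sub _ _).trans ?_
  rw [abs_mul, abs_of_pos (show (0 : ℝ) < 1 / (2 * N) by positivity)]
  calc _ ≤ Λ * p * ‖tensorForm W‖ * ‖h‖ + 1 / (2 * (N : ℝ)) *
        (r * (‖h‖ * √(N : ℝ) * (2 * (Λ * p * ‖tensorForm W‖ * √(N : ℝ))))) := by
        gcongr
        exact abs_gradForm_le hN hp h0 hΛ W j (hn j).le
    _ = Λ * p * ‖tensorForm W‖ * ‖h‖ + r * Λ * p * ‖tensorForm W‖ * ‖h‖ *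
        ((√(N : ℝ) * √(N : ℝ)) / N) := by
        field_simp
    _ = _ := by
        rw [hsq, div_self (by positivity)]
        ring

theorem abs_riemForm_sub_le {p N r : ℕ} (hN : N ≠ 0) (hp : 1 ≤ p) {lam : Fin r → ℝ} {Λ : ℝ}
    (h0 : ∀ j, 0 ≤ lam j) (hΛ : ∀ j, lam j ≤ Λ) (W : NoiseTensor p N) (j : Fin r)
    {h : EuclideanSpace ℝ (Fin N)} (hh : ‖h‖ = √(N : ℝ)) {X Y : Matrix (Fin N) (Fin r) ℝ}
    (hX : X ∈ stiefel N r) (hY : Y ∈ stiefel N r) {d : ℝ}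
    (hd : ∀ l, ‖euclCol X l - euclCol Y l‖ ≤ d) :
    |riemForm lam W j h X - riemForm lam W j h Y|
      ≤ (1 + 2 * r) * Λ * p ^ 2 * ‖tensorForm W‖ * d := by
  have hn := fun l => norm_euclCol_of_mem_stiefel hX l
  have hm := fun l => norm_euclCol_of_mem_stiefel hY l
  have hN0 : 0 < √(N : ℝ) := by positivity
  have hsq : √(N : ℝ) * √(N : ℝ) = N := Real.mul_self_sqrt (Nat.cast_nonneg N)
  have hd0 : 0 ≤ d := (norm_nonneg _).trans (hd j)
  have hΛ0 : 0 ≤ Λ := (h0 j).trans (hΛ j)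
  have hpp : (p : ℝ) ≤ (p : ℝ) ^ 2 := by
    have : (1 : ℝ) ≤ p := by exact_mod_cast hp
    nlinarith
  set τ := ‖tensorForm W‖ with hτ
  have hτ0 : 0 ≤ τ := norm_nonneg _
  have hg : ∀ l m, |gradForm lam W l (euclCol X m) (euclCol X l)| ≤ Λ * p ^ 2 * τ * √(N : ℝ) := by
    intro l m
    rw [← hn m]
    refine (abs_gradForm_le hN hp h0 hΛ W l (hn l).le).trans ?_
    gcongr
  have hgl : ∀ l m, |gradForm lam W l (euclCol X m) (euclCol X l)
      - gradForm lam W l (euclCol Y m) (euclCol Y l)| ≤ Λ * p ^ 2 * τ * d := fun l m =>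
    abs_gradForm_sub_le hN hp h0 hΛ W l (hn l).le (hm l).le (hn m).le (hm m).le (hd m) (hd l)
  have hsum : |∑ l : Fin r, inner ℝ h (euclCol X l) *
      (gradForm lam W j (euclCol X l) (euclCol X j) + gradForm lam W l (euclCol X j) (euclCol X l))
      - ∑ l : Fin r, inner ℝ h (euclCol Y l) *
      (gradForm lam W j (euclCol Y l) (euclCol Y j) + gradForm lam W l (euclCol Y j) (euclCol Y l))|
      ≤ r * (4 * (Λ * p ^ 2 * τ * N * d)) := by
    rw [← Finset.sum_sub_distrib]
    refine (Finset.abs_sum_le_sum_abs _ _).trans ((Finset.sum_le_sum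
      (g := fun _ => 4 * (Λ * p ^ 2 * τ * N * d)) fun l _ => ?_).trans ?_)
    · set A := gradForm lam W j (euclCol X l) (euclCol X j)
          + gradForm lam W l (euclCol X j) (euclCol X l)
      set B := gradForm lam W j (euclCol Y l) (euclCol Y j)
          + gradForm lam W l (euclCol Y j) (euclCol Y l)
      have hA : |A| ≤ 2 * (Λ * p ^ 2 * τ * √(N : ℝ)) :=
        (abs_add_le _ _).trans (by linarith [hg j l, hg l j])
      have hAB : |A - B| ≤ 2 * (Λ * p ^ 2 * τ * d) := by
        have e : A - B = (gradForm lam W j (euclCol X l) (euclCol X j)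
            - gradForm lam W j (euclCol Y l) (euclCol Y j))
            + (gradForm lam W l (euclCol X j) (euclCol X l)
            - gradForm lam W l (euclCol Y j) (euclCol Y l)) := by
          simp only [A, B]
          ring
        rw [e]
        exact (abs_add_le _ _).trans (by linarith [hgl j l, hgl l j])
      have e : inner ℝ h (euclCol X l) * A - inner ℝ h (euclCol Y l) * B
          = inner ℝ h (euclCol X l - euclCol Y l) * A + inner ℝ h (euclCol Y l) * (A - B) := by
        rw [inner_sub_right]
        ring
      have h1 : |inner ℝ h (euclCol X l - euclCol Y l)| ≤ √(N : ℝ) * d := by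
        refine (abs_real_inner_le_norm _ _).trans ?_
        rw [hh]
        gcongr
        exact hd l
      have h2 : |inner ℝ h (euclCol Y l)| ≤ √(N : ℝ) * √(N : ℝ) := by
        refine (abs_real_inner_le_norm _ _).trans ?_
        rw [hh, hm l]
      rw [e]
      calc _ ≤ √(N : ℝ) * d * (2 * (Λ * p ^ 2 * τ * √(N : ℝ)))
            + √(N : ℝ) * √(N : ℝ) * (2 * (Λ * p ^ 2 * τ * d)) := by
            refine (abs_add_le _ _).trans (add_le_add ?_ ?_)
            · rw [abs_mul]
              exact mul_le_mul h1 hA (abs_nonneg _) (by positivity)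
            · rw [abs_mul]
              exact mul_le_mul h2 hAB (abs_nonneg _) (by positivity)
        _ = 4 * (Λ * p ^ 2 * τ * (√(N : ℝ) * √(N : ℝ)) * d) := by ring
        _ = _ := by rw [hsq]
    · simp
  have h3 := abs_gradForm_sub_le hN hp h0 hΛ W j (hn j).le (hm j).le hh.le hh.le
    (by simpa using hd0) (hd j)
  rw [riemForm, riemForm]
  set SX := ∑ l : Fin r, inner ℝ h (euclCol X l) *
      (gradForm lam W j (euclCol X l) (euclCol X j) + gradForm lam W l (euclCol X j) (euclCol X l))
  set SY := ∑ l : Fin r, inner ℝ h (euclCol Y l) *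
      (gradForm lam W j (euclCol Y l) (euclCol Y j) + gradForm lam W l (euclCol Y j) (euclCol Y l))
  have e : gradForm lam W j h (euclCol X j) - 1 / (2 * (N : ℝ)) * SX
      - (gradForm lam W j h (euclCol Y j) - 1 / (2 * (N : ℝ)) * SY)
      = (gradForm lam W j h (euclCol X j) - gradForm lam W j h (euclCol Y j))
        - 1 / (2 * (N : ℝ)) * (SX - SY) := by ring
  rw [e]
  refine (abs_sub _ _).trans ?_
  rw [abs_mul, abs_of_pos (show (0 : ℝ) < 1 / (2 * N) by positivity)]
  calc _ ≤ Λ * p ^ 2 * τ * d + 1 / (2 * (N : ℝ)) * (r * (4 * (Λ * p ^ 2 * τ * N * d))) := by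
        gcongr
    _ = _ := by
        field_simp
        ring

/-! ### The noise flow -/

section Flow

attribute [local instance] Matrix.normedAddCommGroup Matrix.normedSpace

/-- A bounded Lipschitz vector field has global forward trajectories. -/
theorem exists_forward_solution_of_lipschitz_of_bounded {E : Type*} [NormedAddCommGroup E]
    [NormedSpace ℝ E] [CompleteSpace E] {G : E → E} {K C : NNReal} (hG : LipschitzWith K G)
    (hC : ∀ x, ‖G x‖ ≤ C) (x₀ : E) :
    ∃ x : ℝ → E, x 0 = x₀ ∧ ∀ t, 0 ≤ t → HasDerivWithinAt x (G (x t)) (Set.Ici 0) t := by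
  have hloc : ∀ n : ℕ, ∃ α : ℝ → E, α 0 = x₀ ∧
      ∀ t ∈ Set.Icc (0 : ℝ) n, HasDerivWithinAt α (G (α t)) (Set.Icc 0 n) t := by
    intro n
    have hP : IsPicardLindelof (fun _ : ℝ => G) (⟨0, by simp⟩ : Set.Icc (0 : ℝ) n) x₀
        (C * n) 0 C K :=
      IsPicardLindelof.of_time_independent (fun x _ => hC x) hG.lipschitzOnWith (by simp)
    exact hP.exists_eq_forall_mem_Icc_hasDerivWithinAt₀
  choose α hα0 hα using hloc
  have hright : ∀ n : ℕ, ∀ b : ℝ, b ≤ n → ∀ t ∈ Set.Ico (0 : ℝ) b,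
      HasDerivWithinAt (α n) (G (α n t)) (Set.Ici t) t := fun n b hb t ht =>
    (hα n t ⟨ht.1, (ht.2.trans_le hb).le⟩).mono_of_mem_nhdsWithin
      (Icc_mem_nhdsGE_of_mem ⟨ht.1, ht.2.trans_le hb⟩)
  have hcont : ∀ n : ℕ, ∀ b : ℝ, b ≤ n → ContinuousOn (α n) (Set.Icc 0 b) := fun n b hb t ht =>
    ((hα n t ⟨ht.1, ht.2.trans hb⟩).continuousWithinAt).mono (Set.Icc_subset_Icc le_rfl hb)
  have hagree : ∀ m n : ℕ, ∀ t : ℝ, 0 ≤ t → t ≤ m → t ≤ n → α m t = α n t := by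
    intro m n t ht hm hn
    exact ODE_solution_unique (fun _ => hG) (hcont m t hm) (hright m t hm) (hcont n t hn)
      (hright n t hn) ((hα0 m).trans (hα0 n).symm) ⟨ht, le_rfl⟩
  refine ⟨fun t => α (⌊t⌋₊ + 1) t, hα0 _, fun t ht => ?_⟩
  set n := ⌊t⌋₊ + 1 with hn
  have htn : t < n := by
    rw [hn]
    push_cast
    exact Nat.lt_floor_add_one t
  have h1 : HasDerivWithinAt (α n) (G (α n t)) (Set.Ici 0) t :=
    (hα n t ⟨ht, htn.le⟩).mono_of_mem_nhdsWithin (by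
      have h := inter_mem_nhdsWithin (Set.Ici (0 : ℝ)) (Iio_mem_nhds htn)
      exact Filter.mem_of_superset h fun s hs => ⟨hs.1, hs.2.le⟩)
  refine h1.congr_of_eventuallyEq ?_ rfl
  have h := inter_mem_nhdsWithin (Set.Ici (0 : ℝ)) (Iio_mem_nhds htn)
  filter_upwards [h] with s hs
  refine hagree _ _ s hs.1 ?_ hs.2.le
  push_cast
  exact (Nat.lt_floor_add_one s).le

theorem hasDerivWithinAt_matrix_iff {m n : ℕ} {x : ℝ → Matrix (Fin m) (Fin n) ℝ}
    {x' : Matrix (Fin m) (Fin n) ℝ} {s : Set ℝ} {t : ℝ} :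
    HasDerivWithinAt x x' s t ↔ ∀ a j, HasDerivWithinAt (fun s => x s a j) (x' a j) s t :=
  hasDerivWithinAt_pi.trans (forall_congr' fun _ => hasDerivWithinAt_pi)

theorem abs_apply_le_of_mem_stiefel {N r : ℕ} {X : Matrix (Fin N) (Fin r) ℝ}
    (hX : X ∈ stiefel N r) (a : Fin N) (j : Fin r) : |X a j| ≤ √(N : ℝ) := by
  rw [← norm_euclCol_of_mem_stiefel hX j]
  exact PiLp.norm_apply_le (euclCol X j) a

theorem isClosed_stiefel (N r : ℕ) : IsClosed (stiefel N r) :=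
  isClosed_eq (by fun_prop) continuous_const

theorem isCompact_stiefel (N r : ℕ) : IsCompact (stiefel N r) := by
  have hK : IsCompact (Set.pi Set.univ
      (fun _ : Fin N => Set.pi Set.univ (fun _ : Fin r => Set.Icc (-√(N : ℝ)) √(N : ℝ)))) :=
    isCompact_univ_pi fun _ => isCompact_univ_pi fun _ => isCompact_Icc
  exact hK.of_isClosed_subset (isClosed_stiefel N r) fun X hX a _ j _ =>
    abs_le.mp (abs_apply_le_of_mem_stiefel hX a j)

/-! ### Regularity of the field in the position and in the tensor -/

theorem contDiff_euclCol {N r : ℕ} (j : Fin r) :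
    ContDiff ℝ 1 fun X : Matrix (Fin N) (Fin r) ℝ => euclCol X j := by
  rw [contDiff_euclidean]
  intro a
  exact contDiff_apply_apply ℝ ℝ a j

theorem contDiff_gradForm {p N r : ℕ} (lam : Fin r → ℝ) (W : NoiseTensor p N) (j : Fin r)
    {E : Type*} [NormedAddCommGroup E] [NormedSpace ℝ E] {h x : E → EuclideanSpace ℝ (Fin N)}
    (hh : ContDiff ℝ 1 h) (hx : ContDiff ℝ 1 x) :
    ContDiff ℝ 1 fun y => gradForm lam W j (h y) (x y) := by
  unfold gradForm
  refine contDiff_const.mul (contDiff_const.mul (ContDiff.sum fun k _ => ?_))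
  refine (tensorForm W).contDiff.comp (contDiff_pi.mpr fun i => ?_)
  rcases eq_or_ne i k with rfl | hik
  · simpa using hh
  · simpa [hik] using hx

theorem continuous_gradForm {p N r : ℕ} (lam : Fin r → ℝ) (j : Fin r) {Y : Type*}
    [TopologicalSpace Y] {W : Y → NoiseTensor p N} {h x : Y → EuclideanSpace ℝ (Fin N)}
    (hW : Continuous W) (hh : Continuous h) (hx : Continuous x) :
    Continuous fun y => gradForm lam (W y) j (h y) (x y) := by
  unfold gradForm
  simp only [tensorForm_apply]
  refine continuous_const.mul (continuous_const.mul (continuous_finsetSum _ fun k _ =>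
    continuous_finsetSum _ fun a _ => ((continuous_apply a).comp hW).mul
      (continuous_finsetProd _ fun i _ => ?_)))
  rcases eq_or_ne i k with rfl | hik
  · simp only [Function.update_self]
    fun_prop
  · simp only [Function.update_of_ne hik]
    fun_prop

theorem contDiff_riemForm {p N r : ℕ} (lam : Fin r → ℝ) (W : NoiseTensor p N) (j : Fin r)
    (h : EuclideanSpace ℝ (Fin N)) : ContDiff ℝ 1 (riemForm lam W j h) := by
  unfold riemForm
  refine (contDiff_gradForm lam W j contDiff_const (contDiff_euclCol j)).sub
    (contDiff_const.mul (ContDiff.sum fun l _ =>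
      (contDiff_const.inner ℝ (contDiff_euclCol l)).mul
        ((contDiff_gradForm lam W j (contDiff_euclCol l) (contDiff_euclCol j)).add
          (contDiff_gradForm lam W l (contDiff_euclCol j) (contDiff_euclCol l)))))

theorem continuous_riemForm {p N r : ℕ} (lam : Fin r → ℝ) (j : Fin r)
    (h : EuclideanSpace ℝ (Fin N)) :
    Continuous fun q : NoiseTensor p N × Matrix (Fin N) (Fin r) ℝ => riemForm lam q.1 j h q.2 := by
  have hc : ∀ l, Continuous fun q : NoiseTensor p N × Matrix (Fin N) (Fin r) ℝ => euclCol q.2 l :=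
    fun l => (contDiff_euclCol l).continuous.comp continuous_snd
  unfold riemForm
  exact (continuous_gradForm lam j continuous_fst continuous_const (hc j)).sub
    (continuous_const.mul (continuous_finsetSum _ fun l _ =>
      (continuous_const.inner (hc l)).mul
        ((continuous_gradForm lam j continuous_fst (hc l) (hc j)).add
          (continuous_gradForm lam l continuous_fst (hc j) (hc l)))))

theorem noiseField_apply {p N r : ℕ} (M : ℕ) (lam : Fin r → ℝ) (W : NoiseTensor p N)
    (X : Matrix (Fin N) (Fin r) ℝ) (a : Fin N) (j : Fin r) :
    noiseField M lam W X a j = -((1 / √M) * riemForm lam W j (EuclideanSpace.single a 1) X) := by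
  rw [← riemGrad_noiseHamiltonian_apply]
  rfl

theorem contDiff_noiseField {p N r : ℕ} (M : ℕ) (lam : Fin r → ℝ) (W : NoiseTensor p N) :
    ContDiff ℝ 1 (noiseField (r := r) M lam W) := by
  refine contDiff_pi.mpr fun a => contDiff_pi.mpr fun j => ?_
  simp only [noiseField_apply]
  exact (contDiff_const.mul (contDiff_riemForm lam W j _)).neg

theorem continuous_noiseField {p N r : ℕ} (M : ℕ) (lam : Fin r → ℝ) :
    Continuous fun q : NoiseTensor p N × Matrix (Fin N) (Fin r) ℝ =>
      noiseField M lam q.1 q.2 := by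
  refine continuous_pi fun a => continuous_pi fun j => ?_
  simp only [noiseField_apply]
  exact (continuous_const.mul (continuous_riemForm lam j _)).neg

theorem norm_matrix_mul_le {r : ℕ} (A B : Matrix (Fin r) (Fin r) ℝ) :
    ‖A * B‖ ≤ r * (‖A‖ * ‖B‖) := by
  rw [Matrix.norm_le_iff (by positivity)]
  intro i j
  rw [Matrix.mul_apply]
  refine (norm_sum_le _ _).trans ((Finset.sum_le_sum (g := fun _ => ‖A‖ * ‖B‖) fun l _ => ?_).trans
    (by simp))
  rw [norm_mul]
  gcongr
  · exact Matrix.norm_entry_le_entrywise_sup_norm A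
  · exact Matrix.norm_entry_le_entrywise_sup_norm B

/-- The symmetric matrix `Xᵀ ∇̂H₀ + ∇̂H₀ᵀ X` removed from the Euclidean gradient by the
projection. -/
noncomputable def symGrad {p N r : ℕ} (lam : Fin r → ℝ) (W : NoiseTensor p N)
    (X : Matrix (Fin N) (Fin r) ℝ) : Matrix (Fin r) (Fin r) ℝ :=
  X.transpose * euclGrad (noiseHamiltonian lam W) X
    + (euclGrad (noiseHamiltonian lam W) X).transpose * X

theorem continuous_symGrad {p N r : ℕ} (lam : Fin r → ℝ) (W : NoiseTensor p N) :
    Continuous (symGrad (r := r) lam W) := by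
  have hA : Continuous (euclGrad (r := r) (noiseHamiltonian lam W)) := by
    refine continuous_pi fun a => continuous_pi fun j => ?_
    simp only [euclGrad_noiseHamiltonian]
    exact continuous_gradForm lam j continuous_const continuous_const
      (contDiff_euclCol j).continuous
  unfold symGrad
  fun_prop

/-- Along the field, the defect `D = XᵀX - N` evolves linearly: its derivative is a multiple of
`D S + S D`. -/
theorem defect_derivative {p N r : ℕ} (hN : N ≠ 0) (M : ℕ) (lam : Fin r → ℝ)
    (W : NoiseTensor p N) (X : Matrix (Fin N) (Fin r) ℝ) :
    (noiseField M lam W X).transpose * X + X.transpose * noiseField M lam W X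
      = (1 / √M * (1 / (2 * (N : ℝ)))) •
        ((X.transpose * X - (N : ℝ) • (1 : Matrix (Fin r) (Fin r) ℝ)) * symGrad lam W X
          + symGrad lam W X * (X.transpose * X - (N : ℝ) • (1 : Matrix (Fin r) (Fin r) ℝ))) := by
  have hS : (symGrad lam W X).transpose = symGrad lam W X := by
    simp [symGrad, Matrix.transpose_mul, add_comm]
  have hF : noiseField M lam W X = -((1 / √M) • (euclGrad (noiseHamiltonian lam W) X
      - (1 / (2 * (N : ℝ))) • (X * symGrad lam W X))) := rfl
  have hN0 : (N : ℝ) ≠ 0 := Nat.cast_ne_zero.mpr hN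
  have hS2 : X.transpose * euclGrad (noiseHamiltonian lam W) X
      = symGrad lam W X - (euclGrad (noiseHamiltonian lam W) X).transpose * X := by
    simp [symGrad]
  rw [hF]
  simp only [Matrix.transpose_neg, Matrix.transpose_smul, Matrix.transpose_sub,
    Matrix.transpose_mul, hS, Matrix.neg_mul, Matrix.mul_neg, Matrix.smul_mul, Matrix.mul_smul,
    Matrix.sub_mul, Matrix.mul_sub, Matrix.one_mul, Matrix.mul_one, hS2, Matrix.mul_assoc]
  rw [← Matrix.mul_assoc X.transpose X]
  match_scalars <;> field_simp <;> ring

/-- The field agrees on the manifold with a globally Lipschitz field `G`. The trajectories of `G`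
stay on the manifold because the defect `XᵀX - N` solves a linear equation, so they are
trajectories of the noise flow. -/
theorem exists_isNoiseTrajectory_and_extension {p N r : ℕ} (hN : N ≠ 0) (M : ℕ) (lam : Fin r → ℝ)
    (W : NoiseTensor p N) :
    ∃ (G : Matrix (Fin N) (Fin r) ℝ → Matrix (Fin N) (Fin r) ℝ) (K : NNReal),
      LipschitzWith K G ∧ (∀ X ∈ stiefel N r, G X = noiseField M lam W X) ∧
      ∀ X ∈ stiefel N r, ∃ x, IsNoiseTrajectory M lam W X x := by
  -- Cut the field off outside a ball that contains the manifold.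
  let χ : ContDiffBump (0 : Matrix (Fin N) (Fin r) ℝ) :=
    ⟨√(N : ℝ) + 1, √(N : ℝ) + 2, by positivity, by linarith⟩
  have hχ1 : ∀ X ∈ stiefel N r, χ X = 1 := by
    intro X hX
    refine χ.one_of_mem_closedBall ?_
    rw [mem_closedBall_zero_iff, Matrix.norm_le_iff χ.rIn_pos.le]
    intro a j
    have h1 := abs_apply_le_of_mem_stiefel hX a j
    change |X a j| ≤ √(N : ℝ) + 1
    linarith
  let G : Matrix (Fin N) (Fin r) ℝ → Matrix (Fin N) (Fin r) ℝ := fun X =>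
    χ X • noiseField M lam W X
  have hGc : ContDiff ℝ 1 G := χ.contDiff.smul (contDiff_noiseField M lam W)
  have hGs : HasCompactSupport G := χ.hasCompactSupport.smul_right
  obtain ⟨K, hK⟩ := hGc.lipschitzWith_of_hasCompactSupport hGs one_ne_zero
  have hG1 : ∀ X ∈ stiefel N r, G X = noiseField M lam W X := fun X hX => by
    simp only [G, hχ1 X hX, one_smul]
  refine ⟨G, K, hK, hG1, fun X hX => ?_⟩
  obtain ⟨C, hC⟩ := hGs.exists_bound_of_continuous hGc.continuous
  have hC' : ∀ Y, ‖G Y‖ ≤ (C.toNNReal : ℝ) := fun Y => (hC Y).trans (Real.le_coe_toNNReal C)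
  obtain ⟨x, hx0, hx⟩ := exists_forward_solution_of_lipschitz_of_bounded hK hC' X
  -- The defect vanishes at time zero, hence at all times.
  have hmem : ∀ t, 0 ≤ t → x t ∈ stiefel N r := by
    intro T hT
    let S : Matrix (Fin N) (Fin r) ℝ → Matrix (Fin r) (Fin r) ℝ := fun Y =>
      (χ Y * (1 / √M * (1 / (2 * (N : ℝ))))) • symGrad lam W Y
    have hSc : Continuous S :=
      (χ.continuous.mul continuous_const).smul (continuous_symGrad lam W)
    have hSs : HasCompactSupport S :=
      (χ.hasCompactSupport.mul_right (f' := fun _ => 1 / √M * (1 / (2 * (N : ℝ))))).smul_right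
    obtain ⟨B, hB⟩ := hSs.exists_bound_of_continuous hSc
    let D : ℝ → Matrix (Fin r) (Fin r) ℝ := fun t =>
      (x t).transpose * x t - (N : ℝ) • (1 : Matrix (Fin r) (Fin r) ℝ)
    have hD : ∀ t, 0 ≤ t → HasDerivWithinAt D (D t * S (x t) + S (x t) * D t) (Set.Ici 0) t := by
      intro t ht
      have e : D t * S (x t) + S (x t) * D t
          = (G (x t)).transpose * x t + (x t).transpose * G (x t) := by
        simp only [D, S, G]
        rw [Matrix.transpose_smul, Matrix.smul_mul, Matrix.mul_smul, Matrix.mul_smul,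
          Matrix.smul_mul, ← smul_add, ← smul_add, defect_derivative hN, smul_smul]
      rw [e, hasDerivWithinAt_matrix_iff]
      intro i j
      have hent := hasDerivWithinAt_matrix_iff.mp (hx t ht)
      have h1 : HasDerivWithinAt (fun s => ∑ a, x s a i * x s a j)
          (∑ a, (G (x t) a i * x t a j + x t a i * G (x t) a j)) (Set.Ici 0) t :=
        HasDerivWithinAt.fun_sum fun a _ => (hent a i).mul (hent a j)
      rw [Finset.sum_add_distrib] at h1
      exact h1.sub_const _
    have hzero := eq_zero_of_abs_deriv_le_mul_abs_self_of_eq_zero_right (f := D)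
      (K := 2 * (r * B)) (a := 0) (b := T)
      (fun t ht => ((hD t ht.1).continuousWithinAt).mono fun s hs => hs.1)
      (fun t ht => (hD t ht.1).mono fun s hs => ht.1.trans hs)
      (by
        simp only [D, hx0]
        exact sub_eq_zero.mpr hX)
      (fun t ht => by
        refine (norm_add_le _ _).trans ?_
        have h1 := norm_matrix_mul_le (D t) (S (x t))
        have h2 := norm_matrix_mul_le (S (x t)) (D t)
        have h3 : ‖D t‖ * ‖S (x t)‖ ≤ ‖D t‖ * B := by gcongr; exact hB _
        have h4 : (r : ℝ) * (‖D t‖ * ‖S (x t)‖) ≤ r * (‖D t‖ * B) := by gcongr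
        rw [mul_comm ‖S (x t)‖] at h2
        linarith)
      T ⟨hT, le_rfl⟩
    exact sub_eq_zero.mp hzero
  refine ⟨x, hx0, hmem, fun t ht => ?_⟩
  have h := hx t ht
  rw [hG1 _ (hmem t ht)] at h
  exact hasDerivWithinAt_matrix_iff.mp h

theorem IsNoiseTrajectory.hasDerivWithinAt {p N r : ℕ} {M : ℕ} {lam : Fin r → ℝ}
    {W : NoiseTensor p N} {X : Matrix (Fin N) (Fin r) ℝ} {x : ℝ → Matrix (Fin N) (Fin r) ℝ}
    (hx : IsNoiseTrajectory M lam W X x) {t : ℝ} (ht : 0 ≤ t) :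
    HasDerivWithinAt x (noiseField M lam W (x t)) (Set.Ici t) t :=
  hasDerivWithinAt_matrix_iff.mpr fun a j => (hx.deriv t ht a j).mono fun _ hs => ht.trans hs

theorem IsNoiseTrajectory.continuousOn {p N r : ℕ} {M : ℕ} {lam : Fin r → ℝ}
    {W : NoiseTensor p N} {X : Matrix (Fin N) (Fin r) ℝ} {x : ℝ → Matrix (Fin N) (Fin r) ℝ}
    (hx : IsNoiseTrajectory M lam W X x) (T : ℝ) : ContinuousOn x (Set.Icc 0 T) := fun t ht =>
  ((hasDerivWithinAt_matrix_iff.mpr (hx.deriv t ht.1)).continuousWithinAt).mono fun _ hs => hs.1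

theorem IsNoiseTrajectory.eq {p N r : ℕ} (hN : N ≠ 0) {M : ℕ} {lam : Fin r → ℝ}
    {W : NoiseTensor p N} {X : Matrix (Fin N) (Fin r) ℝ} {x y : ℝ → Matrix (Fin N) (Fin r) ℝ}
    (hx : IsNoiseTrajectory M lam W X x) (hy : IsNoiseTrajectory M lam W X y) {t : ℝ}
    (ht : 0 ≤ t) : x t = y t := by
  obtain ⟨G, K, hK, hG, -⟩ := exists_isNoiseTrajectory_and_extension hN M lam W
  refine ODE_solution_unique (v := fun _ => G) (fun _ => hK) (hx.continuousOn t) (fun s hs => ?_)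
    (hy.continuousOn t) (fun s hs => ?_) (hx.init.trans hy.init.symm) ⟨ht, le_rfl⟩
  · rw [hG _ (hx.mem s hs.1)]
    exact hx.hasDerivWithinAt hs.1
  · rw [hG _ (hy.mem s hs.1)]
    exact hy.hasDerivWithinAt hs.1

theorem isNoiseTrajectory_noiseFlow {p N r : ℕ} (hN : N ≠ 0) (M : ℕ) (lam : Fin r → ℝ)
    (W : NoiseTensor p N) {X : Matrix (Fin N) (Fin r) ℝ} (hX : X ∈ stiefel N r) :
    IsNoiseTrajectory M lam W X fun t => noiseFlow M lam W t X := by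
  obtain ⟨G, K, -, -, h⟩ := exists_isNoiseTrajectory_and_extension hN M lam W
  simp only [noiseFlow, dif_pos (h X hX)]
  exact (h X hX).choose_spec

/-- Continuous dependence on a parameter is uniform over a compact set. -/
theorem eventually_forall_mem_dist_lt {A B E : Type*} [TopologicalSpace A] [TopologicalSpace B]
    [PseudoMetricSpace E] {f : A × B → E} (hf : Continuous f) {K : Set B} (hK : IsCompact K)
    (a₀ : A) {δ : ℝ} (hδ : 0 < δ) :
    ∀ᶠ a in nhds a₀, ∀ b ∈ K, dist (f (a, b)) (f (a₀, b)) < δ := by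
  refine hK.eventually_forall_of_forall_eventually fun b _ => ?_
  have hc : Continuous fun z : A × B => dist (f (z.1, z.2)) (f (a₀, z.2)) := by fun_prop
  have := hc.tendsto (a₀, b)
  simp only [dist_self] at this
  exact this.eventually_lt_const hδ

/-- The noise flow is jointly continuous in the tensor and the starting point. -/
theorem continuousOn_noiseFlow {p N r : ℕ} (hN : N ≠ 0) (M : ℕ) (lam : Fin r → ℝ) {t : ℝ}
    (ht : 0 ≤ t) :
    ContinuousOn (fun q : NoiseTensor p N × Matrix (Fin N) (Fin r) ℝ => noiseFlow M lam q.1 t q.2)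
      (Set.univ ×ˢ stiefel N r) := by
  rintro ⟨W₀, X₀⟩ ⟨-, hX₀⟩
  have hX₀ : X₀ ∈ stiefel N r := hX₀
  obtain ⟨G, K, hK, hG, -⟩ := exists_isNoiseTrajectory_and_extension hN M lam W₀
  -- Near `W₀` the trajectories for `W` are approximate trajectories of `G`; Grönwall compares them.
  -- The Lipschitz constant is raised by one only to have it nonzero in `gronwallBound`.
  have hK1 : LipschitzWith (K + 1) G := hK.weaken (by simp)
  have hK0 : ((K + 1 : NNReal) : ℝ) ≠ 0 := by positivity
  refine Metric.continuousWithinAt_iff'.mpr ?_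
  intro ε hε
  have hlim : Filter.Tendsto (fun δ : ℝ => gronwallBound δ (K + 1 : NNReal) δ t)
      (nhdsWithin 0 (Set.Ioi 0)) (nhds 0) := by
    have hc : Continuous fun δ : ℝ => gronwallBound δ (K + 1 : NNReal) δ t := by
      simp only [gronwallBound_of_K_ne_0 hK0]
      fun_prop
    have := hc.tendsto 0
    rw [gronwallBound_ε0_δ0] at this
    exact this.mono_left nhdsWithin_le_nhds
  obtain ⟨δ, hδε, hδ⟩ := ((hlim.eventually_lt_const hε).and self_mem_nhdsWithin).exists
  have hδ : 0 < δ := hδ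
  have hfield : ∀ᶠ W in nhds W₀, ∀ Y ∈ stiefel N r,
      dist (noiseField M lam W Y) (noiseField M lam W₀ Y) < δ :=
    eventually_forall_mem_dist_lt (continuous_noiseField M lam) (isCompact_stiefel N r) W₀ hδ
  have hdist : ∀ᶠ X in nhds X₀, dist X X₀ < δ := Metric.ball_mem_nhds X₀ hδ
  have hboth : ∀ᶠ q : NoiseTensor p N × Matrix (Fin N) (Fin r) ℝ in
      nhdsWithin (W₀, X₀) (Set.univ ×ˢ stiefel N r),
      (∀ Y ∈ stiefel N r, dist (noiseField M lam q.1 Y) (noiseField M lam W₀ Y) < δ)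
        ∧ dist q.2 X₀ < δ :=
    ((hfield.prod_inl_nhds X₀).and (hdist.prod_inr_nhds W₀)).filter_mono nhdsWithin_le_nhds
  filter_upwards [hboth, self_mem_nhdsWithin] with q hq hqs
  have hx := isNoiseTrajectory_noiseFlow hN M lam q.1 hqs.2
  have hy := isNoiseTrajectory_noiseFlow hN M lam W₀ hX₀
  have hgr := dist_le_of_approx_trajectories_ODE (v := fun _ => G) (εf := δ) (εg := 0) (δ := δ)
    (fun _ => hK1) (hx.continuousOn t) (fun s hs => hx.hasDerivWithinAt hs.1)
    (fun s hs => by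
      rw [hG _ (hx.mem s hs.1)]
      exact (hq.1 _ (hx.mem s hs.1)).le)
    (hy.continuousOn t) (fun s hs => hy.hasDerivWithinAt hs.1)
    (fun s hs => by rw [hG _ (hy.mem s hs.1), dist_self])
    (by rw [hx.init, hy.init]; exact hq.2.le) t ⟨ht, le_rfl⟩
  rw [add_zero, sub_zero] at hgr
  exact hgr.trans_lt hδε

end Flow

/-! ### Equivariance under simultaneous rotation of the tensor and the point -/

/-- The matrix of `O^{⊗p}` acting on tensors. -/
noncomputable def tensorMatrix (p : ℕ) {N : ℕ} (O : Matrix (Fin N) (Fin N) ℝ) :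
    Matrix (Fin p → Fin N) (Fin p → Fin N) ℝ :=
  Matrix.of fun a b => ∏ k, O (a k) (b k)

/-- The action of a matrix on Euclidean space. -/
noncomputable def rotVec {N : ℕ} (O : Matrix (Fin N) (Fin N) ℝ) (u : EuclideanSpace ℝ (Fin N)) :
    EuclideanSpace ℝ (Fin N) :=
  WithLp.toLp 2 (O.mulVec u.ofLp)

theorem tensorMatrix_mem_orthogonalGroup (p : ℕ) {N : ℕ} {O : Matrix (Fin N) (Fin N) ℝ}
    (hO : O ∈ Matrix.orthogonalGroup (Fin N) ℝ) :
    tensorMatrix p O ∈ Matrix.orthogonalGroup (Fin p → Fin N) ℝ := by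
  rw [Matrix.mem_orthogonalGroup_iff] at hO ⊢
  ext a c
  have h : ∀ k, ∑ i, O (a k) i * O (c k) i = if a k = c k then 1 else 0 := fun k => by
    have := congrFun (congrFun hO (a k)) (c k)
    rwa [Matrix.mul_apply, Matrix.one_apply] at this
  simp only [Matrix.mul_apply, Matrix.transpose_apply, tensorMatrix, Matrix.of_apply,
    ← Finset.prod_mul_distrib]
  rw [← Fintype.piFinset_univ, ← Finset.prod_univ_sum (fun _ => Finset.univ)
    (fun k i => O (a k) i * O (c k) i), Finset.prod_congr rfl fun k _ => h k, Matrix.one_apply,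
    Finset.prod_ite_zero]
  simp [funext_iff]

theorem tensorMatrix_mulVec_prod {p N : ℕ} (O : Matrix (Fin N) (Fin N) ℝ)
    (u : Fin p → EuclideanSpace ℝ (Fin N)) :
    (tensorMatrix p O).mulVec (fun a => ∏ k, u k (a k)) = fun a => ∏ k, rotVec O (u k) (a k) := by
  funext a
  simp only [Matrix.mulVec, dotProduct, tensorMatrix, Matrix.of_apply, ← Finset.prod_mul_distrib,
    rotVec]
  rw [Finset.prod_univ_sum, Fintype.piFinset_univ]

theorem tensorForm_rotVec {p N : ℕ} {O : Matrix (Fin N) (Fin N) ℝ}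
    (hO : O ∈ Matrix.orthogonalGroup (Fin N) ℝ) (W : NoiseTensor p N)
    (u : Fin p → EuclideanSpace ℝ (Fin N)) :
    tensorForm ((tensorMatrix p O).mulVec W) (fun k => rotVec O (u k)) = tensorForm W u := by
  rw [tensorForm_apply, tensorForm_apply]
  change (tensorMatrix p O).mulVec W ⬝ᵥ (fun a => ∏ k, rotVec O (u k) (a k))
    = W ⬝ᵥ fun a => ∏ k, u k (a k)
  rw [← tensorMatrix_mulVec_prod,
    dotProduct_mulVec_mulVec_of_orthogonal (tensorMatrix_mem_orthogonalGroup p hO)]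

theorem inner_rotVec {N : ℕ} {O : Matrix (Fin N) (Fin N) ℝ}
    (hO : O ∈ Matrix.orthogonalGroup (Fin N) ℝ) (x y : EuclideanSpace ℝ (Fin N)) :
    inner ℝ (rotVec O x) (rotVec O y) = inner ℝ x y := by
  have h := dotProduct_mulVec_mulVec_of_orthogonal hO y.ofLp x.ofLp
  simpa [PiLp.inner_apply, dotProduct, rotVec] using h

theorem euclCol_mul {N r : ℕ} (O : Matrix (Fin N) (Fin N) ℝ) (X : Matrix (Fin N) (Fin r) ℝ)
    (j : Fin r) : euclCol (O * X) j = rotVec O (euclCol X j) := rfl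

theorem gradForm_rotVec {p N r : ℕ} {O : Matrix (Fin N) (Fin N) ℝ}
    (hO : O ∈ Matrix.orthogonalGroup (Fin N) ℝ) (lam : Fin r → ℝ) (W : NoiseTensor p N)
    (j : Fin r) (h x : EuclideanSpace ℝ (Fin N)) :
    gradForm lam ((tensorMatrix p O).mulVec W) j (rotVec O h) (rotVec O x)
      = gradForm lam W j h x := by
  have e : ∀ k : Fin p, Function.update (fun _ => rotVec O x) k (rotVec O h)
      = fun i => rotVec O (Function.update (fun _ => x) k h i) := by
    intro k
    funext i
    rcases eq_or_ne i k with rfl | hik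
    · simp
    · simp [hik]
  simp only [gradForm, e, tensorForm_rotVec hO]

theorem riemForm_rotVec {p N r : ℕ} {O : Matrix (Fin N) (Fin N) ℝ}
    (hO : O ∈ Matrix.orthogonalGroup (Fin N) ℝ) (lam : Fin r → ℝ) (W : NoiseTensor p N)
    (j : Fin r) (h : EuclideanSpace ℝ (Fin N)) (X : Matrix (Fin N) (Fin r) ℝ) :
    riemForm lam ((tensorMatrix p O).mulVec W) j (rotVec O h) (O * X) = riemForm lam W j h X := by
  simp only [riemForm, euclCol_mul, gradForm_rotVec hO, inner_rotVec hO]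

theorem riemForm_mul {p N r : ℕ} {O : Matrix (Fin N) (Fin N) ℝ}
    (hO : O ∈ Matrix.orthogonalGroup (Fin N) ℝ) (lam : Fin r → ℝ) (W : NoiseTensor p N)
    (j : Fin r) (v : EuclideanSpace ℝ (Fin N)) (X : Matrix (Fin N) (Fin r) ℝ) :
    riemForm lam ((tensorMatrix p O).mulVec W) j v (O * X)
      = v.ofLp ⬝ᵥ O.mulVec fun a => riemGrad (noiseHamiltonian lam W) X a j := by
  have e : v = rotVec O (rotVec O.transpose v) := by
    simp [rotVec, (Matrix.mem_orthogonalGroup_iff (Fin N) ℝ).mp hO]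
  conv_lhs => rw [e]
  rw [riemForm_rotVec hO, ← sum_mul_riemGrad, Matrix.dotProduct_mulVec, ← Matrix.mulVec_transpose]
  rfl

theorem noiseField_mul {p N r : ℕ} {O : Matrix (Fin N) (Fin N) ℝ}
    (hO : O ∈ Matrix.orthogonalGroup (Fin N) ℝ) (M : ℕ) (lam : Fin r → ℝ) (W : NoiseTensor p N)
    (X : Matrix (Fin N) (Fin r) ℝ) :
    noiseField M lam ((tensorMatrix p O).mulVec W) (O * X) = O * noiseField M lam W X := by
  ext a j
  rw [noiseField_apply, riemForm_mul hO, noiseField, Matrix.mul_neg, Matrix.mul_smul,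
    Matrix.neg_apply, Matrix.smul_apply, smul_eq_mul]
  congr 2
  simp [Matrix.mul_apply, Matrix.mulVec, dotProduct]

theorem IsNoiseTrajectory.rotate {p N r : ℕ} {O : Matrix (Fin N) (Fin N) ℝ}
    (hO : O ∈ Matrix.orthogonalGroup (Fin N) ℝ) {M : ℕ} {lam : Fin r → ℝ} {W : NoiseTensor p N}
    {X : Matrix (Fin N) (Fin r) ℝ} {x : ℝ → Matrix (Fin N) (Fin r) ℝ}
    (hx : IsNoiseTrajectory M lam W X x) :
    IsNoiseTrajectory M lam ((tensorMatrix p O).mulVec W) (O * X) fun t => O * x t := by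
  refine ⟨by rw [hx.init], fun t ht => ?_, fun t ht a j => ?_⟩
  · have h := hx.mem t ht
    simp only [stiefel, Set.mem_ofPred_eq] at h ⊢
    rw [Matrix.transpose_mul, Matrix.mul_assoc, ← Matrix.mul_assoc _ _ (x t),
      (Matrix.mem_orthogonalGroup_iff' (Fin N) ℝ).mp hO, Matrix.one_mul, h]
  · rw [noiseField_mul hO]
    simp only [Matrix.mul_apply]
    exact HasDerivWithinAt.fun_sum fun b _ => (hx.deriv t ht b j).const_mul _

theorem noiseFlow_mul {p N r : ℕ} (hN : N ≠ 0) {O : Matrix (Fin N) (Fin N) ℝ}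
    (hO : O ∈ Matrix.orthogonalGroup (Fin N) ℝ) (M : ℕ) (lam : Fin r → ℝ) (W : NoiseTensor p N)
    {X : Matrix (Fin N) (Fin r) ℝ} (hX : X ∈ stiefel N r) {t : ℝ} (ht : 0 ≤ t) :
    noiseFlow M lam ((tensorMatrix p O).mulVec W) t (O * X) = O * noiseFlow M lam W t X := by
  have h := (isNoiseTrajectory_noiseFlow hN M lam W hX).rotate hO
  have hOX : O * X ∈ stiefel N r := by
    have := h.mem 0 le_rfl
    rwa [h.init] at this
  exact (isNoiseTrajectory_noiseFlow hN M lam _ hOX).eq hN h ht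

/-- Rotating the tensor by an independent Haar orthogonal matrix does not change the joint law of
the tensor and a uniform point, so the point may be taken to be the image of the reference frame
under the same rotation. -/
theorem noiseLaw_prod_uniformStiefel_apply {p N r : ℕ}
    {S : Set (NoiseTensor p N × Matrix (Fin N) (Fin r) ℝ)} (hS : MeasurableSet S) :
    (noiseLaw p N).prod (uniformStiefel N r) S
      = ∫⁻ W, orthogonalHaar N {O | ((tensorMatrix p (O : Matrix (Fin N) (Fin N) ℝ)).mulVec W,
          (O : Matrix (Fin N) (Fin N) ℝ) * baseFrame N r) ∈ S} ∂(noiseLaw p N) := by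
  have hmt : Continuous fun q : Matrix.orthogonalGroup (Fin N) ℝ × NoiseTensor p N =>
      tensorMatrix p (q.1 : Matrix (Fin N) (Fin N) ℝ) := by
    unfold tensorMatrix
    refine continuous_matrix fun a b => ?_
    simp only [Matrix.of_apply]
    refine continuous_finsetProd _ fun k _ => ?_
    exact (continuous_subtype_val.comp continuous_fst).matrix_elem _ _
  have hc : Continuous fun q : Matrix.orthogonalGroup (Fin N) ℝ × NoiseTensor p N =>
      ((tensorMatrix p (q.1 : Matrix (Fin N) (Fin N) ℝ)).mulVec q.2,
        (q.1 : Matrix (Fin N) (Fin N) ℝ) * baseFrame N r) :=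
    (hmt.matrix_mulVec continuous_snd).prodMk
      ((continuous_subtype_val.comp continuous_fst).matrix_mul continuous_const)
  have hD := hc.measurable hS
  rw [Measure.prod_apply_symm hS, uniformStiefel,
    lintegral_map (measurable_measure_prodMk_right hS) (measurable_orbit N r)]
  have h2 := Measure.prod_apply (μ := orthogonalHaar N) (ν := noiseLaw p N) hD
  rw [Measure.prod_apply_symm hD] at h2
  refine Eq.trans (lintegral_congr fun O => ?_) h2.symm
  have hmp := measurePreserving_mulVec_gaussPi (tensorMatrix_mem_orthogonalGroup p O.2)
  exact (hmp.measure_preimage (measurable_prodMk_right hS).nullMeasurableSet).symm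

/-! ### The size of the noise gradient along the flow -/

/-- The radius absorbs the cardinality `5^{pN} ≤ e^{2pN}` of the net. -/
theorem noiseLaw_sqrt_lt_norm_tensorForm_le (p N : ℕ) {y : ℝ} (hy : 0 ≤ y) :
    noiseLaw p N {W | 2 ^ p * √(4 * p * N + 2 * y) < ‖tensorForm W‖}
      ≤ ENNReal.ofReal (2 * Real.exp (-y)) := by
  refine (noiseLaw_norm_tensorForm_gt_le p N (Real.sqrt_nonneg _)).trans
    (ENNReal.ofReal_le_ofReal ?_)
  rw [Real.sq_sqrt (by positivity)]
  have h5 : (5 : ℝ) ≤ Real.exp 2 := by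
    have h := Real.exp_one_gt_d9
    have e : Real.exp 2 = Real.exp 1 * Real.exp 1 := by rw [← Real.exp_add]; norm_num
    rw [e]
    nlinarith
  have h5' : (5 : ℝ) ^ (p * N) ≤ Real.exp (2 * (p * N)) := by
    calc (5 : ℝ) ^ (p * N) ≤ Real.exp 2 ^ (p * N) := by gcongr
      _ = _ := by rw [← Real.exp_nat_mul]; push_cast; ring_nf
  calc 2 * 5 ^ (p * N) * Real.exp (-(4 * p * N + 2 * y) / 2)
      ≤ 2 * Real.exp (2 * (p * N)) * Real.exp (-(4 * p * N + 2 * y) / 2) := by gcongr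
    _ = _ := by
      rw [mul_assoc, ← Real.exp_add]
      ring_nf

/-- Duality: the form `h ↦ ⟨h, R⟩` of the column `R` is bounded by `abs_riemForm_le`. -/
theorem norm_euclCol_riemGrad_le {p N r : ℕ} (hN : N ≠ 0) (hp : 1 ≤ p) {lam : Fin r → ℝ} {Λ : ℝ}
    (h0 : ∀ j, 0 ≤ lam j) (hΛ : ∀ j, lam j ≤ Λ) (W : NoiseTensor p N) (j : Fin r)
    {X : Matrix (Fin N) (Fin r) ℝ} (hX : X ∈ stiefel N r) :
    ‖euclCol (riemGrad (noiseHamiltonian lam W) X) j‖ ≤ (1 + r) * Λ * p * ‖tensorForm W‖ := by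
  have hΛ0 : 0 ≤ Λ := (h0 j).trans (hΛ j)
  set R := euclCol (riemGrad (noiseHamiltonian lam W) X) j with hR
  have h1 := (le_abs_self _).trans (abs_riemForm_le hN hp h0 hΛ W j R hX)
  rw [← sum_mul_riemGrad] at h1
  have h2 : ‖R‖ * ‖R‖ = ∑ a, R a * riemGrad (noiseHamiltonian lam W) X a j := by
    rw [← pow_two, EuclideanSpace.norm_sq_eq]
    refine Finset.sum_congr rfl fun a _ => ?_
    rw [Real.norm_eq_abs, sq_abs, pow_two]
    rfl
  rw [← h2] at h1
  rcases (norm_nonneg R).eq_or_lt with h | h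
  · rw [← h]; positivity
  · exact le_of_mul_le_mul_right h1 h

theorem one_div_sqrt_natCast_le_one {M : ℕ} (hM : 1 ≤ M) : 1 / √(M : ℝ) ≤ 1 := by
  rw [div_le_one (by positivity), Real.one_le_sqrt]
  exact_mod_cast hM

theorem norm_euclCol_noiseField_le {p N r : ℕ} (hN : N ≠ 0) (hp : 1 ≤ p) {M : ℕ} (hM : 1 ≤ M)
    {lam : Fin r → ℝ} {Λ : ℝ} (h0 : ∀ j, 0 ≤ lam j) (hΛ : ∀ j, lam j ≤ Λ) (W : NoiseTensor p N)
    (j : Fin r) {X : Matrix (Fin N) (Fin r) ℝ} (hX : X ∈ stiefel N r) :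
    ‖euclCol (noiseField M lam W X) j‖ ≤ (1 + r) * Λ * p * ‖tensorForm W‖ := by
  have e : euclCol (noiseField M lam W X) j
      = -((1 / √(M : ℝ)) • euclCol (riemGrad (noiseHamiltonian lam W) X) j) := by
    ext a
    simp [noiseField]
  have hM1 := one_div_sqrt_natCast_le_one hM
  rw [e, norm_neg, norm_smul, Real.norm_eq_abs, abs_of_nonneg (by positivity)]
  exact (mul_le_of_le_one_left (norm_nonneg _) hM1).trans
    (norm_euclCol_riemGrad_le hN hp h0 hΛ W j hX)

theorem hasDerivWithinAt_euclCol {N r : ℕ} {x : ℝ → Matrix (Fin N) (Fin r) ℝ}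
    {x' : Matrix (Fin N) (Fin r) ℝ} {s : Set ℝ} {t : ℝ} {l : Fin r}
    (h : ∀ a, HasDerivWithinAt (fun s => x s a l) (x' a l) s t) :
    HasDerivWithinAt (fun s => euclCol (x s) l) (euclCol x' l) s t := by
  have h1 : HasDerivWithinAt (fun s => fun a => x s a l) (fun a => x' a l) s t :=
    hasDerivWithinAt_pi.mpr h
  exact (PiLp.continuousLinearEquiv 2 ℝ fun _ : Fin N => ℝ).symm.hasFDerivAt.comp_hasDerivWithinAt
    t h1

theorem IsNoiseTrajectory.norm_euclCol_sub_le {p N r : ℕ} (hN : N ≠ 0) (hp : 1 ≤ p) {M : ℕ}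
    (hM : 1 ≤ M) {lam : Fin r → ℝ} {Λ : ℝ} (h0 : ∀ j, 0 ≤ lam j) (hΛ : ∀ j, lam j ≤ Λ)
    {W : NoiseTensor p N} {X : Matrix (Fin N) (Fin r) ℝ} {x : ℝ → Matrix (Fin N) (Fin r) ℝ}
    (hx : IsNoiseTrajectory M lam W X x) {s t : ℝ} (hs : 0 ≤ s) (hst : s ≤ t) (l : Fin r) :
    ‖euclCol (x t) l - euclCol (x s) l‖ ≤ (1 + r) * Λ * p * ‖tensorForm W‖ * (t - s) := by
  have hd : ∀ u, 0 ≤ u → HasDerivWithinAt (fun u => euclCol (x u) l)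
      (euclCol (noiseField M lam W (x u)) l) (Set.Ici 0) u := fun u hu =>
    hasDerivWithinAt_euclCol fun a => hx.deriv u hu a l
  exact norm_image_sub_le_of_norm_deriv_right_le_segment (f := fun u => euclCol (x u) l)
    (fun u hu => (hd u (hs.trans hu.1)).continuousWithinAt.mono fun v hv => hs.trans hv.1)
    (fun u hu => (hd u (hs.trans hu.1)).mono fun v hv => (hs.trans hu.1).trans hv)
    (fun u hu => norm_euclCol_noiseField_le hN hp hM h0 hΛ W l (hx.mem u (hs.trans hu.1)))
    t ⟨hst, le_rfl⟩

theorem abs_noiseGen_corr_eq {p N r : ℕ} (M : ℕ) (lam : Fin r → ℝ) (W : NoiseTensor p N)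
    (V : Matrix (Fin N) (Fin r) ℝ) (i j : Fin r) (X : Matrix (Fin N) (Fin r) ℝ) :
    |noiseGen M lam W (corr V i j) X|
      = 1 / √(M : ℝ) * ((N : ℝ)⁻¹ * |riemForm lam W j (euclCol V i) X|) := by
  rw [noiseGen_corr, abs_neg, abs_mul, abs_mul, abs_of_nonneg (by positivity),
    abs_of_nonneg (by positivity : (0 : ℝ) ≤ (N : ℝ)⁻¹)]

theorem abs_noiseGen_corr_le {p N r : ℕ} (hN : N ≠ 0) (hp : 1 ≤ p) {M : ℕ} (hM : 1 ≤ M)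
    {lam : Fin r → ℝ} {Λ : ℝ} (h0 : ∀ j, 0 ≤ lam j) (hΛ : ∀ j, lam j ≤ Λ) (W : NoiseTensor p N)
    {V : Matrix (Fin N) (Fin r) ℝ} (hV : V ∈ stiefel N r) (i j : Fin r)
    {X : Matrix (Fin N) (Fin r) ℝ} (hX : X ∈ stiefel N r) :
    |noiseGen M lam W (corr V i j) X| ≤ (1 + r) * Λ * p * ‖tensorForm W‖ / √(N : ℝ) := by
  have hM1 := one_div_sqrt_natCast_le_one hM
  have h1 := abs_riemForm_le hN hp h0 hΛ W j (euclCol V i) hX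
  rw [norm_euclCol_of_mem_stiefel hV] at h1
  rw [abs_noiseGen_corr_eq]
  calc _ ≤ 1 * ((N : ℝ)⁻¹ * ((1 + r) * Λ * p * ‖tensorForm W‖ * √(N : ℝ))) := by gcongr
    _ = (1 + r) * Λ * p * ‖tensorForm W‖ * ((N : ℝ)⁻¹ * √(N : ℝ)) := by ring
    _ = _ := by rw [inv_mul_sqrt_self]; ring

/-- Along a trajectory, `L₀ m_{ij}` moves by `O(N^{-1/2})` over a time step of length at most
`N^{-1/2}`, as long as the tensor has norm `O(√N)`. -/
theorem IsNoiseTrajectory.abs_noiseGen_corr_sub_le {p N r : ℕ} (hN : N ≠ 0) (hp : 1 ≤ p) {M : ℕ}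
    (hM : 1 ≤ M) {lam : Fin r → ℝ} {Λ : ℝ} (h0 : ∀ j, 0 ≤ lam j) (hΛ : ∀ j, lam j ≤ Λ)
    {W : NoiseTensor p N} {V : Matrix (Fin N) (Fin r) ℝ} (hV : V ∈ stiefel N r) (i j : Fin r)
    {X : Matrix (Fin N) (Fin r) ℝ} {x : ℝ → Matrix (Fin N) (Fin r) ℝ}
    (hx : IsNoiseTrajectory M lam W X x) {s t β : ℝ} (hs : 0 ≤ s) (hst : s ≤ t)
    (hts : t - s ≤ 1 / √(N : ℝ)) (hβ : (1 + r) * Λ * p * ‖tensorForm W‖ ≤ β * √(N : ℝ)) :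
    |noiseGen M lam W (corr V i j) (x t)|
      ≤ |noiseGen M lam W (corr V i j) (x s)| + 2 * p * β ^ 2 / √(N : ℝ) := by
  have hN0 : 0 < √(N : ℝ) := by positivity
  have hΛ0 : 0 ≤ Λ := (h0 j).trans (hΛ j)
  have hβ0 : 0 ≤ β := by
    have : 0 ≤ β * √(N : ℝ) := le_trans (by positivity) hβ
    exact nonneg_of_mul_nonneg_left this hN0
  have hM1 := one_div_sqrt_natCast_le_one hM
  have hd : ∀ l, ‖euclCol (x t) l - euclCol (x s) l‖ ≤ β := fun l => by
    refine (hx.norm_euclCol_sub_le hN hp hM h0 hΛ hs hst l).trans ?_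
    calc _ ≤ β * √(N : ℝ) * (1 / √(N : ℝ)) :=
          mul_le_mul hβ hts (sub_nonneg.mpr hst) (by positivity)
      _ = β := by field_simp
  have h1 := abs_riemForm_sub_le hN hp h0 hΛ W j (norm_euclCol_of_mem_stiefel hV i)
    (hx.mem t (hs.trans hst)) (hx.mem s hs) hd
  have h2 : (1 + 2 * r) * Λ * p ^ 2 * ‖tensorForm W‖ * β ≤ 2 * p * β ^ 2 * √(N : ℝ) := by
    calc (1 + 2 * r) * Λ * p ^ 2 * ‖tensorForm W‖ * β
        ≤ (2 * (1 + r)) * Λ * p ^ 2 * ‖tensorForm W‖ * β := by gcongr; linarith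
      _ = 2 * p * ((1 + r) * Λ * p * ‖tensorForm W‖) * β := by ring
      _ ≤ 2 * p * (β * √(N : ℝ)) * β := by gcongr
      _ = _ := by ring
  have h3 := (abs_sub_abs_le_abs_sub _ _).trans (h1.trans h2)
  rw [abs_noiseGen_corr_eq, abs_noiseGen_corr_eq]
  set A := |riemForm lam W j (euclCol V i) (x t)|
  set B := |riemForm lam W j (euclCol V i) (x s)|
  calc _ ≤ 1 / √(M : ℝ) * ((N : ℝ)⁻¹ * (B + 2 * p * β ^ 2 * √(N : ℝ))) := by
        gcongr
        linarith
    _ = 1 / √(M : ℝ) * ((N : ℝ)⁻¹ * B)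
        + 1 / √(M : ℝ) * (2 * p * β ^ 2 * ((N : ℝ)⁻¹ * √(N : ℝ))) := by ring
    _ ≤ 1 / √(M : ℝ) * ((N : ℝ)⁻¹ * B) + 1 * (2 * p * β ^ 2 * ((N : ℝ)⁻¹ * √(N : ℝ))) := by
        gcongr
    _ = _ := by rw [inv_mul_sqrt_self]; ring

/-! ### The probability bound at a fixed time -/

theorem orthogonalHaar_abs_dotProduct_ge_le_of_norm_le {N : ℕ} {u R : Fin N → ℝ}
    (hu : u ⬝ᵥ u = 1) {β γ : ℝ} (hβ : 0 < β) (hγ : 0 < γ) (hR : √(R ⬝ᵥ R) ≤ β * √(N : ℝ)) :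
    orthogonalHaar N {O | γ ≤ |u ⬝ᵥ (O : Matrix (Fin N) (Fin N) ℝ).mulVec R|}
      ≤ ENNReal.ofReal (3 * Real.exp (-(γ / β) ^ 2 / 8)) := by
  rcases eq_or_ne R 0 with rfl | hR0
  · have : {O : Matrix.orthogonalGroup (Fin N) ℝ |
        γ ≤ |u ⬝ᵥ (O : Matrix (Fin N) (Fin N) ℝ).mulVec 0|} = ∅ := by
      ext O
      simp [hγ]
    rw [this, measure_empty]
    exact bot_le
  · set ρ := √(R ⬝ᵥ R) with hρ
    have hρ0 : 0 < ρ := Real.sqrt_pos.mpr ((dotProduct_self_nonneg_real R).lt_of_ne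
      fun h => hR0 (dotProduct_self_eq_zero.mp h.symm))
    refine (measure_mono fun O hO => ?_).trans
      (orthogonalHaar_abs_dotProduct_ge_le hu (dotProduct_normalize hR0) (s := γ / β)
        (by positivity))
    have hO : γ ≤ |u ⬝ᵥ (O : Matrix (Fin N) (Fin N) ℝ).mulVec R| := hO
    have hN0 : 0 < √(N : ℝ) := by
      by_contra h
      have : √(N : ℝ) = 0 := le_antisymm (not_lt.mp h) (Real.sqrt_nonneg _)
      rw [this, mul_zero] at hR
      linarith
    change γ / β / √(N : ℝ) ≤ |u ⬝ᵥ (O : Matrix (Fin N) (Fin N) ℝ).mulVec (ρ⁻¹ • R)|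
    rw [Matrix.mulVec_smul, dotProduct_smul, smul_eq_mul, abs_mul, abs_of_pos (inv_pos.mpr hρ0),
      div_div, div_eq_inv_mul]
    gcongr

theorem isClosed_setOf_le_abs_noiseGen_corr {p N r : ℕ} (hN : N ≠ 0) (M : ℕ) (lam : Fin r → ℝ)
    (V : Matrix (Fin N) (Fin r) ℝ) (i j : Fin r) {t : ℝ} (ht : 0 ≤ t) (b : ℝ) :
    IsClosed {q : NoiseTensor p N × Matrix (Fin N) (Fin r) ℝ | q.2 ∈ stiefel N r ∧
      b ≤ |noiseGen M lam q.1 (corr V i j) (noiseFlow M lam q.1 t q.2)|} := by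
  have hf : ContinuousOn (fun q : NoiseTensor p N × Matrix (Fin N) (Fin r) ℝ =>
      riemForm lam q.1 j (euclCol V i) (noiseFlow M lam q.1 t q.2)) (Set.univ ×ˢ stiefel N r) := by
    have := (continuous_riemForm (p := p) lam j (euclCol V i)).comp_continuousOn
      (continuousOn_fst.prodMk (continuousOn_noiseFlow (p := p) hN M lam ht))
    exact this
  have hg : ContinuousOn (fun q : NoiseTensor p N × Matrix (Fin N) (Fin r) ℝ =>
      1 / √(M : ℝ) * ((N : ℝ)⁻¹ * |riemForm lam q.1 j (euclCol V i)
        (noiseFlow M lam q.1 t q.2)|)) (Set.univ ×ˢ stiefel N r) :=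
    continuousOn_const.mul (continuousOn_const.mul hf.abs)
  have := hg.preimage_isClosed_of_isClosed (isClosed_univ.prod (isClosed_stiefel N r))
    (isClosed_Ici (a := b))
  convert this using 1
  ext q
  simp [abs_noiseGen_corr_eq]

/-- At a fixed time the correlation velocity has Gaussian tails: conditionally on the tensor in
the rotated frame, it is the inner product of a spike with a Haar rotation of a fixed vector. -/
theorem noiseLaw_prod_uniformStiefel_noiseGen_ge_le {p N r : ℕ} (hN : N ≠ 0) (hrN : r ≤ N)
    (hp : 1 ≤ p) {M : ℕ} (hM : 1 ≤ M) {lam : Fin r → ℝ} {Λ : ℝ} (h0 : ∀ j, 0 ≤ lam j)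
    (hΛ : ∀ j, lam j ≤ Λ) {V : Matrix (Fin N) (Fin r) ℝ} (hV : V ∈ stiefel N r) (i j : Fin r)
    {t β γ : ℝ} (ht : 0 ≤ t) (hβ : 0 < β) (hγ : 0 < γ) :
    (noiseLaw p N).prod (uniformStiefel N r) {q | q.2 ∈ stiefel N r ∧
      γ / √(N : ℝ) ≤ |noiseGen M lam q.1 (corr V i j) (noiseFlow M lam q.1 t q.2)|}
      ≤ noiseLaw p N {W | β * √(N : ℝ) < (1 + r) * Λ * p * ‖tensorForm W‖}
        + ENNReal.ofReal (3 * Real.exp (-(γ / β) ^ 2 / 8)) := by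
  have hN0 : 0 < √(N : ℝ) := by positivity
  have hM1 := one_div_sqrt_natCast_le_one hM
  set E := {W : NoiseTensor p N | β * √(N : ℝ) < (1 + r) * Λ * p * ‖tensorForm W‖} with hE
  set c := ENNReal.ofReal (3 * Real.exp (-(γ / β) ^ 2 / 8))
  rw [noiseLaw_prod_uniformStiefel_apply
    (isClosed_setOf_le_abs_noiseGen_corr hN M lam V i j ht _).measurableSet]
  have hslice : ∀ W : NoiseTensor p N, orthogonalHaar N
      {O | ((tensorMatrix p (O : Matrix (Fin N) (Fin N) ℝ)).mulVec W,
        (O : Matrix (Fin N) (Fin N) ℝ) * baseFrame N r) ∈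
        {q : NoiseTensor p N × Matrix (Fin N) (Fin r) ℝ | q.2 ∈ stiefel N r ∧
          γ / √(N : ℝ) ≤ |noiseGen M lam q.1 (corr V i j) (noiseFlow M lam q.1 t q.2)|}}
      ≤ E.indicator 1 W + c := by
    intro W
    by_cases hW : W ∈ E
    · rw [Set.indicator_of_mem hW]
      exact prob_le_one.trans le_self_add
    · rw [Set.indicator_of_notMem hW, zero_add]
      have hW : (1 + r) * Λ * p * ‖tensorForm W‖ ≤ β * √(N : ℝ) := not_lt.mp hW
      set Y := noiseFlow M lam W t (baseFrame N r) with hY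
      have hYs : Y ∈ stiefel N r :=
        (isNoiseTrajectory_noiseFlow hN M lam W (baseFrame_mem_stiefel hrN)).mem t ht
      set R : Fin N → ℝ := fun a => riemGrad (noiseHamiltonian lam W) Y a j with hR
      have hRn : √(R ⬝ᵥ R) ≤ β * √(N : ℝ) := by
        have h := (norm_euclCol_riemGrad_le hN hp h0 hΛ W j hYs).trans hW
        rw [EuclideanSpace.norm_eq] at h
        simpa [dotProduct, ← pow_two] using h
      have hu : unitSpike V i ⬝ᵥ unitSpike V i = 1 := by
        rw [unitSpike_dotProduct hN hV, if_pos rfl]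
      refine (measure_mono fun O hO => ?_).trans
        (orthogonalHaar_abs_dotProduct_ge_le_of_norm_le hu hβ hγ hRn)
      have hO := hO.2
      simp only at hO
      rw [noiseFlow_mul hN O.2 M lam W (baseFrame_mem_stiefel hrN) ht, abs_noiseGen_corr_eq,
        riemForm_mul O.2] at hO
      have hv : (euclCol V i).ofLp = √(N : ℝ) • unitSpike V i := by
        funext a
        simp [unitSpike, euclCol, hN0.ne']
      rw [hv, smul_dotProduct, smul_eq_mul, abs_mul, abs_of_pos hN0, ← mul_assoc (N : ℝ)⁻¹,
        inv_mul_sqrt_self] at hO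
      change γ ≤ |unitSpike V i ⬝ᵥ (O : Matrix (Fin N) (Fin N) ℝ).mulVec R|
      set D := |unitSpike V i ⬝ᵥ (O : Matrix (Fin N) (Fin N) ℝ).mulVec R|
      have h2 : γ / √(N : ℝ) ≤ D / √(N : ℝ) := by
        refine hO.trans ((mul_le_of_le_one_left (by positivity) hM1).trans_eq ?_)
        ring
      exact (div_le_div_iff_of_pos_right hN0).mp h2
  refine (lintegral_mono hslice).trans ?_
  rw [lintegral_add_right _ measurable_const, lintegral_const, measure_univ, mul_one]
  gcongr
  exact lintegral_indicator_one_le E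

/-! ### Condition 0 at level infinity -/

/-- If `S` has product measure at most `a b`, then its slices have measure at most `a` outside a
set of measure `b`. No measurability of `S` is needed. -/
theorem measure_lt_measure_slice_le {α β : Type*} [MeasurableSpace α] [MeasurableSpace β]
    {μ : Measure α} {ν : Measure β} [SFinite μ] [SFinite ν] {S : Set (α × β)} {a b : ℝ}
    (ha : 0 < a) (h : (μ.prod ν) S ≤ ENNReal.ofReal (a * b)) :
    μ {x | ENNReal.ofReal a < ν {y | (x, y) ∈ S}} ≤ ENNReal.ofReal b := by
  set S' := toMeasurable (μ.prod ν) S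
  have hS' : MeasurableSet S' := measurableSet_toMeasurable _ _
  have hsub : {x | ENNReal.ofReal a < ν {y | (x, y) ∈ S}}
      ⊆ {x | ENNReal.ofReal a ≤ ν (Prod.mk x ⁻¹' S')} := fun x hx =>
    (show ENNReal.ofReal a < ν {y | (x, y) ∈ S} from hx).le.trans
      (measure_mono (show {y | (x, y) ∈ S} ⊆ Prod.mk x ⁻¹' S' from
        fun y hy => subset_toMeasurable (μ.prod ν) S hy))
  have ha' : ENNReal.ofReal a ≠ 0 := by simpa using ha
  refine (measure_mono hsub).trans ((meas_ge_le_lintegral_div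
    (measurable_measure_prodMk_left hS').aemeasurable ha' ENNReal.ofReal_ne_top).trans ?_)
  rw [← Measure.prod_apply hS', measure_toMeasurable]
  refine ENNReal.div_le_of_le_mul (h.trans_eq ?_)
  rw [mul_comm, ENNReal.ofReal_mul' ha.le]

theorem measure_prod_fst_mem_le {α β : Type*} [MeasurableSpace α] [MeasurableSpace β]
    {μ : Measure α} {ν : Measure β} [SFinite μ] [IsProbabilityMeasure ν] (A : Set α) :
    (μ.prod ν) {q | q.1 ∈ A} ≤ μ A := by
  have : {q : α × β | q.1 ∈ A} = A ×ˢ Set.univ := by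
    ext q
    simp
  rw [this, Measure.prod_prod, measure_univ, mul_one]

/-- The joint bound. The sup over `[0, T]` is reduced to the times `k / √N`; outside the event
that the tensor is large, the velocity moves too little between them to matter. -/
theorem noiseLaw_prod_uniformStiefel_condition0_le {p r : ℕ} (hp : 1 ≤ p) (hr : 1 ≤ r)
    {lam : Fin r → ℝ} {Λ : ℝ} (hΛ0 : 0 < Λ) (h0 : ∀ j, 0 ≤ lam j) (hΛ : ∀ j, lam j ≤ Λ) {β : ℝ}
    (hβ : β = (1 + r) * Λ * p * 2 ^ p * √(8 * p)) {N : ℕ} (hrN : r ≤ N) {M : ℕ} (hM : 1 ≤ M)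
    {V : Matrix (Fin N) (Fin r) ℝ} (hV : V ∈ stiefel N r) {γ T : ℝ}
    (hγ : 4 * p * β ^ 2 ≤ γ) (hT : 0 < T) :
    (noiseLaw p N).prod (uniformStiefel N r) {q | q.2 ∉ condition0InftySet M lam V q.1 T γ}
      ≤ ENNReal.ofReal
        (12 * r ^ 2 * max 1 (√(N : ℝ) * T) * Real.exp (-(1 / (32 * β ^ 2)) * γ ^ 2)) := by
  have hN : N ≠ 0 := by omega
  have hN0 : 0 < √(N : ℝ) := by positivity
  have hp0 : (0 : ℝ) < p := by exact_mod_cast hp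
  set κ : ℝ := (1 + r) * Λ * p * 2 ^ p with hκ
  have hκ0 : 0 < κ := by positivity
  have hβ0 : 0 < β := by rw [hβ]; positivity
  have hγ0 : 0 < γ := lt_of_lt_of_le (by positivity) hγ
  have hβκ : β ^ 2 = κ ^ 2 * (8 * p) := by
    rw [hβ, mul_pow, Real.sq_sqrt (by positivity)]
  -- The tensor is large with probability `2 exp (-γ² / (4 κ²))`.
  set y := γ ^ 2 / (4 * κ ^ 2) with hy
  have hy0 : 0 ≤ y := by positivity
  set E := {W : NoiseTensor p N | 2 ^ p * √(4 * p * N + 2 * y) < ‖tensorForm W‖} with hE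
  set e := Real.exp (-(1 / (32 * β ^ 2)) * γ ^ 2) with he
  have hEe : noiseLaw p N E ≤ ENNReal.ofReal (2 * e) := by
    refine (noiseLaw_sqrt_lt_norm_tensorForm_le p N hy0).trans (ENNReal.ofReal_le_ofReal ?_)
    rw [he]
    gcongr
    have h1 : 1 / (32 * β ^ 2) * γ ^ 2 ≤ y := by
      rw [hy, hβκ, one_div_mul_eq_div]
      have h1p : (1 : ℝ) ≤ p := by exact_mod_cast hp
      gcongr
      · norm_num
      · exact le_mul_of_one_le_right (sq_nonneg κ) (by linarith)
    linarith
  have hnorm : ∀ W ∉ E, (1 + r) * Λ * p * ‖tensorForm W‖ ≤ √(κ ^ 2 * (4 * p * N + 2 * y)) := by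
    intro W hW
    have hW : ‖tensorForm W‖ ≤ 2 ^ p * √(4 * p * N + 2 * y) := not_lt.mp hW
    rw [Real.sqrt_mul' _ (by positivity), Real.sqrt_sq hκ0.le]
    calc (1 + r) * Λ * p * ‖tensorForm W‖
        ≤ (1 + r) * Λ * p * (2 ^ p * √(4 * p * N + 2 * y)) := by gcongr
      _ = _ := by rw [hκ]; ring
  have hκy : κ ^ 2 * (4 * p * N + 2 * y) = (β ^ 2 * N + γ ^ 2) / 2 := by
    rw [hβκ, hy]
    field_simp
    ring
  have hstiefel : (noiseLaw p N).prod (uniformStiefel N r) {q | q.2 ∉ stiefel N r} = 0 := by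
    have : {q : NoiseTensor p N × Matrix (Fin N) (Fin r) ℝ | q.2 ∉ stiefel N r}
        = Set.univ ×ˢ (stiefel N r)ᶜ := by
      ext q
      simp
    rw [this, Measure.prod_prod, uniformStiefel_compl_stiefel hrN, mul_zero]
  set m := max 1 (√(N : ℝ) * T) with hm
  have hm1 : 1 ≤ m := le_max_left _ _
  have hr1 : (1 : ℝ) ≤ r := by exact_mod_cast hr
  rcases le_total (β * √(N : ℝ)) γ with hcase | hcase
  · -- For large `γ` the deterministic bound on the velocity suffices.
    have hsub : {q : NoiseTensor p N × Matrix (Fin N) (Fin r) ℝ |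
        q.2 ∉ condition0InftySet M lam V q.1 T γ} ⊆ {q | q.2 ∉ stiefel N r} ∪ {q | q.1 ∈ E} := by
      intro q hq
      by_contra hcon
      simp only [Set.mem_union, Set.mem_ofPred_eq, not_or, not_not] at hcon
      refine hq ⟨hcon.1, fun i j t ht => ?_⟩
      have h1 := abs_noiseGen_corr_le hN hp hM h0 hΛ q.1 hV i j
        ((isNoiseTrajectory_noiseFlow hN M lam q.1 hcon.1).mem t ht.1)
      refine h1.trans ?_
      gcongr
      refine (hnorm q.1 hcon.2).trans (Real.sqrt_le_iff.mpr ⟨hγ0.le, ?_⟩)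
      rw [hκy]
      have h2 : (β * √(N : ℝ)) ^ 2 ≤ γ ^ 2 := by gcongr
      rw [mul_pow, Real.sq_sqrt (Nat.cast_nonneg N)] at h2
      linarith
    refine (measure_mono hsub).trans ((measure_union_le _ _).trans ?_)
    rw [hstiefel, zero_add]
    refine (measure_prod_fst_mem_le E).trans (hEe.trans (ENNReal.ofReal_le_ofReal ?_))
    have h3 : (1 : ℝ) ≤ r ^ 2 * m := by nlinarith
    have he0 : 0 < e := Real.exp_pos _
    nlinarith
  · have hEβ : ∀ W ∉ E, (1 + r) * Λ * p * ‖tensorForm W‖ ≤ β * √(N : ℝ) := by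
      intro W hW
      refine (hnorm W hW).trans (Real.sqrt_le_iff.mpr ⟨by positivity, ?_⟩)
      rw [hκy, mul_pow, Real.sq_sqrt (Nat.cast_nonneg N)]
      have h2 : γ ^ 2 ≤ (β * √(N : ℝ)) ^ 2 := by gcongr
      rw [mul_pow, Real.sq_sqrt (Nat.cast_nonneg N)] at h2
      linarith
    set n := ⌊√(N : ℝ) * T⌋₊ + 1 with hn
    let B : Fin r × Fin r × ℕ → Set (NoiseTensor p N × Matrix (Fin N) (Fin r) ℝ) := fun z =>
      {q | q.2 ∈ stiefel N r ∧ γ / 2 / √(N : ℝ) ≤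
        |noiseGen M lam q.1 (corr V z.1 z.2.1) (noiseFlow M lam q.1 (z.2.2 / √(N : ℝ)) q.2)|}
    let I : Finset (Fin r × Fin r × ℕ) := Finset.univ ×ˢ Finset.univ ×ˢ Finset.range n
    have hB : ∀ z, (noiseLaw p N).prod (uniformStiefel N r) (B z) ≤ ENNReal.ofReal (5 * e) := by
      intro z
      refine (noiseLaw_prod_uniformStiefel_noiseGen_ge_le hN hrN hp hM h0 hΛ hV z.1 z.2.1
        (by positivity) hβ0 (half_pos hγ0)).trans ?_
      have h1 : {W : NoiseTensor p N | β * √(N : ℝ) < (1 + r) * Λ * p * ‖tensorForm W‖} ⊆ E := by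
        intro W hW
        by_contra hWE
        exact absurd (hEβ W hWE) (not_le.mpr hW)
      have h2 : Real.exp (-(γ / 2 / β) ^ 2 / 8) = e := by
        rw [he]
        congr 1
        field_simp
        norm_num
      rw [h2]
      refine (add_le_add_left ((measure_mono h1).trans hEe) _).trans_eq ?_
      rw [← ENNReal.ofReal_add (by positivity) (by positivity)]
      congr 1
      ring
    have hsub : {q : NoiseTensor p N × Matrix (Fin N) (Fin r) ℝ |
        q.2 ∉ condition0InftySet M lam V q.1 T γ}
        ⊆ ({q | q.2 ∉ stiefel N r} ∪ {q | q.1 ∈ E}) ∪ ⋃ z ∈ I, B z := by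
      intro q hq
      by_contra hcon
      simp only [Set.mem_union, Set.mem_ofPred_eq, not_or, not_not, Set.mem_iUnion,
        not_exists] at hcon
      obtain ⟨⟨hX, hW⟩, hBq⟩ := hcon
      refine hq ⟨hX, fun i j t ht => ?_⟩
      -- The last grid time before `t`.
      set k := ⌊√(N : ℝ) * t⌋₊ with hk
      have hkt : (k : ℝ) ≤ √(N : ℝ) * t := Nat.floor_le (mul_nonneg hN0.le ht.1)
      have htk : √(N : ℝ) * t < k + 1 := Nat.lt_floor_add_one _
      have hkn : k < n := Nat.lt_succ_of_le (Nat.floor_le_floor (by gcongr; exact ht.2))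
      have hz : (i, j, k) ∈ I := by simp [I, hkn]
      have hlt : |noiseGen M lam q.1 (corr V i j) (noiseFlow M lam q.1 (k / √(N : ℝ)) q.2)|
          < γ / 2 / √(N : ℝ) := by
        by_contra hge
        exact hBq _ hz ⟨hX, not_lt.mp hge⟩
      have hstep := (isNoiseTrajectory_noiseFlow hN M lam q.1 hX).abs_noiseGen_corr_sub_le hN hp hM
        h0 hΛ hV i j (s := k / √(N : ℝ)) (t := t) (by positivity)
        (by rw [div_le_iff₀ hN0]; linarith)
        (by rw [sub_le_iff_le_add, ← add_div, le_div_iff₀ hN0]; linarith) (hEβ q.1 hW)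
      refine hstep.trans ?_
      have h3 : 2 * p * β ^ 2 / √(N : ℝ) ≤ γ / 2 / √(N : ℝ) := by
        gcongr
        linarith
      calc _ ≤ γ / 2 / √(N : ℝ) + γ / 2 / √(N : ℝ) := add_le_add hlt.le h3
        _ = γ / √(N : ℝ) := by ring
    have hn2 : (n : ℝ) ≤ 2 * m := by
      have h1 : ((⌊√(N : ℝ) * T⌋₊ : ℕ) : ℝ) ≤ √(N : ℝ) * T := Nat.floor_le (by positivity)
      have h2 : √(N : ℝ) * T ≤ m := le_max_right _ _
      rw [hn]
      push_cast
      linarith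
    refine (measure_mono hsub).trans ((measure_union_le _ _).trans
      ((add_le_add (measure_union_le _ _) (measure_biUnion_finset_le _ _)).trans ?_))
    rw [hstiefel, zero_add]
    refine (add_le_add ((measure_prod_fst_mem_le E).trans hEe)
      (Finset.sum_le_sum fun z _ => hB z)).trans ?_
    have he0 : 0 < e := Real.exp_pos _
    rw [Finset.sum_const, nsmul_eq_mul, ← ENNReal.ofReal_natCast,
      ← ENNReal.ofReal_mul (Nat.cast_nonneg _),
      ← ENNReal.ofReal_add (by positivity) (by positivity)]
    refine ENNReal.ofReal_le_ofReal ?_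
    have hcard : ((I.card : ℕ) : ℝ) = r ^ 2 * n := by
      simp only [I, Finset.card_product, Finset.card_univ, Fintype.card_fin, Finset.card_range]
      push_cast
      ring
    rw [hcard]
    have h3 : (1 : ℝ) ≤ r ^ 2 * m := by nlinarith
    have h4 : (r : ℝ) ^ 2 * n ≤ r ^ 2 * (2 * m) := by gcongr
    calc 2 * e + r ^ 2 * n * (5 * e) ≤ 2 * (r ^ 2 * m) * e + r ^ 2 * (2 * m) * (5 * e) := by
          gcongr
          linarith
      _ = _ := by ring

/-- The exponent is half that of the joint bound, which leaves a factor `e^{-c γ₀²}` to spend on the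
Markov inequality in the tensor. -/
theorem weaklySatisfiesCondition0Infty_uniformStiefel {r : ℕ} (hr : 1 ≤ r) {p : ℕ} (hp : 1 ≤ p)
    {lam : Fin r → ℝ} (h0 : ∀ j, 0 ≤ lam j) :
    ∃ C c : ℝ, 0 < C ∧ 0 < c ∧
      ∀ V : (N : ℕ) → Matrix (Fin N) (Fin r) ℝ, (∀ N, r ≤ N → V N ∈ stiefel N r) →
      ∀ M : ℕ, 1 ≤ M →
        WeaklySatisfiesCondition0Infty p M lam V (fun N => uniformStiefel N r) C c := by
  obtain ⟨Λ, hΛ0, hΛ⟩ : ∃ Λ : ℝ, 0 < Λ ∧ ∀ j, lam j ≤ Λ := by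
    refine ⟨∑ j, lam j + 1, ?_, fun j => ?_⟩
    · have := Finset.sum_nonneg (s := Finset.univ) fun j _ => h0 j
      linarith
    have := Finset.single_le_sum (fun j _ => h0 j) (Finset.mem_univ j)
    linarith
  set β : ℝ := (1 + r) * Λ * p * 2 ^ p * √(8 * p) with hβ
  have hp0 : (0 : ℝ) < p := by exact_mod_cast hp
  have hβ0 : 0 < β := by positivity
  set c₀ : ℝ := 1 / (32 * β ^ 2) with hc₀
  have hc₀0 : 0 < c₀ := by positivity
  -- The constant makes the bound trivial for `γ < 4 p β²`.
  set C : ℝ := 12 * r ^ 2 + Real.exp (c₀ * (4 * p * β ^ 2) ^ 2) with hC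
  have hexp1 : 1 ≤ Real.exp (c₀ * (4 * p * β ^ 2) ^ 2) := Real.one_le_exp (by positivity)
  have hC1 : 1 ≤ C := by
    have : (0 : ℝ) ≤ 12 * r ^ 2 := by positivity
    linarith
  have hC0 : 0 < C := by linarith
  refine ⟨C, c₀ / 2, hC0, by positivity, fun V hV M hM N hN γ T hγ hT => ?_⟩
  set m := max 1 (√(N : ℝ) * T) with hm
  have hm1 : 1 ≤ m := le_max_left _ _
  have hjoint : (noiseLaw p N).prod (uniformStiefel N r)
      {q | q.2 ∉ condition0InftySet M lam (V N) q.1 T γ}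
      ≤ ENNReal.ofReal (C * m * Real.exp (-c₀ * γ ^ 2)) := by
    rcases le_total (4 * p * β ^ 2) γ with h | h
    · refine (noiseLaw_prod_uniformStiefel_condition0_le hp hr hΛ0 h0 hΛ hβ hN hM (hV N hN) h
        hT).trans (ENNReal.ofReal_le_ofReal ?_)
      gcongr
      linarith [Real.exp_pos (c₀ * (4 * p * β ^ 2) ^ 2)]
    · refine prob_le_one.trans ?_
      rw [← ENNReal.ofReal_one]
      refine ENNReal.ofReal_le_ofReal ?_
      have h1 : Real.exp (c₀ * γ ^ 2) ≤ C := by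
        have : Real.exp (c₀ * γ ^ 2) ≤ Real.exp (c₀ * (4 * p * β ^ 2) ^ 2) := by gcongr
        have h12 : (0 : ℝ) ≤ 12 * r ^ 2 := by positivity
        linarith
      calc (1 : ℝ) = Real.exp (c₀ * γ ^ 2) * 1 * Real.exp (-c₀ * γ ^ 2) := by
            rw [mul_one, ← Real.exp_add]
            simp
        _ ≤ C * m * Real.exp (-c₀ * γ ^ 2) := by gcongr
  constructor
  · refine hjoint.trans (ENNReal.ofReal_le_ofReal ?_)
    gcongr
    linarith
  · refine measure_lt_measure_slice_le
      (S := {q | q.2 ∉ condition0InftySet M lam (V N) q.1 T γ}) (by positivity)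
      (hjoint.trans (ENNReal.ofReal_le_ofReal ?_))
    have h2 : Real.exp (-c₀ * γ ^ 2)
        = Real.exp (-(c₀ / 2) * γ ^ 2) * Real.exp (-(c₀ / 2) * γ ^ 2) := by
      rw [← Real.exp_add]
      congr 1
      ring
    rw [h2]
    calc C * m * (Real.exp (-(c₀ / 2) * γ ^ 2) * Real.exp (-(c₀ / 2) * γ ^ 2))
        ≤ C * m * (Real.exp (-(c₀ / 2) * γ ^ 2) * Real.exp (-(c₀ / 2) * γ ^ 2)) * C :=
          le_mul_of_one_le_right (by positivity) hC1
      _ = _ := by ring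

theorem mainTheorem6 (r : ℕ) (hr : 1 ≤ r) :
    -- Condition 1
    (∃ C₁ c₁ C₂ c₂ C₃ : ℝ, 0 < C₁ ∧ 0 < c₁ ∧ 0 < C₂ ∧ 0 < c₂ ∧ 0 < C₃ ∧
      ∀ V : (N : ℕ) → Matrix (Fin N) (Fin r) ℝ, (∀ N, r ≤ N → V N ∈ stiefel N r) →
        SatisfiesCondition1 V (fun N => uniformStiefel N r) C₁ c₁ C₂ c₂ C₃) ∧
    -- Condition 2
    (∃ C₁ c₁ C₂ c₂ C₃ : ℝ, 0 < C₁ ∧ 0 < c₁ ∧ 0 < C₂ ∧ 0 < c₂ ∧ 0 < C₃ ∧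
      ∀ (p : ℕ) (lam : Fin r → ℝ), 3 ≤ p → Antitone lam → (∀ i, 0 < lam i) →
      ∀ V : (N : ℕ) → Matrix (Fin N) (Fin r) ℝ, (∀ N, r ≤ N → V N ∈ stiefel N r) →
        SatisfiesCondition2 p lam V (fun N => uniformStiefel N r) C₁ c₁ C₂ c₂ C₃) ∧
    -- Condition 0 at level infinity, in the weak sense
    (∀ (p : ℕ) (lam : Fin r → ℝ), 3 ≤ p → Antitone lam → (∀ i, 0 ≤ lam i) →
      ∃ C c : ℝ, 0 < C ∧ 0 < c ∧
      ∀ V : (N : ℕ) → Matrix (Fin N) (Fin r) ℝ, (∀ N, r ≤ N → V N ∈ stiefel N r) →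
      ∀ M : ℕ, 1 ≤ M →
        WeaklySatisfiesCondition0Infty p M lam V (fun N => uniformStiefel N r) C c) := by
  refine ⟨⟨3 * r ^ 2, 1 / 8, 1, 1, 8 * r ^ 2, by positivity, by norm_num, by norm_num, by norm_num,
    by positivity, fun V hV => satisfiesCondition1_uniformStiefel hr V hV⟩,
    ⟨3 * r ^ 2, 1 / 8, Real.exp 1, 1, 3136 * r ^ 4, by positivity, by norm_num, by positivity,
      by norm_num, by positivity,
      fun p lam hp _ hlam V hV => satisfiesCondition2_uniformStiefel hr hp hlam V hV⟩,
    fun p lam hp _ hlam => weaklySatisfiesCondition0Infty_uniformStiefel hr (by omega) hlam⟩
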